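/- **Theorem.** Let $F^1=(K^1,\phi^1)$ and $F^2=(K^2,\phi^2)$ be bi-filtrations of finite simplicial complexes, i.e. $\phi^i:K^i\to[0,\infty)^2$ is monotone with respect to inclusion of faces and the componentwise order. Let $n$ be the total number of simplices of $K^1$ and $K^2$, let $X$ and $Y$ be the maximal $x$- and $y$-coordinate among all critical values $\phi^i(\sigma)$, and let $C=\max\{X,Y\}$. Fix a homological dimension $p\ge 0$ (homology is taken over $\mathbb{Z}/2$) and let $\varepsilon>0$. For a line $L$ of positive slope with origin $\mathcal O\in L$ and angle $\gamma\in(0,\pi/2)$ with the $x$-axis, the push of $x\in\mathbb{R}^2$ is the signed distance from $\mathcal O$ of the minimal point $q\in L$ with $x\le q$; the restriction $\mathrm{restr}(F^i,L)$ is the mono-filtration of $K^i$ whose critical values are the pushes of the values $\phi^i(\sigma)$; the weight $w(L)$ is $\sin\gamma$ if $\gamma\le\pi/4$ and $\cos\gamma$ otherwise. Let $$d_{\mathrm{match}}=\sup_L w(L)\,d_B(\mathrm{restr}(F^1,L),\mathrm{restr}(F^2,L))\in[0,\infty],$$ where $d_B$ is the bottleneck distance of the persistence diagrams in dimension $p$.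 The relative $(1+\varepsilon)$-approximation algorithm works as follows. A slice is encoded by a type ($x$ or $y$, flat or steep) and a pair $(\lambda,\mu)$, where $\lambda$ is its slope (flat) or inverse slope (steep) and $\mu$ is its intercept with the nonnegative $x$- or $y$-axis. A FIFO queue initially contains the boxes $[0,1]\times[0,Y]$ for both $y$-types and $[0,1]\times[0,X]$ for both $x$-types, and $\rho=0$. While the queue is non-empty, a box $B$ is removed; the bottleneck distance $e$ of the weighted restrictions (pushes multiplied by $w(L)$) onto the center slice of $B$ is computed, by the standard matrix reduction for both persistence diagrams and by successive augmentation along bottleneck-shortest paths for the distance of the diagrams; $\rho$ is replaced by $\max\{\rho,e\}$; and if $v_1+e+v_2>(1+\varepsilon)\rho$, then the four quarters of $B$ are appended to the queue with the same type. Here $v_i$ is either (linear bound) the maximum over the critical values of $F^i$ and the four corners of $B$ of the absolute difference of the weighted pushes onto the corner slice and the center slice, or (constant bound), for $B$ with width $\Delta\lambda$, height $\Delta\mu$, lower edge $\mu_{\min}$ and center $(\lambda_c,\mu_c)$, the number $\frac12(\Delta\mu+X\Delta\lambda)$, $\frac12(\lambda_c\Delta\mu+(Y-\mu_{\min})\Delta\lambda)$,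 $\frac12(\lambda_c\Delta\mu+(X-\mu_{\min})\Delta\lambda)$, $\frac12(\Delta\mu+Y\Delta\lambda)$ for flat $y$-, steep $y$-, flat $x$-, steep $x$-slices, respectively. When the queue is empty, $\delta=(1+\varepsilon)\rho$ is returned. Steps are counted on a random access machine with unit-cost real arithmetic. There is an absolute constant $A$ such that, for all such data with $d_{\mathrm{match}}>0$ and for both versions of the bound, the algorithm terminates, its output satisfies $d_{\mathrm{match}}\le\delta\le(1+\varepsilon)\,d_{\mathrm{match}}$, and its total number of steps is at most $$A\,n^3\left(\frac{C(1+\varepsilon)}{\varepsilon\,d_{\mathrm{match}}}\right)^2$$ if $d_{\mathrm{match}}<\infty$, and at most $A\,n^3$ if $d_{\mathrm{match}}=\infty$. -/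

import Mathlib

open scoped ENNReal

universe u v

/-! ## Bi-filtrations -/

/-- A finite simplicial complex over the base set `V`, given as a repetition-free list
`simplex 0, …, simplex (size - 1)` of its simplices. -/
structure FinComplex (V : Type*) where
  size : ℕ
  simplex : Fin size → Finset V
  simplex_injective : Function.Injective simplex
  simplex_nonempty : ∀ i, (simplex i).Nonempty
  face_mem : ∀ i (τ : Finset V), τ.Nonempty → τ ⊆ simplex i → ∃ j, simplex j = τ

/-- A (1-critical) bi-filtration: every simplex carries a critical value in the plane, and
critical values are monotone for the componentwise order of `ℝ × ℝ`. -/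
structure BiFiltration (V : Type*) extends FinComplex V where
  crit : Fin size → ℝ × ℝ
  crit_mono : ∀ i j, simplex i ⊆ simplex j → crit i ≤ crit j

/-! ## Persistence diagrams of mono-filtrations

A mono-filtration is a complex `K` with real critical values `f : Fin K.size → ℝ` of its simplices.
Homology is simplicial homology with coefficients in `ZMod 2`. -/

namespace FinComplex

variable {V : Type*} [DecidableEq V] (K : FinComplex V)

/-- `simplex i` is a codimension-one face of `simplex j`. -/
def IsFacet (i j : Fin K.size) : Prop :=
  K.simplex i ⊆ K.simplex j ∧ (K.simplex j).card = (K.simplex i).card + 1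

instance (i j : Fin K.size) : Decidable (K.IsFacet i j) := by
  unfold IsFacet; infer_instance

/-- The simplicial boundary map on all chains of `K`. -/
def boundaryMap : (Fin K.size → ZMod 2) →ₗ[ZMod 2] (Fin K.size → ZMod 2) :=
  Matrix.mulVecLin (Matrix.of fun i j => if K.IsFacet i j then (1 : ZMod 2) else 0)

/-- The `p`-chains supported on a set `S` of simplices. -/
def chains (p : ℕ) (S : Set (Fin K.size)) : Submodule (ZMod 2) (Fin K.size → ZMod 2) where
  carrier := {c | ∀ i, ¬ (i ∈ S ∧ (K.simplex i).card = p + 1) → c i = 0}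
  add_mem' := fun ha hb i hi => by simp [ha i hi, hb i hi]
  zero_mem' := fun _ _ => rfl
  smul_mem' := fun r _ hc i hi => by simp [hc i hi]

/-- The `p`-cycles of the subcomplex `S`. -/
def cycles (p : ℕ) (S : Set (Fin K.size)) : Submodule (ZMod 2) (Fin K.size → ZMod 2) :=
  K.chains p S ⊓ LinearMap.ker K.boundaryMap

/-- The `p`-boundaries of the subcomplex `S`. -/
def boundaries (p : ℕ) (S : Set (Fin K.size)) : Submodule (ZMod 2) (Fin K.size → ZMod 2) :=
  (K.chains (p + 1) S).map K.boundaryMap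

/-- For subcomplexes `S ⊆ T`, the rank of `H_p(S) → H_p(T)`: its image is the image of the
cycles of `S` in the quotient by the boundaries of `T`. -/
noncomputable def persistentBetti (p : ℕ) (S T : Set (Fin K.size)) : ℕ :=
  Module.finrank (ZMod 2) ((K.cycles p S).map (K.boundaries p T).mkQ)

/-- The multiplicity of the point `(b, d)`, `b < d`, in the `p`-th persistence diagram: the number
of classes that are present at `b` but not before `b`, and that vanish at `d` but not before `d`.
(The subtraction is that of an inclusion-exclusion formula, and its result is nonnegative.) -/
noncomputable def finiteMult (f : Fin K.size → ℝ) (p : ℕ) (b d : ℝ) : ℕ :=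
  (K.persistentBetti p {i | f i ≤ b} {i | f i < d}
      + K.persistentBetti p {i | f i < b} {i | f i ≤ d})
    - (K.persistentBetti p {i | f i < b} {i | f i < d}
      + K.persistentBetti p {i | f i ≤ b} {i | f i ≤ d})

/-- The multiplicity of the point `(b, ∞)`. -/
noncomputable def infiniteMult (f : Fin K.size → ℝ) (p : ℕ) (b : ℝ) : ℕ :=
  K.persistentBetti p {i | f i ≤ b} Set.univ - K.persistentBetti p {i | f i < b} Set.univ

/-- The persistence diagram in homological dimension `p`, a multiset of points of
`ℝ × (ℝ ∪ {∞})` above the diagonal. Births and deaths occur only at critical values. -/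
noncomputable def diagram (f : Fin K.size → ℝ) (p : ℕ) : Multiset (ℝ × WithTop ℝ) :=
  ∑ b ∈ Finset.univ.image f,
    (Multiset.replicate (K.infiniteMult f p b) (b, (⊤ : WithTop ℝ))
      + ∑ d ∈ (Finset.univ.image f).filter (fun d => b < d),
          Multiset.replicate (K.finiteMult f p b d) (b, (d : WithTop ℝ)))

end FinComplex

/-! ## Bottleneck distance -/

/-- The cost of matching two points of persistence diagrams, with `∞ - ∞ = 0`. -/
noncomputable def matchCost : ℝ × WithTop ℝ → ℝ × WithTop ℝ → WithTop ℝ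
  | (b, some d), (b', some d') => ((max |b - b'| |d - d'| : ℝ) : WithTop ℝ)
  | (b, none), (b', none) => ((|b - b'| : ℝ) : WithTop ℝ)
  | (_, some _), (_, none) => ⊤
  | (_, none), (_, some _) => ⊤

/-- The cost of leaving a point of a persistence diagram unmatched. -/
noncomputable def unmatchedCost : ℝ × WithTop ℝ → WithTop ℝ
  | (b, some d) => (((d - b) / 2 : ℝ) : WithTop ℝ)
  | (_, none) => ⊤

/-- Costs as elements of `[0, ∞]`. -/
noncomputable def WithTop.toCost : WithTop ℝ → ℝ≥0∞
  | some x => ENNReal.ofReal x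
  | none => ⊤

/-- The cost of the partial matching between `D₁` and `D₂` whose matched pairs are `M`. -/
noncomputable def matchingCost (D₁ D₂ : Multiset (ℝ × WithTop ℝ))
    (M : Multiset ((ℝ × WithTop ℝ) × (ℝ × WithTop ℝ))) : ℝ≥0∞ :=
  (M.map fun q => (matchCost q.1 q.2).toCost).sup
    ⊔ ((D₁ - M.map Prod.fst).map fun x => (unmatchedCost x).toCost).sup
    ⊔ ((D₂ - M.map Prod.snd).map fun x => (unmatchedCost x).toCost).sup

/-- The bottleneck distance of two persistence diagrams. -/
noncomputable def bottleneckDist (D₁ D₂ : Multiset (ℝ × WithTop ℝ)) : ℝ≥0∞ :=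
  ⨅ (M : Multiset ((ℝ × WithTop ℝ) × (ℝ × WithTop ℝ)))
    (_ : M.map Prod.fst ≤ D₁ ∧ M.map Prod.snd ≤ D₂), matchingCost D₁ D₂ M

/-! ## Matching distance -/

/-- A slice: a line of positive slope with a distinguished origin, described by the origin and by
the angle with the `x`-axis. -/
structure Slice where
  origin : ℝ × ℝ
  angle : ℝ
  angle_pos : 0 < angle
  angle_lt : angle < Real.pi / 2

/-- The point of the slice at signed distance `t` from the origin. -/
noncomputable def Slice.point (L : Slice) (t : ℝ) : ℝ × ℝ :=
  L.origin + t • (Real.cos L.angle, Real.sin L.angle)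

/-- The push of `x` to `L`: the signed distance from the origin of `L` to the minimal point `q`
of `L` with `x ≤ q`. -/
noncomputable def Slice.push (L : Slice) (x : ℝ × ℝ) : ℝ :=
  sInf {t : ℝ | x ≤ L.point t}

/-- The weight of a slice: flat slices have slope at most one. -/
noncomputable def Slice.weight (L : Slice) : ℝ :=
  if L.angle ≤ Real.pi / 4 then Real.sin L.angle else Real.cos L.angle

/-- The matching distance of two bi-filtrations with respect to persistence diagrams in
homological dimension `p`; the critical values of the restriction of `F` to `L` are the pushes
of the critical values of `F`. -/
noncomputable def matchingDist {V₁ V₂ : Type*} [DecidableEq V₁] [DecidableEq V₂] (p : ℕ)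
    (F₁ : BiFiltration V₁) (F₂ : BiFiltration V₂) : ℝ≥0∞ :=
  ⨆ L : Slice, ENNReal.ofReal L.weight *
    bottleneckDist (F₁.diagram (fun i => L.push (F₁.crit i)) p)
      (F₂.diagram (fun i => L.push (F₂.crit i)) p)

/-- The maximal `x`-coordinate among all critical values of two bi-filtrations with nonnegative
critical values (`0` if there are no critical values). -/
noncomputable def maxX {V₁ V₂ : Type*} (F₁ : BiFiltration V₁) (F₂ : BiFiltration V₂) : ℝ :=
  ⨆ i : Fin F₁.size ⊕ Fin F₂.size,
    Sum.elim (fun j => (F₁.crit j).1) (fun j => (F₂.crit j).1) i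

/-- The maximal `y`-coordinate among all critical values of two bi-filtrations with nonnegative
critical values (`0` if there are no critical values). -/
noncomputable def maxY {V₁ V₂ : Type*} (F₁ : BiFiltration V₁) (F₂ : BiFiltration V₂) : ℝ :=
  ⨆ i : Fin F₁.size ⊕ Fin F₂.size,
    Sum.elim (fun j => (F₁.crit j).2) (fun j => (F₂.crit j).2) i

/-! ## Step counting

Algorithms are written in a monad that counts elementary steps on a random access machine with
unit-cost real arithmetic. One step pays for a bounded number of operations of the following kinds:
an arithmetic operation on or a comparison of two numbers (reals, `∞`, or indices), reading or
writing one array cell, and adding an item to or removing one from a list or queue. -/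

/-- A value together with the number of steps spent on its computation. -/
structure Timed (α : Type) where
  val : α
  steps : ℕ

namespace Timed

instance : Monad Timed where
  pure a := ⟨a, 0⟩
  bind x g := ⟨(g x.val).val, x.steps + (g x.val).steps⟩

/-- A value obtained by one step. -/
def one {α : Type} (a : α) : Timed α := ⟨a, 1⟩

/-- A value obtained by `k` steps. -/
def cost {α : Type} (k : ℕ) (a : α) : Timed α := ⟨a, k⟩

/-- Filling an array of length `n` whose `i`-th entry is computed by `g i`: one step for each
entry in addition to the steps for computing the entries. An array of length `n` is modelled by
a function on `Fin n`. -/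
def array {α : Type} {n : ℕ} (g : Fin n → Timed α) : Timed (Fin n → α) :=
  ⟨fun i => (g i).val, ∑ i, ((g i).steps + 1)⟩

end Timed

/-! ## Computing the persistence diagram -/

/-- Insertion into a sorted list. -/
def insertT {α : Type} (le : α → α → Bool) (a : α) : List α → Timed (List α)
  | [] => Timed.one [a]
  | b :: l =>
    if le a b then Timed.one (a :: b :: l)
    else do
      let l' ← insertT le a l
      Timed.one (b :: l')

/-- Insertion sort. -/
def sortT {α : Type} (le : α → α → Bool) : List α → Timed (List α)
  | [] => Timed.one []
  | a :: l => do
    let l' ← sortT le l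
    insertT le a l'

/-- The reduction of one column `col` (with coefficients in `ZMod 2`, written as Booleans). The
given rows are scanned from the last one to the first one. At a nonzero entry, the column is
finished with this entry as its pivot if no earlier column has the same pivot; otherwise that
earlier column, which is recorded in `owner` and stored in `R`, is added. The result is the
reduced column and its pivot. -/
def reduceCol {n : ℕ} (R : Fin n → Fin n → Bool) (owner : Fin n → Option (Fin n)) :
    (Fin n → Bool) → List (Fin n) → Timed ((Fin n → Bool) × Option (Fin n))
  | col, [] => Timed.one (col, none)
  | col, r :: rows =>
    if col r then
      match owner r with
      | none => Timed.one (col, some r)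
      | some i => do
        let col' ← Timed.array fun k => Timed.one (xor (col k) (R i k))
        let res ← reduceCol R owner col' rows
        Timed.one res
    else do
      let res ← reduceCol R owner col rows
      Timed.one res

/-- The state of the matrix reduction. -/
structure ReductionState (n : ℕ) where
  /-- the columns of the matrix -/
  R : Fin n → Fin n → Bool
  /-- for each row, the reduced column that has its pivot there -/
  owner : Fin n → Option (Fin n)
  /-- whether the column has been reduced to a nonzero column -/
  negative : Fin n → Bool

/-- The reduction of the columns in a list, from the first one to the last one. -/
def reduceAll {n : ℕ} (rows : List (Fin n)) :
    ReductionState n → List (Fin n) → Timed (ReductionState n)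
  | s, [] => Timed.one s
  | s, j :: js => do
    let (col, pivot) ← reduceCol s.R s.owner (s.R j) rows
    let s' ← Timed.one (match pivot with
      | none => { s with R := Function.update s.R j col }
      | some r =>
        { R := Function.update s.R j col
          owner := Function.update s.owner r (some j)
          negative := Function.update s.negative j true })
    reduceAll rows s' js

/-- Reading off the points of the persistence diagram in dimension `p` from the reduced matrix:
a row that carries the pivot of a column yields a birth-death pair, the index of a zero column
without such a partner yields a point at infinity. -/
noncomputable def collectPoints {n : ℕ} (p : ℕ) (card : Fin n → ℕ) (f : Fin n → ℝ)
    (s : ReductionState n) : List (Fin n) → Timed (List (ℝ × WithTop ℝ))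
  | [] => Timed.one []
  | i :: is => do
    let pts ← collectPoints p card f s is
    Timed.one (
      if card i = p + 1 then
        match s.owner i with
        | some j => if f i < f j then (f i, ((f j : ℝ) : WithTop ℝ)) :: pts else pts
        | none => if s.negative i then pts else (f i, ⊤) :: pts
      else pts)

/-- The standard persistence algorithm: sort the simplices compatibly with the critical values `f`
and the dimension, reduce the boundary matrix from left to right, and read off the pairs.
A simplex is given as the list of its vertices, so that one pays the number of vertices to determine
the dimension of a simplex, and the product of the numbers of vertices to decide whether a simplex
is a facet of another one. -/
noncomputable def persistenceAlg {V : Type*} [DecidableEq V] (K : FinComplex V)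
    (f : Fin K.size → ℝ) (p : ℕ) : Timed (List (ℝ × WithTop ℝ)) := do
  let card ← Timed.array fun i => Timed.cost (K.simplex i).card (K.simplex i).card
  let bdry ← Timed.array fun j => Timed.array fun i =>
    Timed.cost ((K.simplex i).card * (K.simplex j).card) (decide (K.IsFacet i j))
  let order ← sortT (fun i j => decide (f i < f j ∨ (f i = f j ∧ card i ≤ card j)))
    (List.finRange K.size)
  let rows ← Timed.cost K.size order.reverse
  let owner ← Timed.array fun _ => Timed.one none
  let negative ← Timed.array fun _ => Timed.one false
  let s ← reduceAll rows ⟨bdry, owner, negative⟩ order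
  collectPoints p card f s order

/-! ## Computing the bottleneck distance

The bottleneck distance is the bottleneck value of a perfect matching in a complete bipartite graph
on the points of both diagrams and as many diagonal slots. The matching is built by
successive augmentation along paths whose largest edge cost is minimal. -/

/-- A matching between `N` left and `N` right vertices. -/
structure BipMatching (N : ℕ) where
  ofLeft : Fin N → Option (Fin N)
  ofRight : Fin N → Option (Fin N)

/-- An unvisited right vertex in a list with minimal `slack`, if there is one. -/
noncomputable def argminT {N : ℕ} (visited : Fin N → Bool) (slack : Fin N → WithTop ℝ) :
    List (Fin N) → Timed (Option (Fin N))
  | [] => Timed.one none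
  | v :: vs => do
    let best ← argminT visited slack vs
    Timed.one (
      if visited v then best
      else match best with
        | none => some v
        | some u => if slack v ≤ slack u then some v else some u)

/-- Growing a tree of alternating paths. `slack w` is the least cost of an edge from a left vertex
of the tree to the right vertex `w`, attained at the left vertex `parent w`; `θ` is the largest edge
cost used so far. In each round, the cheapest right vertex `v` outside of the tree is reached. If it
is unmatched, it is returned; otherwise, its partner joins the tree. The first argument bounds
the number of rounds. -/
noncomputable def growTree {N : ℕ} (c : Fin N → Fin N → WithTop ℝ)
    (ofRight : Fin N → Option (Fin N)) :
    ℕ → (Fin N → Bool) → (Fin N → WithTop ℝ) → (Fin N → Fin N) → WithTop ℝ →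
      Timed (Option (Fin N) × (Fin N → Fin N) × WithTop ℝ)
  | 0, _, _, parent, θ => Timed.one (none, parent, θ)
  | k + 1, visited, slack, parent, θ => do
    let best ← argminT visited slack (List.finRange N)
    match best with
    | none => Timed.one (none, parent, θ)
    | some v =>
      let θ' ← Timed.one (max θ (slack v))
      match ofRight v with
      | none => Timed.one (some v, parent, θ')
      | some l => do
        let visited' ← Timed.one (Function.update visited v true)
        let upd ← Timed.array fun w => Timed.one (
          if visited' w = false ∧ c l w < slack w then (c l w, l) else (slack w, parent w))
        growTree c ofRight k visited' (fun w => (upd w).1) (fun w => (upd w).2) θ'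

/-- Augmenting the matching along the tree path that ends in the right vertex `v`. The first
argument bounds the length of the path. -/
def augment {N : ℕ} (parent : Fin N → Fin N) : ℕ → Fin N → BipMatching N → Timed (BipMatching N)
  | 0, _, M => Timed.one M
  | k + 1, v, M => do
    let M' ← Timed.one
      { ofLeft := Function.update M.ofLeft (parent v) (some v)
        ofRight := Function.update M.ofRight v (some (parent v)) : BipMatching N }
    match M.ofLeft (parent v) with
    | none => Timed.one M'
    | some u => augment parent k u M'

/-- Matching the left vertices in a list one after the other; the result is the largest edge cost
that has been used. -/
noncomputable def assignAll {N : ℕ} (c : Fin N → Fin N → WithTop ℝ) :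
    List (Fin N) → BipMatching N → WithTop ℝ → Timed (WithTop ℝ)
  | [], _, θ => Timed.one θ
  | u :: us, M, θ => do
    let visited ← Timed.array fun _ => Timed.one false
    let slack ← Timed.array fun w => Timed.one (c u w)
    let parent ← Timed.array fun _ => Timed.one u
    let (v, parent', θ') ← growTree c M.ofRight N visited slack parent θ
    match v with
    | none => Timed.one θ'
    | some v => do
      let M' ← augment parent' N v M
      assignAll c us M' θ'

/-- The cost of an edge between two points (`some x`) or diagonal slots (`none`). -/
noncomputable def edgeCost : Option (ℝ × WithTop ℝ) → Option (ℝ × WithTop ℝ) → WithTop ℝ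
  | some x, some y => matchCost x y
  | some x, none => unmatchedCost x
  | none, some y => unmatchedCost y
  | none, none => 0

/-- The bottleneck distance of two persistence diagrams, stored in arrays. Left vertices are the
points of `D₁` followed by `D₂.length` diagonal slots, right vertices are the points of `D₂`
followed by `D₁.length` diagonal slots. -/
noncomputable def bottleneckAlg (D₁ D₂ : List (ℝ × WithTop ℝ)) : Timed (WithTop ℝ) := do
  let c ← Timed.array fun i : Fin (D₁.length + D₂.length) =>
    Timed.array fun j : Fin (D₁.length + D₂.length) =>
      Timed.one (edgeCost D₁[(i : ℕ)]? D₂[(j : ℕ)]?)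
  let ofLeft ← Timed.array fun _ => Timed.one none
  let ofRight ← Timed.array fun _ => Timed.one none
  assignAll c (List.finRange (D₁.length + D₂.length)) ⟨ofLeft, ofRight⟩ 0

/-! ## The approximation algorithm -/

/-- The type of a slice: its origin lies on the nonnegative `x`- or `y`-axis, and it is flat or
steep. -/
inductive SliceType where
  | xFlat
  | xSteep
  | yFlat
  | ySteep

/-- The weighted push of `x` onto the slice of a type with parameters `(lam, mu)`, where `lam` is the
slope of a flat slice and the inverse of the slope of a steep slice, and `mu` is the nontrivial
coordinate of the origin. In each case, the first alternative applies if `x` lies above the slice,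
the second one if `x` lies below; the relevant one is the larger one. -/
noncomputable def wpush (t : SliceType) (lam mu : ℝ) (x : ℝ × ℝ) : ℝ :=
  match t with
  | .xFlat => max x.2 (lam * (x.1 - mu))
  | .xSteep => max (lam * x.2) (x.1 - mu)
  | .yFlat => max (x.2 - mu) (lam * x.1)
  | .ySteep => max (lam * (x.2 - mu)) x.1

/-- The primitive `Eval`: the bottleneck distance of the weighted restrictions onto a slice. -/
noncomputable def evalPrim {V₁ V₂ : Type*} [DecidableEq V₁] [DecidableEq V₂] (p : ℕ)
    (F₁ : BiFiltration V₁) (F₂ : BiFiltration V₂) (t : SliceType) (lam mu : ℝ) :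
    Timed (WithTop ℝ) := do
  let f₁ ← Timed.array fun i => Timed.one (wpush t lam mu (F₁.crit i))
  let f₂ ← Timed.array fun i => Timed.one (wpush t lam mu (F₂.crit i))
  let D₁ ← persistenceAlg F₁.toFinComplex f₁ p
  let D₂ ← persistenceAlg F₂.toFinComplex f₂ p
  bottleneckAlg D₁ D₂

/-- The box `[lamMin, lamMax] × [muMin, muMax]` in the parameter space of slices. -/
structure ParamBox where
  lamMin : ℝ
  lamMax : ℝ
  muMin : ℝ
  muMax : ℝ

namespace ParamBox

noncomputable def lamMid (B : ParamBox) : ℝ := (B.lamMin + B.lamMax) / 2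

noncomputable def muMid (B : ParamBox) : ℝ := (B.muMin + B.muMax) / 2

/-- The four sub-boxes obtained by splitting at the center. -/
noncomputable def children (B : ParamBox) : List ParamBox :=
  [⟨B.lamMin, B.lamMid, B.muMin, B.muMid⟩, ⟨B.lamMid, B.lamMax, B.muMin, B.muMid⟩,
    ⟨B.lamMin, B.lamMid, B.muMid, B.muMax⟩, ⟨B.lamMid, B.lamMax, B.muMid, B.muMax⟩]

end ParamBox

/-- The maximum over the four corners of the box of the absolute difference between the weighted
pushes of `x` onto the corner slice and onto the center slice. -/
noncomputable def cornerVariation (t : SliceType) (B : ParamBox) (x : ℝ × ℝ) : ℝ :=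
  max
    (max |wpush t B.lamMin B.muMin x - wpush t B.lamMid B.muMid x|
      |wpush t B.lamMin B.muMax x - wpush t B.lamMid B.muMid x|)
    (max |wpush t B.lamMax B.muMin x - wpush t B.lamMid B.muMid x|
      |wpush t B.lamMax B.muMax x - wpush t B.lamMid B.muMid x|)

/-- The maximum of `0` and the values `g x` for `x` in a list. -/
noncomputable def maxT {α : Type} (g : α → ℝ) : List α → Timed ℝ
  | [] => Timed.one 0
  | x :: xs => do
    let m ← maxT g xs
    Timed.one (max (g x) m)

/-- The constant-time bound for the variation of the points of `[0, X] × [0, Y]` in a box. -/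
noncomputable def constantVariation (t : SliceType) (X Y : ℝ) (B : ParamBox) : ℝ :=
  match t with
  | .yFlat => ((B.muMax - B.muMin) + X * (B.lamMax - B.lamMin)) / 2
  | .ySteep => (B.lamMid * (B.muMax - B.muMin) + (Y - B.muMin) * (B.lamMax - B.lamMin)) / 2
  | .xFlat => (B.lamMid * (B.muMax - B.muMin) + (X - B.muMin) * (B.lamMax - B.lamMin)) / 2
  | .xSteep => ((B.muMax - B.muMin) + Y * (B.lamMax - B.lamMin)) / 2

/-- The two versions of the primitive `Bound`: local linear bound and local constant bound. -/
inductive BoundKind where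
  | linear
  | constant

/-- The primitive `Bound`; `e` is the bottleneck distance at the center slice of the box. -/
noncomputable def boundPrim {V₁ V₂ : Type*} (kind : BoundKind)
    (F₁ : BiFiltration V₁) (F₂ : BiFiltration V₂) (X Y : ℝ) (B : ParamBox) (t : SliceType)
    (e : WithTop ℝ) : Timed (WithTop ℝ) :=
  match kind with
  | .linear => do
    let v₁ ← maxT (fun i => cornerVariation t B (F₁.crit i)) (List.finRange F₁.size)
    let v₂ ← maxT (fun i => cornerVariation t B (F₂.crit i)) (List.finRange F₂.size)
    Timed.one ((v₁ : WithTop ℝ) + e + (v₂ : WithTop ℝ))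
  | .constant =>
    Timed.one ((constantVariation t X Y B : WithTop ℝ) + e
      + (constantVariation t X Y B : WithTop ℝ))

/-- The state of the approximation algorithm: the maximal coordinates of critical values, the FIFO
queue of boxes with their types, and the largest bottleneck distance encountered so far. -/
structure ApproxState where
  X : ℝ
  Y : ℝ
  queue : List (ParamBox × SliceType)
  rho : WithTop ℝ

/-- The initialization of the algorithm. -/
noncomputable def approxInit {V₁ V₂ : Type*} (F₁ : BiFiltration V₁) (F₂ : BiFiltration V₂) :
    Timed ApproxState := do
  let X₁ ← maxT (fun i => (F₁.crit i).1) (List.finRange F₁.size)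
  let X₂ ← maxT (fun i => (F₂.crit i).1) (List.finRange F₂.size)
  let Y₁ ← maxT (fun i => (F₁.crit i).2) (List.finRange F₁.size)
  let Y₂ ← maxT (fun i => (F₂.crit i).2) (List.finRange F₂.size)
  Timed.one
    { X := max X₁ X₂
      Y := max Y₁ Y₂
      queue := [(⟨0, 1, 0, max Y₁ Y₂⟩, .ySteep), (⟨0, 1, 0, max Y₁ Y₂⟩, .yFlat),
        (⟨0, 1, 0, max X₁ X₂⟩, .xSteep), (⟨0, 1, 0, max X₁ X₂⟩, .xFlat)]
      rho := 0 }

/-- The factor `1 + ε` times an extended real. -/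
noncomputable def scaleUp (ε : ℝ) (x : WithTop ℝ) : WithTop ℝ := x.map fun r => (1 + ε) * r

/-- One round of the main loop of the relative `(1 + ε)`-approximation algorithm: the first item of
the queue is processed. If the queue is empty, the algorithm has stopped, and nothing happens. -/
noncomputable def approxRound {V₁ V₂ : Type*} [DecidableEq V₁] [DecidableEq V₂] (kind : BoundKind)
    (p : ℕ) (ε : ℝ) (F₁ : BiFiltration V₁) (F₂ : BiFiltration V₂) (s : ApproxState) :
    Timed ApproxState :=
  match s.queue with
  | [] => pure s
  | (B, t) :: rest => do
    let e ← evalPrim p F₁ F₂ t B.lamMid B.muMid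
    let rho' ← Timed.one (max s.rho e)
    let m ← boundPrim kind F₁ F₂ s.X s.Y B t e
    if scaleUp ε rho' < m then
      Timed.one
        { s with queue := rest ++ B.children.map (fun B' => (B', t)), rho := rho' }
    else
      Timed.one { s with queue := rest, rho := rho' }

/-- The state of the relative `(1 + ε)`-approximation algorithm after initialization and `k` rounds
of the main loop, with the total number of steps. -/
noncomputable def approxRun {V₁ V₂ : Type*} [DecidableEq V₁] [DecidableEq V₂] (kind : BoundKind)
    (p : ℕ) (ε : ℝ) (F₁ : BiFiltration V₁) (F₂ : BiFiltration V₂) : ℕ → Timed ApproxState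
  | 0 => approxInit F₁ F₂
  | k + 1 => do
    let s ← approxRun kind p ε F₁ F₂ k
    approxRound kind p ε F₁ F₂ s

/-! Correctness. Moving the origin of a line along the line adds a constant to all pushes, and
multiplication by the weight turns them into one of the four expressions of `wpush`; the bottleneck
distance scales accordingly (`bottleneckDist_affine`). An intercept beyond the largest coordinate
acts like the largest coordinate (`wpush_min`). So the matching distance d is at most the supremum
of `sliceDist` over the four initial boxes, while every center slice is a genuine line, whence ρ ≤ d
throughout. By stability (`bottleneckDist_diagram_le`), distances within a box exceed the center
value e by at most v = v₁ + v₂, so a box that is not subdivided only contains values ≤ (1 + ε)ρ.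
Once the queue is empty, d ≤ (1 + ε)ρ ≤ (1 + ε)d.

Number of rounds (`LoopInvariant.round`). Let w be the width of a box. Both bounds satisfy v ≤ 2Cw,
and subdivision requires v + e > (1 + ε)ρ with e ≤ ρ, hence ερ < 2Cw. This must be converted into a
bound in terms of d, although ρ may still be far below d. Here the FIFO order enters: the processed
box is the widest one in the queue, and each queued box of width w' is initial or a quarter of an
evaluated box of width 2w', so its values are at most ρ + 4Cw'. Hence d ≤ max {(1 + ε)ρ, ρ + 4Cw},
and together εd ≤ 4C(1 + ε)w. So no box is narrower than ω = εd / (8C(1 + ε)), and counting the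
nodes of quadtrees with leaves of width ω gives O(1/ω²) rounds.

If d = ∞, stability makes every slice distance infinite, and the four initial boxes are settled at
once.

Subroutines. The reduced boundary matrix yields one family of vectors with distinct pivots that
contains bases of all cycle and boundary spaces of the filtration, so persistent Betti numbers
become counts of indices and the diagram is read off from the pairing (`diagram_eq`). This holds for
every ordering of the simplices along which the critical values increase weakly; in particular, two
functions with a common ordering have the same pairing, which is the source of stability. For the
bottleneck distance, diagrams are padded with diagonal slots, so that partial matchings become
perfect ones, and a pigeonhole argument shows that no augmentation uses a costlier edge than some
edge of any given perfect matching (`growTree_spec`). Each round takes O(n³) steps. -/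

/-! ## Pivots -/

section Pivot

variable {ι α : Type*}

/-- `a` is the last index, with respect to the ranks `r`, of a nonzero entry of `w`. -/
def IsPivot (r : ι → ℕ) (w : ι → ZMod 2) (a : ι) : Prop :=
  w a ≠ 0 ∧ ∀ k, r a < r k → w k = 0

theorem ZMod.eq_one_of_ne_zero_two {x : ZMod 2} (h : x ≠ 0) : x = 1 := by
  revert x; decide

theorem IsPivot.rank_le {r : ι → ℕ} {w : ι → ZMod 2} {a k : ι} (h : IsPivot r w a) (hk : w k ≠ 0) :
    r k ≤ r a := by
  by_contra hlt
  exact hk (h.2 k (not_le.mp hlt))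

theorem IsPivot.unique {r : ι → ℕ} (hr : Function.Injective r) {w : ι → ZMod 2} {a b : ι}
    (ha : IsPivot r w a) (hb : IsPivot r w b) : a = b :=
  hr (le_antisymm (hb.rank_le ha.1) (ha.rank_le hb.1))

/-- Among the vectors with nonzero coefficient, the one with the highest pivot is alone in reaching
that row, because pivots are distinct; its leading entry cannot cancel. -/
theorem exists_isPivot_sum {r : ι → ℕ} (hr : Function.Injective r) {u : α → ι → ZMod 2}
    {top : α → ι} (htop : Function.Injective top) (hu : ∀ a, IsPivot r (u a) (top a))
    (s : Finset α) (c : α → ZMod 2) (hc : ∃ a ∈ s, c a ≠ 0) :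
    ∃ a ∈ s, c a ≠ 0 ∧ IsPivot r (∑ b ∈ s, c b • u b) (top a) := by
  classical
  obtain ⟨a, ha, hmax⟩ := (s.filter fun a => c a ≠ 0).exists_max_image (fun a => r (top a))
    (by obtain ⟨a, ha, h⟩ := hc; exact ⟨a, by simp [ha, h]⟩)
  simp only [Finset.mem_filter] at ha hmax
  refine ⟨a, ha.1, ha.2, ?_, ?_⟩
  · rw [Finset.sum_apply, Finset.sum_eq_single_of_mem a ha.1]
    · exact mul_ne_zero ha.2 (hu a).1
    · intro b hb hba
      by_cases hcb : c b = 0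
      · simp [hcb]
      · have h1 := hmax b ⟨hb, hcb⟩
        have h2 : r (top b) ≠ r (top a) := fun h => hba (htop (hr h))
        simp [(hu b).2 (top a) (lt_of_le_of_ne h1 h2)]
  · intro k hk
    rw [Finset.sum_apply]
    refine Finset.sum_eq_zero fun b hb => ?_
    by_cases hcb : c b = 0
    · simp [hcb]
    · simp [(hu b).2 k ((hmax b ⟨hb, hcb⟩).trans_lt hk)]

theorem linearIndependent_of_isPivot {r : ι → ℕ} (hr : Function.Injective r)
    {u : α → ι → ZMod 2} {top : α → ι} (htop : Function.Injective top)
    (hu : ∀ a, IsPivot r (u a) (top a)) : LinearIndependent (ZMod 2) u := by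
  rw [linearIndependent_iff']
  intro s c h a ha
  by_contra hca
  obtain ⟨b, -, -, hb⟩ := exists_isPivot_sum hr htop hu s c ⟨a, ha, hca⟩
  exact hb.1 (by rw [h]; rfl)

/-- Gaussian elimination by pivots. -/
theorem eq_span_of_isPivot {r : ι → ℕ} (hr : Function.Injective r) [Finite ι]
    (W : Submodule (ZMod 2) (ι → ZMod 2)) {u : ι → ι → ZMod 2} (I : Set ι)
    (hu : ∀ i ∈ I, IsPivot r (u i) i) (huW : ∀ i ∈ I, u i ∈ W)
    (hW : ∀ z ∈ W, ∀ i, IsPivot r z i → i ∈ I) : W = Submodule.span (ZMod 2) (u '' I) := by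
  apply le_antisymm
  -- Induction on a bound for the ranks in the support: over `ZMod 2` both leading entries are 1, so
  -- subtracting `u k` removes the top row.
  · have key : ∀ m : ℕ, ∀ z ∈ W, (∀ k, z k ≠ 0 → r k < m) →
        z ∈ Submodule.span (ZMod 2) (u '' I) := by
      intro m
      induction m with
      | zero =>
        intro z _ h
        have : z = 0 := funext fun k => by
          by_contra hk
          exact absurd (h k hk) (Nat.not_lt_zero _)
        rw [this]; exact Submodule.zero_mem _
      | succ m ih =>
        intro z hz h
        by_cases hk : ∃ k, z k ≠ 0 ∧ r k = m
        · obtain ⟨k, hk, hkm⟩ := hk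
          have htop : IsPivot r z k := ⟨hk, fun j hj => by
            by_contra hzj
            have := h j hzj
            omega⟩
          have hkI := hW z hz k htop
          have h1 : z - u k ∈ Submodule.span (ZMod 2) (u '' I) := by
            refine ih _ (W.sub_mem hz (huW k hkI)) fun j hj => ?_
            have hle : r j ≤ m := by
              by_contra hlt
              rw [← hkm, not_le] at hlt
              exact hj (by simp [htop.2 j hlt, (hu k hkI).2 j hlt])
            refine lt_of_le_of_ne hle fun hjm => ?_
            obtain rfl : j = k := hr (hjm.trans hkm.symm)
            exact hj (by simp [ZMod.eq_one_of_ne_zero_two hk,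
              ZMod.eq_one_of_ne_zero_two (hu j hkI).1])
          have h2 := Submodule.add_mem _ h1
            (Submodule.subset_span (Set.mem_image_of_mem u hkI))
          simpa using h2
        · push Not at hk
          exact ih z hz fun k hzk => lt_of_le_of_ne (Nat.lt_succ_iff.mp (h k hzk)) (hk k hzk)
    intro z hz
    obtain ⟨m, hm⟩ := (Set.finite_range r).bddAbove
    exact key (m + 1) z hz fun k _ => Nat.lt_succ_of_le (hm ⟨k, rfl⟩)
  · rw [Submodule.span_le]
    rintro _ ⟨i, hi, rfl⟩
    exact huW i hi

end Pivot

/-- Modulo the span over `J`, the vectors indexed by `I ∩ J` vanish, and those indexed by `I \ J`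
stay independent because their span meets the span over `J` trivially. -/
theorem LinearIndependent.finrank_map_mkQ_span {k V ι : Type*} [Field k] [AddCommGroup V]
    [Module k V] [Finite ι] {u : ι → V} (hu : LinearIndependent k u) (I J : Set ι) :
    Module.finrank k ((Submodule.span k (u '' I)).map (Submodule.span k (u '' J)).mkQ) =
      (I \ J).ncard := by
  classical
  have := Fintype.ofFinite ι
  set B := Submodule.span k (u '' J)
  have h1 : (Submodule.span k (u '' I)).map B.mkQ =
      Submodule.span k (Set.range fun i : ↥(I \ J) => B.mkQ (u i)) := by
    rw [Submodule.map_span]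
    apply le_antisymm
    · rw [Submodule.span_le]
      rintro _ ⟨_, ⟨i, hi, rfl⟩, rfl⟩
      by_cases hJ : i ∈ J
      · have : B.mkQ (u i) = 0 := by
          rw [Submodule.mkQ_apply, Submodule.Quotient.mk_eq_zero]
          exact Submodule.subset_span ⟨i, hJ, rfl⟩
        rw [this]; exact Submodule.zero_mem _
      · exact Submodule.subset_span ⟨⟨i, hi, hJ⟩, rfl⟩
    · apply Submodule.span_mono
      rintro _ ⟨i, rfl⟩
      exact ⟨u i, ⟨i, i.2.1, rfl⟩, rfl⟩
  rw [h1, finrank_span_eq_card]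
  · rw [Set.ncard_eq_toFinset_card', Set.toFinset_card]
  · have h2 : LinearIndependent k (fun i : ↥(I \ J) => u i) :=
      hu.comp _ Subtype.val_injective
    refine h2.map ?_
    rw [Submodule.ker_mkQ]
    rw [show (Set.range fun i : ↥(I \ J) => u i) = u '' (I \ J) by ext x; simp]
    exact hu.disjoint_span_image Set.disjoint_sdiff_left

/-! ## Reductions of the boundary matrix -/

namespace FinComplex

variable {V : Type*} [DecidableEq V] (K : FinComplex V)

theorem boundaryMap_apply (c : Fin K.size → ZMod 2) (i : Fin K.size) :
    K.boundaryMap c i = ∑ j, if K.IsFacet i j then c j else 0 := by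
  simp [boundaryMap, Matrix.mulVec, dotProduct, ite_mul]

theorem exists_isFacet_of_boundaryMap_ne_zero {c : Fin K.size → ZMod 2} {i : Fin K.size}
    (h : K.boundaryMap c i ≠ 0) : ∃ j, c j ≠ 0 ∧ K.IsFacet i j := by
  rw [boundaryMap_apply] at h
  obtain ⟨j, -, hj⟩ := Finset.exists_ne_zero_of_sum_ne_zero h
  by_cases hf : K.IsFacet i j
  · rw [if_pos hf] at hj
    exact ⟨j, hj, hf⟩
  · simp [hf] at hj

/-- If there is any intermediate simplex, then `k` has exactly two vertices more than `i`, and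
adding either of them to `i` gives the only two intermediate simplices. This is the reason for ∂∂ =
0. -/
theorem card_intermediate_even (i k : Fin K.size) :
    ((Finset.univ.filter fun j => K.IsFacet i j ∧ K.IsFacet j k).card : ZMod 2) = 0 := by
  rcases (Finset.univ.filter fun j => K.IsFacet i j ∧ K.IsFacet j k).eq_empty_or_nonempty
    with h | ⟨j₀, hj₀⟩
  · simp [h]
  · simp only [Finset.mem_filter, Finset.mem_univ, true_and] at hj₀
    obtain ⟨⟨hij, hc1⟩, ⟨hjk, hc2⟩⟩ := hj₀
    have hik := hij.trans hjk
    have hcard : (K.simplex k \ K.simplex i).card = 2 := by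
      rw [Finset.card_sdiff_of_subset hik]; omega
    obtain ⟨a, b, hab, hdiff⟩ := Finset.card_eq_two.mp hcard
    have ha : a ∈ K.simplex k \ K.simplex i := by simp [hdiff]
    have hb : b ∈ K.simplex k \ K.simplex i := by simp [hdiff]
    rw [Finset.mem_sdiff] at ha hb
    obtain ⟨ja, hja⟩ := K.face_mem k (insert a (K.simplex i)) (Finset.insert_nonempty _ _)
      (Finset.insert_subset ha.1 hik)
    obtain ⟨jb, hjb⟩ := K.face_mem k (insert b (K.simplex i)) (Finset.insert_nonempty _ _)
      (Finset.insert_subset hb.1 hik)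
    have hne : ja ≠ jb := by
      rintro rfl
      have : a ∈ insert b (K.simplex i) := by rw [← hjb, hja]; simp
      rcases Finset.mem_insert.mp this with h | h
      · exact hab h
      · exact ha.2 h
    have hca : (K.simplex ja).card = (K.simplex i).card + 1 := by
      rw [hja, Finset.card_insert_of_notMem ha.2]
    have hcb : (K.simplex jb).card = (K.simplex i).card + 1 := by
      rw [hjb, Finset.card_insert_of_notMem hb.2]
    have : (Finset.univ.filter fun j => K.IsFacet i j ∧ K.IsFacet j k) = {ja, jb} := by
      ext j
      simp only [Finset.mem_filter, Finset.mem_univ, true_and, Finset.mem_insert,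
        Finset.mem_singleton]
      constructor
      · rintro ⟨⟨h1, h2⟩, ⟨h3, h4⟩⟩
        have h5 : (K.simplex j \ K.simplex i).card = 1 := by
          rw [Finset.card_sdiff_of_subset h1]; omega
        obtain ⟨x, hx⟩ := Finset.card_eq_one.mp h5
        have hxj : K.simplex j = insert x (K.simplex i) := by
          rw [← Finset.sdiff_union_of_subset h1, hx]; rfl
        have hxm : x ∈ K.simplex k \ K.simplex i := by
          have : x ∈ K.simplex j \ K.simplex i := by simp [hx]
          rw [Finset.mem_sdiff] at this ⊢
          exact ⟨h3 this.1, this.2⟩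
        rw [hdiff, Finset.mem_insert, Finset.mem_singleton] at hxm
        rcases hxm with rfl | rfl
        · exact Or.inl (K.simplex_injective (hxj.trans hja.symm))
        · exact Or.inr (K.simplex_injective (hxj.trans hjb.symm))
      · rintro (rfl | rfl)
        · refine ⟨⟨?_, hca⟩, ⟨?_, by omega⟩⟩
          · rw [hja]; exact Finset.subset_insert _ _
          · rw [hja]; exact Finset.insert_subset ha.1 hik
        · refine ⟨⟨?_, hcb⟩, ⟨?_, by omega⟩⟩
          · rw [hjb]; exact Finset.subset_insert _ _
          · rw [hjb]; exact Finset.insert_subset hb.1 hik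
    rw [this, Finset.card_pair hne]
    decide

theorem boundaryMap_boundaryMap (c : Fin K.size → ZMod 2) :
    K.boundaryMap (K.boundaryMap c) = 0 := by
  funext i
  rw [boundaryMap_apply]
  have h1 : ∀ j, (if K.IsFacet i j then K.boundaryMap c j else 0) =
      ∑ k, if K.IsFacet i j ∧ K.IsFacet j k then c k else 0 := by
    intro j
    by_cases h : K.IsFacet i j <;> simp [h, boundaryMap_apply]
  rw [Finset.sum_congr rfl fun j _ => h1 j, Finset.sum_comm]
  refine Finset.sum_eq_zero fun k _ => ?_
  rw [← Finset.sum_filter, Finset.sum_const, nsmul_eq_mul, card_intermediate_even, zero_mul]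

theorem mem_chains {V : Type*} (K : FinComplex V) {p : ℕ} {S : Set (Fin K.size)}
    {c : Fin K.size → ZMod 2} :
    c ∈ K.chains p S ↔ ∀ i, c i ≠ 0 → i ∈ S ∧ (K.simplex i).card = p + 1 := by
  change (∀ i, ¬ (i ∈ S ∧ (K.simplex i).card = p + 1) → c i = 0) ↔ _
  exact forall_congr' fun i => not_imp_comm

/-- The outcome of the reduction of the boundary matrix with rows and columns ordered by `r`:
the `j`-th reduced column is the boundary of `v j`, and `owner a = some j` says that the last nonzero
entry of this column is in row `a`. -/
structure Reduction (r : Fin K.size → ℕ) (owner : Fin K.size → Option (Fin K.size)) where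
  v : Fin K.size → Fin K.size → ZMod 2
  diag : ∀ j, v j j ≠ 0
  supp : ∀ j k, v j k ≠ 0 → r k ≤ r j ∧ (K.simplex k).card = (K.simplex j).card
  top : ∀ a j, owner a = some j → IsPivot r (K.boundaryMap (v j)) a
  zero : ∀ j, (∀ a, owner a ≠ some j) → K.boundaryMap (v j) = 0

namespace Reduction

variable {K} {r : Fin K.size → ℕ} {owner : Fin K.size → Option (Fin K.size)}

theorem isPivot_v (D : K.Reduction r owner) (j : Fin K.size) : IsPivot r (D.v j) j :=
  ⟨D.diag j, fun k hk => by
    by_contra h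
    exact absurd (D.supp j k h).1 (not_le.mpr hk)⟩

theorem card_of_boundary_ne_zero (D : K.Reduction r owner) {j k : Fin K.size}
    (h : K.boundaryMap (D.v j) k ≠ 0) : (K.simplex j).card = (K.simplex k).card + 1 := by
  obtain ⟨l, hl, hf⟩ := K.exists_isFacet_of_boundaryMap_ne_zero h
  rw [← (D.supp j l hl).2, hf.2]

theorem card_eq (D : K.Reduction r owner) {a j : Fin K.size} (h : owner a = some j) :
    (K.simplex j).card = (K.simplex a).card + 1 :=
  D.card_of_boundary_ne_zero (D.top a j h).1

/-- The nonzero reduced columns have distinct pivots and are therefore independent. So a cycle,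
expanded in the basis `D.v`, has zero coefficients at all owned indices, whereas its pivot carries a
nonzero coefficient. -/
theorem not_owned_of_isPivot_cycle (D : K.Reduction r owner) (hr : Function.Injective r)
    {z : Fin K.size → ZMod 2} (hz : K.boundaryMap z = 0) {i : Fin K.size} (hi : IsPivot r z i)
    (a : Fin K.size) : owner a ≠ some i := by
  intro hai
  have hspan : Submodule.span (ZMod 2) (Set.range D.v) = ⊤ :=
    (linearIndependent_of_isPivot hr Function.injective_id D.isPivot_v).span_eq_top_of_card_eq_finrank'
      (by simp)
  have hmem : z ∈ Submodule.span (ZMod 2) (Set.range D.v) := by rw [hspan]; trivial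
  obtain ⟨c, rfl⟩ := (Submodule.mem_span_range_iff_exists_fun (ZMod 2)).mp hmem
  have hne : ∃ k ∈ Finset.univ, c k ≠ 0 := by
    by_contra hcon
    push Not at hcon
    exact hi.1 (by simp [hcon])
  -- Since `D.v k` has pivot `k`, the pivot of the combination is itself an index with nonzero
  -- coefficient.
  obtain ⟨k, -, hck, hk⟩ := exists_isPivot_sum hr Function.injective_id D.isPivot_v _ c hne
  obtain rfl : k = i := hk.unique hr hi
  classical
  let s : Finset (Fin K.size) := Finset.univ.filter fun j => ∃ a, owner a = some j
  let α := {j : Fin K.size // ∃ a, owner a = some j}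
  have htop : ∀ j : α, ∃ a, owner a = some j.1 := fun j => j.2
  choose top htop using htop
  have hinj : Function.Injective top := fun j j' h => by
    have := htop j
    rw [h, htop j'] at this
    exact Subtype.ext (Option.some.inj this).symm
  have hlin := linearIndependent_of_isPivot hr hinj
    (u := fun j : α => K.boundaryMap (D.v j.1)) fun j => D.top _ _ (htop j)
  rw [Fintype.linearIndependent_iff] at hlin
  refine hck (hlin (fun j => c j.1) ?_ ⟨k, a, hai⟩)
  rw [← Finset.sum_subtype s (by simp [s]) (fun j => c j • K.boundaryMap (D.v j)),
    Finset.sum_subset (Finset.subset_univ s)]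
  · rw [map_sum] at hz
    simpa only [map_smul] using hz
  · intro j _ hj
    rw [D.zero j (by simpa [s] using hj), smul_zero]

/-- A family with pivots `i` that contains bases of all cycle and boundary spaces. -/
def basisVec (D : K.Reduction r owner) (i : Fin K.size) : Fin K.size → ZMod 2 :=
  match owner i with
  | some j => K.boundaryMap (D.v j)
  | none => D.v i

theorem isPivot_basisVec (D : K.Reduction r owner) (i : Fin K.size) :
    IsPivot r (D.basisVec i) i := by
  unfold basisVec
  split
  · next j h => exact D.top i j h
  · exact D.isPivot_v i

/-- An unowned index carries a cycle: its `basisVec` is a boundary or a vector whose reduced column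
is zero. It lives on ranks up to its index, hence in the initial segment `S`. Conversely, pivots of
cycles are unowned, so Gaussian elimination applies. -/
theorem cycles_eq_span (D : K.Reduction r owner) (hr : Function.Injective r) (p : ℕ)
    {S : Set (Fin K.size)} (hS : ∀ i ∈ S, ∀ k, r k ≤ r i → k ∈ S) :
    K.cycles p S = Submodule.span (ZMod 2) (D.basisVec ''
      {i | i ∈ S ∧ (K.simplex i).card = p + 1 ∧ ∀ a, owner a ≠ some i}) := by
  apply eq_span_of_isPivot hr
  · exact fun i _ => D.isPivot_basisVec i
  · rintro i ⟨hiS, hic, hi⟩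
    have hpiv := D.isPivot_basisVec i
    refine Submodule.mem_inf.mpr ⟨?_, ?_⟩
    · rw [mem_chains]
      intro k hk
      refine ⟨hS i hiS k (hpiv.rank_le hk), ?_⟩
      rcases h : owner i with _ | j
      · simp only [basisVec, h] at hk
        rw [(D.supp i k hk).2, hic]
      · simp only [basisVec, h] at hk
        have h1 := D.card_eq h
        have h2 := D.card_of_boundary_ne_zero hk
        omega
    · rw [LinearMap.mem_ker]
      unfold basisVec
      split
      · exact K.boundaryMap_boundaryMap _
      · exact D.zero i hi
  · intro z hz i hi
    obtain ⟨hz1, hz2⟩ := Submodule.mem_inf.mp hz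
    have := K.mem_chains.mp hz1 i hi.1
    exact ⟨this.1, this.2, D.not_owned_of_isPivot_cycle hr hz2 hi⟩

theorem chains_eq_span (D : K.Reduction r owner) (hr : Function.Injective r) (p : ℕ)
    {S : Set (Fin K.size)} (hS : ∀ i ∈ S, ∀ k, r k ≤ r i → k ∈ S) :
    K.chains p S = Submodule.span (ZMod 2) (D.v ''
      {i | i ∈ S ∧ (K.simplex i).card = p + 1}) := by
  apply eq_span_of_isPivot hr
  · exact fun i _ => D.isPivot_v i
  · rintro i ⟨hiS, hic⟩
    rw [mem_chains]
    intro k hk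
    have := D.supp i k hk
    exact ⟨hS i hiS k this.1, this.2.trans hic⟩
  · intro z hz i hi
    exact K.mem_chains.mp hz i hi.1

/-- The boundary space is spanned by the reduced columns of `T`; the nonzero ones are exactly the
vectors `basisVec i` whose owner lies in `T`. -/
theorem boundaries_eq_span (D : K.Reduction r owner) (hr : Function.Injective r) (p : ℕ)
    {T : Set (Fin K.size)} (hT : ∀ i ∈ T, ∀ k, r k ≤ r i → k ∈ T) :
    K.boundaries p T = Submodule.span (ZMod 2) (D.basisVec ''
      {i | (K.simplex i).card = p + 1 ∧ ∃ j ∈ T, owner i = some j}) := by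
  rw [boundaries, D.chains_eq_span hr _ hT, Submodule.map_span]
  apply le_antisymm <;> rw [Submodule.span_le]
  · rintro _ ⟨_, ⟨j, ⟨hjT, hjc⟩, rfl⟩, rfl⟩
    by_cases h : ∃ a, owner a = some j
    · obtain ⟨a, ha⟩ := h
      have hc := D.card_eq ha
      refine Submodule.subset_span ⟨a, ⟨by omega, j, hjT, ha⟩, ?_⟩
      simp [basisVec, ha]
    · push Not at h
      rw [D.zero j h]
      exact Submodule.zero_mem _
  · rintro _ ⟨i, ⟨hic, j, hjT, hij⟩, rfl⟩
    have hc := D.card_eq hij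
    refine Submodule.subset_span ⟨D.v j, ⟨j, ⟨hjT, by omega⟩, rfl⟩, ?_⟩
    simp [basisVec, hij]

-- Cycles of `S` and boundaries of `T` are spanned by parts of the same independent family, so the
-- rank is the size of a difference of index sets: births in `S` that are not paired within `T`.
open Classical in
theorem persistentBetti_eq (D : K.Reduction r owner) (hr : Function.Injective r) (p : ℕ)
    {S T : Set (Fin K.size)} (hS : ∀ i ∈ S, ∀ k, r k ≤ r i → k ∈ S)
    (hT : ∀ i ∈ T, ∀ k, r k ≤ r i → k ∈ T) :
    K.persistentBetti p S T =
      ∑ i, if (K.simplex i).card = p + 1 ∧ (∀ a, owner a ≠ some i) ∧ i ∈ S ∧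
        ¬ ∃ j ∈ T, owner i = some j then 1 else 0 := by
  have hlin := linearIndependent_of_isPivot hr Function.injective_id D.isPivot_basisVec
  have key : ∀ (Z B : Submodule (ZMod 2) (Fin K.size → ZMod 2)) (I J : Set (Fin K.size)),
      Z = Submodule.span (ZMod 2) (D.basisVec '' I) →
      B = Submodule.span (ZMod 2) (D.basisVec '' J) →
      Module.finrank (ZMod 2) (Z.map B.mkQ) = (I \ J).ncard := by
    rintro Z B I J rfl rfl
    convert hlin.finrank_map_mkQ_span I J
  rw [persistentBetti, key _ _ _ _ (D.cycles_eq_span hr p hS) (D.boundaries_eq_span hr p hT),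
    Finset.sum_boole, Nat.cast_id, Set.ncard_eq_toFinset_card']
  congr 1
  ext i
  simp only [Set.mem_toFinset, Set.mem_sdiff, Set.mem_ofPred_eq, Finset.mem_filter,
    Finset.mem_univ, true_and]
  exact ⟨fun h => ⟨h.1.2.1, h.1.2.2, h.1.1, fun h' => h.2 ⟨h.1.2.1, h'⟩⟩,
    fun h => ⟨⟨h.2.2.1, h.1, h.2.1⟩, fun h' => h.2.2.2 h'.2⟩⟩

/-- The points of the persistence diagram that are contributed by the simplex `i`. -/
noncomputable def pointsAt (owner : Fin K.size → Option (Fin K.size)) (f : Fin K.size → ℝ)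
    (p : ℕ) (i : Fin K.size) : Multiset (ℝ × WithTop ℝ) :=
  open Classical in
  if (K.simplex i).card = p + 1 then
    match owner i with
    | some j => if f i < f j then {(f i, ((f j : ℝ) : WithTop ℝ))} else 0
    | none => if ∃ a, owner a = some i then 0 else {(f i, ⊤)}
  else 0

theorem owned_of_owner (D : K.Reduction r owner) (hr : Function.Injective r)
    {i j : Fin K.size} (h : owner i = some j) (a : Fin K.size) : owner a ≠ some i :=
  D.not_owned_of_isPivot_cycle hr (K.boundaryMap_boundaryMap _) (D.top i j h) a

open Classical in
theorem infiniteMult_eq (D : K.Reduction r owner) (hr : Function.Injective r)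
    {f : Fin K.size → ℝ} (hf : ∀ i j, r i ≤ r j → f i ≤ f j) (p : ℕ) (b : ℝ) :
    K.infiniteMult f p b = ∑ i, if (K.simplex i).card = p + 1 ∧ (∀ a, owner a ≠ some i) ∧
      f i = b ∧ owner i = none then 1 else 0 := by
  have hle : ∀ b, ∀ i ∈ {i | f i ≤ b}, ∀ k, r k ≤ r i → k ∈ {i | f i ≤ b} :=
    fun b i hi k hk => (hf k i hk).trans hi
  have hlt : ∀ b, ∀ i ∈ {i | f i < b}, ∀ k, r k ≤ r i → k ∈ {i | f i < b} :=
    fun b i hi k hk => (hf k i hk).trans_lt hi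
  rw [infiniteMult, D.persistentBetti_eq hr p (hle b) (fun _ _ _ _ => Set.mem_univ _),
    D.persistentBetti_eq hr p (hlt b) (fun _ _ _ _ => Set.mem_univ _)]
  rw [Nat.sub_eq_iff_eq_add (Finset.sum_le_sum fun i _ => ?_), ← Finset.sum_add_distrib]
  · refine Finset.sum_congr rfl fun i _ => ?_
    simp only [Set.mem_ofPred_eq, Set.mem_univ, true_and]
    rcases h : owner i with _ | j
    · rcases lt_trichotomy (f i) b with h1 | h1 | h1
      · simp [h1, h1.le, h1.ne]
      · simp [h1]
      · simp [h1.not_ge, h1.not_gt, h1.ne']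
    · simp
  · simp only [Set.mem_ofPred_eq]
    split_ifs with h1 h2
    · exact le_rfl
    · exact absurd ⟨h1.1, h1.2.1, h1.2.2.1.le, h1.2.2.2⟩ h2
    · exact Nat.zero_le _
    · exact le_rfl

open Classical in
theorem finiteMult_eq (D : K.Reduction r owner) (hr : Function.Injective r)
    {f : Fin K.size → ℝ} (hf : ∀ i j, r i ≤ r j → f i ≤ f j) (p : ℕ) (b d : ℝ) :
    K.finiteMult f p b d = ∑ i, if (K.simplex i).card = p + 1 ∧ (∀ a, owner a ≠ some i) ∧
      f i = b ∧ ∃ j, owner i = some j ∧ f j = d then 1 else 0 := by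
  have hle : ∀ b, ∀ i ∈ {i | f i ≤ b}, ∀ k, r k ≤ r i → k ∈ {i | f i ≤ b} :=
    fun b i hi k hk => (hf k i hk).trans hi
  have hlt : ∀ b, ∀ i ∈ {i | f i < b}, ∀ k, r k ≤ r i → k ∈ {i | f i < b} :=
    fun b i hi k hk => (hf k i hk).trans_lt hi
  rw [finiteMult, D.persistentBetti_eq hr p (hle b) (hlt d),
    D.persistentBetti_eq hr p (hlt b) (hle d), D.persistentBetti_eq hr p (hlt b) (hlt d),
    D.persistentBetti_eq hr p (hle b) (hle d), ← Finset.sum_add_distrib,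
    ← Finset.sum_add_distrib]
  -- The inclusion-exclusion identity is proved without subtraction and summand by summand: a
  -- simplex is counted with total weight one precisely if it is born at `b` and its partner enters
  -- at `d`.
  refine Nat.sub_eq_of_eq_add ?_
  rw [← Finset.sum_add_distrib]
  refine Finset.sum_congr rfl fun i _ => ?_
  simp only [Set.mem_ofPred_eq]
  by_cases hc : (K.simplex i).card = p + 1 ∧ ∀ a, owner a ≠ some i
  · simp only [hc.1, true_and]
    simp only [eq_true hc.2, true_and]
    rcases h : owner i with _ | j
    · simp [add_comm]
    · simp only [Option.some.injEq, exists_eq_right', exists_eq_left', not_lt, not_le]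
      rcases lt_trichotomy (f i) b with h1 | h1 | h1
      · simp [h1, h1.le, h1.ne]
      · rcases lt_trichotomy (f j) d with h2 | h2 | h2
        · simp [h1, h2.not_ge, h2.not_gt, h2.ne]
        · simp [h1, h2]
        · simp [h1, h2, h2.le, h2.ne']
      · simp [h1.not_ge, h1.not_gt, h1.ne']
  · have h1 : ∀ q : Prop, ¬ ((K.simplex i).card = p + 1 ∧ (∀ a, owner a ≠ some i) ∧ q) :=
      fun q h => hc ⟨h.1, h.2.1⟩
    simp only [h1, if_false]

theorem _root_.Multiset.replicate_sum_ite {α β : Type*} (s : Finset α) (P : α → Prop)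
    [DecidablePred P] (x : β) :
    Multiset.replicate (∑ i ∈ s, if P i then 1 else 0) x = ∑ i ∈ s, if P i then {x} else 0 := by
  classical
  induction s using Finset.induction_on with
  | empty => simp
  | insert a s ha ih =>
    rw [Finset.sum_insert ha, Finset.sum_insert ha, Multiset.replicate_add, ih]
    split_ifs <;> simp

/-- The pairing lemma: the persistence diagram can be read off from a reduction of the boundary
matrix. -/
theorem diagram_eq (D : K.Reduction r owner) (hr : Function.Injective r)
    {f : Fin K.size → ℝ} (hf : ∀ i j, r i ≤ r j → f i ≤ f j) (p : ℕ) :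
    K.diagram f p = ∑ i, pointsAt owner f p i := by
  classical
  rw [diagram]
  simp_rw [D.infiniteMult_eq hr hf, D.finiteMult_eq hr hf, Multiset.replicate_sum_ite]
  rw [Finset.sum_add_distrib]
  rw [Finset.sum_comm]
  have h2 : ∀ b, ∑ d ∈ (Finset.univ.image f).filter (fun d => b < d), (∑ i,
      if (K.simplex i).card = p + 1 ∧ (∀ a, owner a ≠ some i) ∧
        f i = b ∧ ∃ j, owner i = some j ∧ f j = d
      then ({(b, (d : WithTop ℝ))} : Multiset (ℝ × WithTop ℝ)) else 0) =
      ∑ i, ∑ d ∈ (Finset.univ.image f).filter (fun d => b < d),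
      if (K.simplex i).card = p + 1 ∧ (∀ a, owner a ≠ some i) ∧
        f i = b ∧ ∃ j, owner i = some j ∧ f j = d
      then ({(b, (d : WithTop ℝ))} : Multiset (ℝ × WithTop ℝ)) else 0 :=
    fun b => Finset.sum_comm
  rw [Finset.sum_congr rfl fun b _ => h2 b, Finset.sum_comm (s := Finset.univ.image f),
    ← Finset.sum_add_distrib]
  refine Finset.sum_congr rfl fun i _ => ?_
  have hmem : f i ∈ Finset.univ.image f := Finset.mem_image_of_mem _ (Finset.mem_univ _)
  unfold pointsAt
  -- After exchanging the sums, a fixed simplex `i` contributes only at the birth value `b = f i`.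
  rw [Finset.sum_eq_single_of_mem (f i) hmem (by
      intro b _ hb
      rw [if_neg]
      rintro ⟨-, -, h, -⟩
      exact hb h.symm),
    Finset.sum_eq_single_of_mem (f i) hmem (by
      intro b _ hb
      refine Finset.sum_eq_zero fun d _ => ?_
      rw [if_neg]
      rintro ⟨-, -, h, -⟩
      exact hb h.symm)]
  by_cases hc : (K.simplex i).card = p + 1
  · simp only [hc, true_and, if_true]
    rcases h : owner i with _ | j
    · by_cases hneg : ∃ a, owner a = some i
      · simp [hneg]
      · simp [hneg]
    · have hown := D.owned_of_owner hr h
      simp only [eq_true hown, reduceCtorEq, and_false, if_false, zero_add, true_and,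
        Option.some.injEq, exists_eq_left']
      split_ifs with hlt
      · rw [Finset.sum_eq_single_of_mem (f j)]
        · simp
        · simp [hlt]
        · intro d _ hd
          rw [if_neg (Ne.symm hd)]
      · refine Finset.sum_eq_zero fun d hd => ?_
        rw [if_neg]
        rintro rfl
        exact hlt (Finset.mem_filter.mp hd).2
  · simp [hc]

end Reduction
end FinComplex

/-! ## Values and steps of timed computations -/

namespace Timed

variable {α β : Type}

@[simp] theorem val_pure (a : α) : (pure a : Timed α).val = a := rfl
@[simp] theorem steps_pure (a : α) : (pure a : Timed α).steps = 0 := rfl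
@[simp] theorem val_bind (x : Timed α) (g : α → Timed β) : (x >>= g).val = (g x.val).val := rfl
@[simp] theorem steps_bind (x : Timed α) (g : α → Timed β) :
    (x >>= g).steps = x.steps + (g x.val).steps := rfl
@[simp] theorem val_one (a : α) : (one a).val = a := rfl
@[simp] theorem steps_one (a : α) : (one a).steps = 1 := rfl
@[simp] theorem val_cost (k : ℕ) (a : α) : (cost k a).val = a := rfl
@[simp] theorem steps_cost (k : ℕ) (a : α) : (cost k a).steps = k := rfl
@[simp] theorem val_array {n : ℕ} (g : Fin n → Timed α) : (array g).val = fun i => (g i).val := rfl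
@[simp] theorem steps_array {n : ℕ} (g : Fin n → Timed α) :
    (array g).steps = ∑ i, ((g i).steps + 1) := rfl

end Timed

/-! ## Correctness of the persistence algorithm -/

theorem val_insertT {α : Type} (le : α → α → Bool) (a : α) (l : List α) :
    (insertT le a l).val = l.orderedInsert (fun x y => le x y = true) a := by
  induction l with
  | nil => rfl
  | cons b l ih =>
    rw [insertT, List.orderedInsert]
    split_ifs
    · rfl
    · simp [ih]

theorem val_sortT {α : Type} (le : α → α → Bool) (l : List α) :
    (sortT le l).val = l.insertionSort (fun x y => le x y = true) := by
  induction l with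
  | nil => rfl
  | cons a l ih => simp [sortT, val_insertT, ih]

/-- The vector over `ZMod 2` encoded by an array of Booleans. -/
def boolVec {ι : Type*} (c : ι → Bool) : ι → ZMod 2 := fun k => if c k then 1 else 0

theorem boolVec_ne_zero {ι : Type*} {c : ι → Bool} {k : ι} : boolVec c k ≠ 0 ↔ c k = true := by
  unfold boolVec; split_ifs with h <;> simp [h]

theorem boolVec_xor {ι : Type*} (c d : ι → Bool) :
    boolVec (fun k => xor (c k) (d k)) = boolVec c + boolVec d := by
  funext k
  have h : ∀ x y : Bool, (if xor x y then (1 : ZMod 2) else 0) =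
      (if x then 1 else 0) + if y then 1 else 0 := by decide
  exact h _ _

/-- The support of the column always stays within the rows still to be scanned: adding a column with
pivot in the current row clears this entry and otherwise affects only rows of smaller rank. `P` is
any property preserved by these additions; it is used for being the boundary of an admissible chain.
-/
theorem reduceCol_spec {n : ℕ} {r : Fin n → ℕ} {R : Fin n → Fin n → Bool}
    {owner : Fin n → Option (Fin n)}
    (howner : ∀ a i, owner a = some i → IsPivot r (boolVec (R i)) a)
    (P : (Fin n → Bool) → Prop)
    (hP : ∀ col a i, P col → col a = true → owner a = some i → P fun k => xor (col k) (R i k))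
    (rows : List (Fin n)) (hrows : rows.Pairwise fun a b => r b < r a)
    (hdown : ∀ a ∈ rows, ∀ k, r k ≤ r a → k ∈ rows)
    (col : Fin n → Bool) (hcol : ∀ k, col k = true → k ∈ rows) (hPcol : P col) :
    P (reduceCol R owner col rows).val.1 ∧
      (∀ a, (reduceCol R owner col rows).val.2 = some a →
        owner a = none ∧ IsPivot r (boolVec (reduceCol R owner col rows).val.1) a) ∧
      ((reduceCol R owner col rows).val.2 = none →
        ∀ k, (reduceCol R owner col rows).val.1 k = false) := by
  induction rows generalizing col with
  | nil =>
    refine ⟨hPcol, fun a ha => ?_, fun _ k => ?_⟩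
    · simp [reduceCol] at ha
    · by_contra h
      exact absurd (hcol k (by simpa [reduceCol] using h)) List.not_mem_nil
  | cons a rows ih =>
    rw [List.pairwise_cons] at hrows
    have hdown' : ∀ b ∈ rows, ∀ k, r k ≤ r b → k ∈ rows := by
      intro b hb k hk
      rcases List.mem_cons.mp (hdown b (List.mem_cons_of_mem _ hb) k hk) with rfl | h
      · exact absurd (hrows.1 b hb) (not_lt.mpr hk)
      · exact h
    rw [reduceCol]
    split_ifs with hca
    · split
      · next how =>
        refine ⟨hPcol, fun b hb => ?_, fun h => by simp at h⟩
        obtain rfl : a = b := by simpa using hb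
        refine ⟨how, boolVec_ne_zero.mpr hca, fun k hk => ?_⟩
        by_contra hne
        rcases List.mem_cons.mp (hcol k (boolVec_ne_zero.mp hne)) with rfl | h
        · exact lt_irrefl _ hk
        · exact lt_asymm hk (hrows.1 k h)
      · next i how =>
        have hpiv := howner a i how
        refine ih hrows.2 hdown' _ (fun k hk => ?_) (hP col a i hPcol hca how)
        have hk' : boolVec (fun k => xor (col k) (R i k)) k ≠ 0 := boolVec_ne_zero.mpr hk
        have hka : k ≠ a := by
          rintro rfl
          have := boolVec_ne_zero.mp hpiv.1
          simp [hca, this] at hk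
        have hmem : k ∈ a :: rows := by
          by_cases hck : col k = true
          · exact hcol k hck
          · refine hdown a List.mem_cons_self k (hpiv.rank_le (boolVec_ne_zero.mpr ?_))
            simpa [hck] using hk
        exact (List.mem_cons.mp hmem).resolve_left hka
    · refine ih hrows.2 hdown' _ (fun k hk => ?_) hPcol
      refine (List.mem_cons.mp (hcol k hk)).resolve_left ?_
      rintro rfl
      exact hca hk

theorem idxOf_injective {n : ℕ} {ord : List (Fin n)} (hmem : ∀ i, i ∈ ord) :
    Function.Injective fun i => ord.idxOf i :=
  fun i _ h => (List.idxOf_inj (hmem i)).mp h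

theorem le_of_idxOf_le {n : ℕ} {ord : List (Fin n)} (hmem : ∀ i, i ∈ ord)
    {f : Fin n → ℝ} (hf : ord.Pairwise fun i j => f i ≤ f j) (i j : Fin n)
    (hij : ord.idxOf i ≤ ord.idxOf j) : f i ≤ f j := by
  rcases hij.eq_or_lt with h | h
  · rw [idxOf_injective hmem h]
  · have := List.pairwise_iff_getElem.mp hf _ _ (List.idxOf_lt_length_iff.mpr (hmem i))
      (List.idxOf_lt_length_iff.mpr (hmem j)) h
    simpa using this

theorem exists_order {n : ℕ} (f : Fin n → ℝ) :
    ∃ ord : List (Fin n), ord.Nodup ∧ (∀ i, i ∈ ord) ∧ ord.Pairwise fun i j => f i ≤ f j := by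
  refine ⟨(List.finRange n).insertionSort fun i j => f i ≤ f j, ?_, ?_, ?_⟩
  · exact (List.perm_insertionSort _ _).nodup_iff.mpr (List.nodup_finRange _)
  · intro i
    exact (List.perm_insertionSort _ _).mem_iff.mpr (List.mem_finRange i)
  · have : Std.Total fun i j : Fin n => f i ≤ f j := ⟨fun i j => le_total _ _⟩
    have : IsTrans (Fin n) fun i j : Fin n => f i ≤ f j := ⟨fun _ _ _ => le_trans⟩
    exact List.pairwise_insertionSort _ _

/-! ### The invariant of the matrix reduction and the resulting diagram. -/

namespace FinComplex

variable {V : Type*} [DecidableEq V] (K : FinComplex V)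

/-- `col` is the `j`-th column of the boundary matrix plus earlier columns of simplices of the same
dimension. -/
def IsReduced (r : Fin K.size → ℕ) (col : Fin K.size → Bool) (j : Fin K.size) : Prop :=
  ∃ v : Fin K.size → ZMod 2, v j ≠ 0 ∧
    (∀ k, v k ≠ 0 → r k ≤ r j ∧ (K.simplex k).card = (K.simplex j).card) ∧
    boolVec col = K.boundaryMap v

/-- The invariant of the matrix reduction, `js` being the columns that are not yet reduced. -/
structure ReductionInvariant (r : Fin K.size → ℕ) (s : ReductionState K.size)
    (js : List (Fin K.size)) : Prop where
  todo : ∀ j ∈ js, (∀ k, s.R j k = decide (K.IsFacet k j)) ∧ s.negative j = false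
  done : ∀ j, j ∉ js → K.IsReduced r (s.R j) j ∧ (s.negative j = false → ∀ k, s.R j k = false)
  owner : ∀ a j, s.owner a = some j →
    j ∉ js ∧ IsPivot r (boolVec (s.R j)) a ∧ s.negative j = true
  negative : ∀ j, s.negative j = true → ∃ a, s.owner a = some j

variable {K}

theorem isReduced_boundary (r : Fin K.size → ℕ) {col : Fin K.size → Bool} {j : Fin K.size}
    (h : ∀ k, col k = decide (K.IsFacet k j)) : K.IsReduced r col j := by
  refine ⟨Pi.single j 1, by simp, fun k hk => ?_, ?_⟩
  · by_cases hkj : k = j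
    · subst hkj; exact ⟨le_rfl, rfl⟩
    · simp [hkj] at hk
  · funext k
    rw [boundaryMap_apply, Finset.sum_eq_single_of_mem j (Finset.mem_univ _)]
    · simp [boolVec, h]
    · intro l _ hl
      simp [hl]

/-- A common nonzero row `a` forces both columns to belong to simplices one dimension above `a`, so
dimensions are not mixed. As `i` precedes `j`, the coefficient at `j` is unaffected. -/
theorem IsReduced.add {r : Fin K.size → ℕ} {c d : Fin K.size → Bool} {i j a : Fin K.size}
    (hc : K.IsReduced r c j) (hd : K.IsReduced r d i) (hij : r i < r j) (hca : c a = true)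
    (hda : d a = true) : K.IsReduced r (fun k => xor (c k) (d k)) j := by
  obtain ⟨v, hv1, hv2, hv3⟩ := hc
  obtain ⟨w, hw1, hw2, hw3⟩ := hd
  have hcard : (K.simplex i).card = (K.simplex j).card := by
    obtain ⟨l, hl, hl'⟩ := K.exists_isFacet_of_boundaryMap_ne_zero
      (hv3 ▸ boolVec_ne_zero.mpr hca : K.boundaryMap v a ≠ 0)
    obtain ⟨m, hm, hm'⟩ := K.exists_isFacet_of_boundaryMap_ne_zero
      (hw3 ▸ boolVec_ne_zero.mpr hda : K.boundaryMap w a ≠ 0)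
    rw [← (hv2 l hl).2, ← (hw2 m hm).2, hl'.2, hm'.2]
  have hwj : w j = 0 := by
    by_contra h
    exact absurd (hw2 j h).1 (not_le.mpr hij)
  refine ⟨v + w, by simpa [hwj] using hv1, fun k hk => ?_, ?_⟩
  · by_cases hvk : v k = 0
    · have := hw2 k (by simpa [hvk] using hk)
      exact ⟨this.1.trans hij.le, this.2.trans hcard⟩
    · exact hv2 k hvk
  · rw [boolVec_xor, hv3, hw3, map_add]

/-- The hypothesis on `js` says that all finished columns precede the unfinished ones, so every
column recorded in `owner` may be added to the current one. -/
theorem reduceAll_spec {r : Fin K.size → ℕ} {rows : List (Fin K.size)}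
    (hrows : rows.Pairwise fun a b => r b < r a) (hmem : ∀ a, a ∈ rows)
    (js : List (Fin K.size)) (s : ReductionState K.size)
    (hjs : js.Pairwise fun a b => r a < r b) (hjs' : ∀ j ∈ js, ∀ k, k ∉ js → r k < r j)
    (hs : K.ReductionInvariant r s js) :
    K.ReductionInvariant r (reduceAll rows s js).val [] := by
  induction js generalizing s with
  | nil => exact hs
  | cons j js ih =>
    rw [List.pairwise_cons] at hjs
    have hjnot : j ∉ js := fun h => lt_irrefl _ (hjs.1 j h)
    have hto := hs.todo j List.mem_cons_self
    have hspec := reduceCol_spec (fun a i h => (hs.owner a i h).2.1)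
      (fun col => K.IsReduced r col j)
      (fun col a i hcol hca how => by
        obtain ⟨h1, h2, -⟩ := hs.owner a i how
        exact hcol.add (hs.done i h1).1 (hjs' j List.mem_cons_self i h1) hca
          (boolVec_ne_zero.mp h2.1))
      rows hrows (fun a _ k _ => hmem k) (s.R j) (fun k _ => hmem k)
      (isReduced_boundary r hto.1)
    have hlater : ∀ i ∈ js, ∀ k, k ∉ js → r k < r i := by
      intro i hi k hk
      by_cases hkj : k = j
      · subst hkj; exact hjs.1 i hi
      · exact hjs' i (List.mem_cons_of_mem _ hi) k (by simp [hkj, hk])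
    rw [reduceAll]
    simp only [Timed.val_bind]
    generalize reduceCol s.R s.owner (s.R j) rows = res at hspec ⊢
    obtain ⟨⟨col, pivot⟩, t⟩ := res
    obtain ⟨h1, h2, h3⟩ := hspec
    simp only at h1 h2 h3
    refine ih _ hjs.2 hlater ?_
    rcases pivot with _ | a
    · refine ⟨fun i hi => ?_, fun i hi => ?_, fun a i hai => ?_, fun i hi => ?_⟩
      · have hij : i ≠ j := fun h => hjnot (h ▸ hi)
        simpa [hij] using hs.todo i (List.mem_cons_of_mem _ hi)
      · by_cases hij : i = j
        · subst hij
          simpa [h1] using fun _ => h3 rfl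
        · simpa [hij] using hs.done i (by simp [hij, hi])
      · obtain ⟨h4, h5, h6⟩ := hs.owner a i hai
        simp only [List.mem_cons, not_or] at h4
        exact ⟨h4.2, by simpa [h4.1] using h5, h6⟩
      · exact hs.negative i hi
    · obtain ⟨ha, hpiv⟩ := h2 a rfl
      refine ⟨fun i hi => ?_, fun i hi => ?_, fun b i hbi => ?_, fun i hi => ?_⟩
      · have hij : i ≠ j := fun h => hjnot (h ▸ hi)
        simpa [hij] using hs.todo i (List.mem_cons_of_mem _ hi)
      · by_cases hij : i = j
        · subst hij
          simpa using h1
        · simpa [hij] using hs.done i (by simp [hij, hi])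
      · by_cases hba : b = a
        · subst hba
          obtain rfl : j = i := by simpa using hbi
          exact ⟨hjnot, by simpa using hpiv, by simp⟩
        · obtain ⟨h4, h5, h6⟩ := hs.owner b i (by simpa [hba] using hbi)
          simp only [List.mem_cons, not_or] at h4
          exact ⟨h4.2, by simpa [h4.1] using h5, by simpa [h4.1] using h6⟩
      · by_cases hij : i = j
        · subst hij
          exact ⟨a, by simp⟩
        · obtain ⟨b, hb⟩ := hs.negative i (by simpa [hij] using hi)
          refine ⟨b, ?_⟩
          have hba : b ≠ a := by rintro rfl; simp [ha] at hb
          simpa [hba] using hb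

theorem ReductionInvariant.nonempty_reduction {r : Fin K.size → ℕ} {s : ReductionState K.size}
    (hs : K.ReductionInvariant r s []) : Nonempty (K.Reduction r s.owner) := by
  have h := fun j => (hs.done j List.not_mem_nil).1
  choose v hv1 hv2 hv3 using h
  refine ⟨⟨v, hv1, hv2, fun a j haj => hv3 j ▸ (hs.owner a j haj).2.1, fun j hj => ?_⟩⟩
  have hneg : s.negative j = false := by
    by_contra hne
    obtain ⟨a, ha⟩ := hs.negative j (by simpa using hne)
    exact hj a ha
  rw [← hv3 j]
  funext k
  simp [boolVec, (hs.done j List.not_mem_nil).2 hneg k]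

theorem coe_val_collectPoints {r : Fin K.size → ℕ} {s : ReductionState K.size}
    (hs : K.ReductionInvariant r s []) (p : ℕ) (f : Fin K.size → ℝ) (l : List (Fin K.size)) :
    ((collectPoints p (fun i => (K.simplex i).card) f s l).val : Multiset (ℝ × WithTop ℝ)) =
      (l.map (Reduction.pointsAt s.owner f p)).sum := by
  induction l with
  | nil => rfl
  | cons i l ih =>
    have hneg : s.negative i = true ↔ ∃ a, s.owner a = some i :=
      ⟨hs.negative i, fun ⟨a, ha⟩ => (hs.owner a i ha).2.2⟩
    rw [List.map_cons, List.sum_cons, ← ih]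
    simp only [collectPoints, Timed.val_bind, Timed.val_one, Reduction.pointsAt]
    by_cases hc : (K.simplex i).card = p + 1
    · rw [if_pos hc, if_pos hc]
      rcases s.owner i with _ | j
      · simp only [hneg]
        split_ifs
        · simp
        · simp
      · dsimp only
        split_ifs <;> simp
    · simp [hc]

/-- The matrix reduction for an ordering of the simplices. -/
def reductionResult (ord : List (Fin K.size)) : ReductionState K.size :=
  (reduceAll ord.reverse ⟨fun j i => decide (K.IsFacet i j), fun _ => none, fun _ => false⟩ ord).val

theorem reductionResult_invariant {ord : List (Fin K.size)} (hnd : ord.Nodup)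
    (hmem : ∀ i, i ∈ ord) :
    K.ReductionInvariant (fun i => ord.idxOf i) (reductionResult ord) [] := by
  have hpw : ord.Pairwise fun a b => ord.idxOf a < ord.idxOf b := by
    rw [List.pairwise_iff_getElem]
    intro i j hi hj hij
    rwa [hnd.idxOf_getElem, hnd.idxOf_getElem]
  refine reduceAll_spec (List.pairwise_reverse.mpr hpw) (by simpa using hmem) ord _ hpw
    (fun j _ k hk => absurd (hmem k) hk)
    ⟨fun j _ => ⟨fun k => rfl, rfl⟩, fun j hj => absurd (hmem j) hj, fun a j h => ?_,
      fun j h => ?_⟩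
  · simp at h
  · simp at h

/-- The persistence diagram in terms of an ordering compatible with the critical values. -/
theorem diagram_eq_sum_pointsAt {ord : List (Fin K.size)} (hnd : ord.Nodup) (hmem : ∀ i, i ∈ ord)
    {f : Fin K.size → ℝ} (hf : ord.Pairwise fun i j => f i ≤ f j) (p : ℕ) :
    K.diagram f p = ∑ i, Reduction.pointsAt (reductionResult ord).owner f p i := by
  obtain ⟨D⟩ := (reductionResult_invariant hnd hmem).nonempty_reduction
  exact D.diagram_eq (idxOf_injective hmem) (le_of_idxOf_le hmem hf) p

variable (K)

/-- The ordering of the simplices used by the persistence algorithm. -/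
noncomputable def algOrder (f : Fin K.size → ℝ) : List (Fin K.size) :=
  (sortT (fun i j => decide (f i < f j ∨ (f i = f j ∧ (K.simplex i).card ≤ (K.simplex j).card)))
    (List.finRange K.size)).val

/-- Ties are broken by dimension; this still is a total preorder, and the pairing argument only
needs `f` to increase weakly along the order. -/
theorem algOrder_spec {V : Type*} (K : FinComplex V) (f : Fin K.size → ℝ) :
    (K.algOrder f).Nodup ∧ (∀ i, i ∈ K.algOrder f) ∧
    (K.algOrder f).Pairwise fun i j => f i ≤ f j := by
  have hperm : (K.algOrder f).Perm (List.finRange K.size) := by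
    rw [algOrder, val_sortT]; exact List.perm_insertionSort _ _
  refine ⟨hperm.nodup_iff.mpr (List.nodup_finRange _),
    fun i => hperm.mem_iff.mpr (List.mem_finRange i), ?_⟩
  rw [algOrder, val_sortT]
  simp only [decide_eq_true_eq]
  set le : Fin K.size → Fin K.size → Prop :=
    fun i j => f i < f j ∨ (f i = f j ∧ (K.simplex i).card ≤ (K.simplex j).card) with hle
  have : Std.Total le := ⟨fun i j => by
    rcases lt_trichotomy (f i) (f j) with h | h | h
    · exact Or.inl (Or.inl h)
    · rcases le_total (K.simplex i).card (K.simplex j).card with h' | h'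
      · exact Or.inl (Or.inr ⟨h, h'⟩)
      · exact Or.inr (Or.inr ⟨h.symm, h'⟩)
    · exact Or.inr (Or.inl h)⟩
  have : IsTrans _ le := ⟨fun i j k h1 h2 => by
    rcases h1 with h1 | ⟨h1, h1'⟩ <;> rcases h2 with h2 | ⟨h2, h2'⟩
    · exact Or.inl (h1.trans h2)
    · exact Or.inl (h2 ▸ h1)
    · exact Or.inl (h1 ▸ h2)
    · exact Or.inr ⟨h1.trans h2, h1'.trans h2'⟩⟩
  refine List.Pairwise.imp ?_ (List.pairwise_insertionSort le _)
  rintro i j (h | h)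
  · exact h.le
  · exact h.1.le

/-- The persistence algorithm computes the persistence diagram. -/
theorem coe_val_persistenceAlg (f : Fin K.size → ℝ) (p : ℕ) :
    ((persistenceAlg K f p).val : Multiset (ℝ × WithTop ℝ)) = K.diagram f p := by
  obtain ⟨hnd, hmem, hpw⟩ := K.algOrder_spec f
  rw [diagram_eq_sum_pointsAt hnd hmem hpw]
  have h1 : (persistenceAlg K f p).val = (collectPoints p (fun i => (K.simplex i).card) f
      (reductionResult (K.algOrder f)) (K.algOrder f)).val := rfl
  rw [h1, coe_val_collectPoints (reductionResult_invariant hnd hmem), ← Multiset.sum_coe,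
    ← Multiset.map_coe]
  have h2 : ((K.algOrder f : List _) : Multiset (Fin K.size)) = Finset.univ.val := by
    rw [Multiset.Nodup.ext (Multiset.coe_nodup.mpr hnd) Finset.univ.nodup]
    intro a
    simp [hmem a]
  rw [h2]
  rfl

end FinComplex

/-! ## Bottleneck matchings by augmentation -/

section Assignment

variable {N : ℕ}

theorem argminT_none {visited : Fin N → Bool} {slack : Fin N → WithTop ℝ} {l : List (Fin N)}
    (h : (argminT visited slack l).val = none) : ∀ v ∈ l, visited v = true := by
  induction l with
  | nil => simp
  | cons v l ih =>
    simp only [argminT, Timed.val_bind, Timed.val_one] at h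
    split_ifs at h with hv
    · intro w hw
      rcases List.mem_cons.mp hw with rfl | hw
      · exact hv
      · exact ih h w hw
    · split at h
      · simp at h
      · split_ifs at h

theorem argminT_some {visited : Fin N → Bool} {slack : Fin N → WithTop ℝ} {l : List (Fin N)}
    {v : Fin N} (h : (argminT visited slack l).val = some v) :
    visited v = false ∧ ∀ w ∈ l, visited w = false → slack v ≤ slack w := by
  induction l generalizing v with
  | nil => simp [argminT] at h
  | cons a l ih =>
    simp only [argminT, Timed.val_bind, Timed.val_one] at h
    split_ifs at h with ha
    · obtain ⟨h1, h2⟩ := ih h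
      refine ⟨h1, fun w hw hvw => ?_⟩
      rcases List.mem_cons.mp hw with rfl | hw
      · simp [ha] at hvw
      · exact h2 w hw hvw
    · have ha' : visited a = false := by simpa using ha
      split at h
      · next hn =>
        obtain rfl : a = v := by simpa using h
        refine ⟨ha', fun w hw hvw => ?_⟩
        rcases List.mem_cons.mp hw with rfl | hw
        · exact le_rfl
        · simp [argminT_none hn w hw] at hvw
      · next b hb =>
        obtain ⟨h1, h2⟩ := ih hb
        split_ifs at h with hab
        · obtain rfl : a = v := by simpa using h
          refine ⟨ha', fun w hw hvw => ?_⟩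
          rcases List.mem_cons.mp hw with rfl | hw
          · exact le_rfl
          · exact hab.trans (h2 w hw hvw)
        · obtain rfl : b = v := by simpa using h
          refine ⟨h1, fun w hw hvw => ?_⟩
          rcases List.mem_cons.mp hw with rfl | hw
          · exact (not_le.mp hab).le
          · exact h2 w hw hvw

/-- The two partner functions of a matching are inverse to each other. -/
def BipMatching.Valid (M : BipMatching N) : Prop :=
  ∀ a b, M.ofLeft a = some b ↔ M.ofRight b = some a

/-- The left vertex `l` belongs to the alternating tree with root `u`. -/
def InTree (ofRight : Fin N → Option (Fin N)) (visited : Fin N → Bool) (u l : Fin N) : Prop :=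
  l = u ∨ ∃ w, visited w = true ∧ ofRight w = some l

/-- The invariant of the growth of the alternating tree. -/
structure TreeInvariant (c : Fin N → Fin N → WithTop ℝ) (ofRight : Fin N → Option (Fin N))
    (u : Fin N) (visited : Fin N → Bool) (slack : Fin N → WithTop ℝ) (parent : Fin N → Fin N)
    (θ : WithTop ℝ) (rank : Fin N → ℕ) : Prop where
  matched : ∀ w, visited w = true → ∃ l, ofRight w = some l
  edge : ∀ w, visited w = true → c (parent w) w ≤ θ
  path : ∀ w, visited w = true →
    parent w = u ∨ ∃ w', visited w' = true ∧ rank w' < rank w ∧ ofRight w' = some (parent w)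
  rank_lt : ∀ w, visited w = true → rank w < (Finset.univ.filter fun w => visited w = true).card
  slack_eq : ∀ w, visited w = false → slack w = c (parent w) w
  parent_mem : ∀ w, visited w = false → InTree ofRight visited u (parent w)
  slack_le : ∀ w l, visited w = false → InTree ofRight visited u l → slack w ≤ c l w

/-- An augmenting path from `u` to `v` with edge costs at most `θ`, described by the parents of the
right vertices in a set `W` that contains the path. -/
structure AugmentingPath (c : Fin N → Fin N → WithTop ℝ) (ofRight : Fin N → Option (Fin N))
    (u : Fin N) (parent : Fin N → Fin N) (θ : WithTop ℝ) (rank : Fin N → ℕ) (W : Set (Fin N))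
    (v : Fin N) : Prop where
  mem : v ∈ W
  free : ofRight v = none
  edge : ∀ w ∈ W, c (parent w) w ≤ θ
  path : ∀ w ∈ W, parent w = u ∨ ∃ w' ∈ W, rank w' < rank w ∧ ofRight w' = some (parent w)
  rank_lt : rank v < N

/-- The partners of the visited right vertices are distinct tree vertices different from the root,
so the tree has more left vertices than visited right ones. -/
theorem card_visited_lt {ofRight : Fin N → Option (Fin N)} {visited : Fin N → Bool} {u : Fin N}
    (hinj : ∀ a b l, ofRight a = some l → ofRight b = some l → a = b)
    (hu : ∀ w, ofRight w ≠ some u) (hm : ∀ w, visited w = true → ∃ l, ofRight w = some l)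
    (T : Finset (Fin N)) (hT : ∀ l, InTree ofRight visited u l → l ∈ T) :
    (Finset.univ.filter fun w => visited w = true).card < T.card := by
  have huT := hT u (Or.inl rfl)
  have h1 : (Finset.univ.filter fun w => visited w = true).card ≤ (T.erase u).card := by
    refine Finset.card_le_card_of_injOn (fun w => (ofRight w).getD u) ?_ ?_
    · intro w hw
      have hw : visited w = true := by simpa using hw
      obtain ⟨l, hl⟩ := hm w hw
      simp only [hl, Option.getD_some, Finset.coe_erase, Set.mem_sdiff, Finset.mem_coe,
        Set.mem_singleton_iff]
      exact ⟨hT l (Or.inr ⟨w, hw, hl⟩), fun h => hu w (h ▸ hl)⟩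
    · intro a ha b hb hab
      have ha : visited a = true := by simpa using ha
      have hb : visited b = true := by simpa using hb
      obtain ⟨l, hl⟩ := hm a ha
      obtain ⟨m, hm⟩ := hm b hb
      simp only [hl, hm, Option.getD_some] at hab
      exact hinj a b l hl (hab ▸ hm)
  exact h1.trans_lt (Finset.card_erase_lt_of_mem huT)

/-- Optimality by comparison with a competing perfect matching `σ`: some tree vertex has its
`σ`-partner outside of the visited set, and the cheapest exit from the tree costs no more than this
edge of `σ`. The down-closed `P` stands for a threshold on costs. The auxiliary `rank` is the time
of the visit; it decreases along tree paths towards the root. -/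
theorem growTree_spec {c : Fin N → Fin N → WithTop ℝ} {ofRight : Fin N → Option (Fin N)}
    {u : Fin N} (hinj : ∀ a b l, ofRight a = some l → ofRight b = some l → a = b)
    (hu : ∀ w, ofRight w ≠ some u) {P : WithTop ℝ → Prop} (hP : ∀ x y, x ≤ y → P y → P x)
    {σ : Fin N → Fin N} (hσ : Function.Injective σ) (hPσ : ∀ i, P (c i (σ i)))
    (k : ℕ) (visited : Fin N → Bool) (slack : Fin N → WithTop ℝ) (parent : Fin N → Fin N)
    (θ : WithTop ℝ) (rank : Fin N → ℕ)
    (hinv : TreeInvariant c ofRight u visited slack parent θ rank)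
    (hk : N ≤ k + (Finset.univ.filter fun w => visited w = true).card) (hθ : P θ) :
    ∃ v parent' θ' rank' W,
      (growTree c ofRight k visited slack parent θ).val = (some v, parent', θ') ∧
      θ ≤ θ' ∧ P θ' ∧ AugmentingPath c ofRight u parent' θ' rank' W v := by
  classical
  have hcardT := card_visited_lt hinj hu hinv.matched
    (Finset.univ.filter fun l => InTree ofRight visited u l) (by simp)
  have hTN : (Finset.univ.filter fun l => InTree ofRight visited u l).card ≤ N := by
    simpa using Finset.card_le_univ (Finset.univ.filter fun l => InTree ofRight visited u l)
  induction k generalizing visited slack parent θ rank with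
  | zero => omega
  | succ k ih =>
    -- Pigeonhole: `σ` cannot map the tree injectively into the smaller set of visited right
    -- vertices.
    obtain ⟨l₀, hl₀, hσl₀⟩ : ∃ l, InTree ofRight visited u l ∧ visited (σ l) = false := by
      by_contra hcon
      push Not at hcon
      have := Finset.card_le_card_of_injOn (s := Finset.univ.filter fun l =>
        InTree ofRight visited u l) (t := Finset.univ.filter fun w => visited w = true) σ
        (fun l hl => by simpa using hcon l (by simpa using hl)) hσ.injOn
      omega
    rw [growTree]
    simp only [Timed.val_bind]
    rcases hbest : (argminT visited slack (List.finRange N)).val with _ | v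
    · have := argminT_none hbest (σ l₀) (List.mem_finRange _)
      simp [hσl₀] at this
    obtain ⟨hv, hmin⟩ := argminT_some hbest
    have hPv : P (slack v) := hP _ _ ((hmin _ (List.mem_finRange _) hσl₀).trans
      (hinv.slack_le _ _ hσl₀ hl₀)) (hPσ l₀)
    have hPθ : P (max θ (slack v)) := by rcases max_choice θ (slack v) with h | h <;> rwa [h]
    have hvc : c (parent v) v ≤ max θ (slack v) := by
      rw [← hinv.slack_eq v hv]; exact le_max_right _ _
    set m := (Finset.univ.filter fun w => visited w = true).card with hm
    have hne : ∀ w, visited w = true → w ≠ v := by rintro w hw rfl; simp [hv] at hw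
    rcases hr : ofRight v with _ | l
    · simp only [hr, Timed.val_bind, Timed.val_one]
      -- The new vertex gets as rank the number `m` of vertices visited before, which exceeds all
      -- their ranks.
      refine ⟨v, parent, _, Function.update rank v m, {w | visited w = true ∨ w = v}, rfl,
        le_max_left _ _, hPθ, Or.inr rfl, hr, ?_, ?_, ?_⟩
      · rintro w (hw | rfl)
        · exact (hinv.edge w hw).trans (le_max_left _ _)
        · exact hvc
      · rintro w (hw | rfl)
        · rcases hinv.path w hw with h | ⟨w', h1, h2, h3⟩
          · exact Or.inl h
          · exact Or.inr ⟨w', Or.inl h1, by simpa [hne w hw, hne w' h1] using h2, h3⟩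
        · rcases hinv.parent_mem w hv with h | ⟨w', h1, h3⟩
          · exact Or.inl h
          · exact Or.inr ⟨w', Or.inl h1, by simpa [hne w' h1] using hinv.rank_lt w' h1, h3⟩
      · simp; omega
    · simp only [hr, Timed.val_bind, Timed.val_one, Timed.val_array]
      set visited' := Function.update visited v true with hvisited'
      have hcard' : (Finset.univ.filter fun w => visited' w = true).card = m + 1 := by
        have : (Finset.univ.filter fun w => visited' w = true) =
            insert v (Finset.univ.filter fun w => visited w = true) := by
          ext w
          by_cases hw : w = v <;> simp [hvisited', hw]
        rw [this, Finset.card_insert_of_notMem (by simp [hv])]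
      have hvis : ∀ w, visited' w = true ↔ visited w = true ∨ w = v := by
        intro w; by_cases hw : w = v <;> simp [hvisited', hw]
      have hvisf : ∀ w, visited' w = false → visited w = false ∧ w ≠ v := by
        intro w; by_cases hw : w = v <;> simp [hvisited', hw]
      have hInTree : ∀ a, InTree ofRight visited' u a ↔ InTree ofRight visited u a ∨ a = l := by
        intro a
        simp only [InTree, hvis]
        constructor
        · rintro (h | ⟨w, h1 | rfl, h2⟩)
          · exact Or.inl (Or.inl h)
          · exact Or.inl (Or.inr ⟨w, h1, h2⟩)
          · rw [hr] at h2; exact Or.inr (Option.some.inj h2).symm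
        · rintro ((h | ⟨w, h1, h2⟩) | rfl)
          · exact Or.inl h
          · exact Or.inr ⟨w, Or.inl h1, h2⟩
          · exact Or.inr ⟨v, Or.inr rfl, hr⟩
      have hinv' : TreeInvariant c ofRight u visited'
          (fun w => (if visited' w = false ∧ c l w < slack w then (c l w, l)
            else (slack w, parent w)).1)
          (fun w => (if visited' w = false ∧ c l w < slack w then (c l w, l)
            else (slack w, parent w)).2) (max θ (slack v)) (Function.update rank v m) := by
        refine ⟨?_, ?_, ?_, ?_, ?_, ?_, ?_⟩
        · intro w hw
          rcases (hvis w).mp hw with h | rfl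
          · exact hinv.matched w h
          · exact ⟨l, hr⟩
        · intro w hw
          simp only [hw, Bool.true_eq_false, false_and, if_false]
          rcases (hvis w).mp hw with h | rfl
          · exact (hinv.edge w h).trans (le_max_left _ _)
          · exact hvc
        · intro w hw
          simp only [hw, Bool.true_eq_false, false_and, if_false]
          rcases (hvis w).mp hw with h | rfl
          · rcases hinv.path w h with h' | ⟨w', h1, h2, h3⟩
            · exact Or.inl h'
            · exact Or.inr ⟨w', (hvis w').mpr (Or.inl h1),
                by simpa [hne w h, hne w' h1] using h2, h3⟩
          · rcases hinv.parent_mem w hv with h | ⟨w', h1, h3⟩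
            · exact Or.inl h
            · exact Or.inr ⟨w', (hvis w').mpr (Or.inl h1),
                by simpa [hne w' h1] using hinv.rank_lt w' h1, h3⟩
        · intro w hw
          rw [hcard']
          rcases (hvis w).mp hw with h | rfl
          · have := hinv.rank_lt w h
            simp only [Function.update_of_ne (hne w h)]
            omega
          · simp
        · intro w hw
          obtain ⟨hw1, hw2⟩ := hvisf w hw
          split_ifs
          · rfl
          · exact hinv.slack_eq w hw1
        · intro w hw
          obtain ⟨hw1, hw2⟩ := hvisf w hw
          rw [hInTree]
          split_ifs
          · exact Or.inr rfl
          · exact Or.inl (hinv.parent_mem w hw1)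
        · intro w a hw ha
          obtain ⟨hw1, hw2⟩ := hvisf w hw
          rcases (hInTree a).mp ha with h | rfl
          · split_ifs with hif
            · exact hif.2.le.trans (hinv.slack_le w a hw1 h)
            · exact hinv.slack_le w a hw1 h
          · split_ifs with hif
            · exact le_rfl
            · exact not_lt.mp fun h => hif ⟨hw, h⟩
      obtain ⟨v', parent', θ', rank', W, h1, h2, h3, h4⟩ := ih visited' _ _ _ _ hinv'
        (by rw [hcard']; omega) hPθ
        (card_visited_lt hinj hu hinv'.matched _ (by simp))
        (by
          simpa using Finset.card_le_univ
            (Finset.univ.filter fun l => InTree ofRight visited' u l))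
      exact ⟨v', parent', θ', rank', W, h1, (le_max_left _ _).trans h2, h3, h4⟩

/-- In the midst of an augmentation the matching is consistent except at `v`, whose former partner
has just been rematched while `ofRight v` is outdated. The ranks strictly decrease along the path,
which bounds its length and leads to the free root `u`. -/
theorem augment_spec {c : Fin N → Fin N → WithTop ℝ} {u : Fin N} {parent : Fin N → Fin N}
    {θ : WithTop ℝ} {rank : Fin N → ℕ} {W : Set (Fin N)} (hW : ∀ w ∈ W, c (parent w) w ≤ θ)
    (k : ℕ) (v : Fin N) (M : BipMatching N) (hvW : v ∈ W) (hk : rank v < k)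
    (hM : ∀ a b, b ≠ v → (M.ofLeft a = some b ↔ M.ofRight b = some a))
    (hv : ∀ a, M.ofLeft a ≠ some v)
    (hpath : ∀ w ∈ W, rank w ≤ rank v → (M.ofLeft (parent w) = none ∧ parent w = u) ∨
      ∃ w' ∈ W, rank w' < rank w ∧ M.ofLeft (parent w) = some w') :
    (augment parent k v M).val.Valid ∧
    (∀ a b, (augment parent k v M).val.ofLeft a = some b → M.ofLeft a = some b ∨ c a b ≤ θ) ∧
    (∀ a, (augment parent k v M).val.ofLeft a = none ↔ M.ofLeft a = none ∧ a ≠ u) := by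
  induction k generalizing v M with
  | zero => exact absurd hk (Nat.not_lt_zero _)
  | succ k ih =>
    rw [augment]
    simp only [Timed.val_bind, Timed.val_one]
    set l := parent v with hl
    rcases hpath v hvW le_rfl with ⟨h1, h2⟩ | ⟨w, hwW, hwr, hw⟩
    · rw [← hl] at h1 h2
      simp only [h1]
      refine ⟨fun a b => ?_, fun a b hab => ?_, fun a => ?_⟩
      · dsimp only [Timed.val_one]
        by_cases ha : a = l <;> by_cases hb : b = v
        · simp [ha, hb]
        · subst ha
          simp only [Function.update_self, Function.update_of_ne hb, Option.some.injEq]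
          rw [← hM _ b hb, h1]
          simp [Ne.symm hb]
        · subst hb
          simp only [Function.update_self, Function.update_of_ne ha, Option.some.injEq]
          simp [hv a, Ne.symm ha]
        · simp [ha, hb, hM a b hb]
      · dsimp only [Timed.val_one] at hab
        by_cases ha : a = l
        · subst ha
          obtain rfl : v = b := by simpa using hab
          exact Or.inr (hW v hvW)
        · exact Or.inl (by simpa [ha] using hab)
      · dsimp only [Timed.val_one]
        by_cases ha : a = l
        · simp [ha, h2]
        · simp [ha, ← h2]
    · rw [← hl] at hw
      simp only [hw]
      have hwv : w ≠ v := by rintro rfl; exact lt_irrefl _ hwr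
      set M' : BipMatching N := { ofLeft := Function.update M.ofLeft l (some v)
                                  ofRight := Function.update M.ofRight v (some l) }
      have hM' : ∀ a b, b ≠ w → (M'.ofLeft a = some b ↔ M'.ofRight b = some a) := by
        intro a b hb
        dsimp only [M']
        by_cases ha : a = l <;> by_cases hbv : b = v
        · simp [ha, hbv]
        · subst ha
          simp only [Function.update_self, Function.update_of_ne hbv, Option.some.injEq]
          rw [← hM _ b hbv, hw]
          simp [Ne.symm hbv, Ne.symm hb]
        · subst hbv
          simp only [Function.update_self, Function.update_of_ne ha, Option.some.injEq]
          simp [hv a, Ne.symm ha]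
        · simp [ha, hbv, hM a b hbv]
      have hv' : ∀ a, M'.ofLeft a ≠ some w := by
        intro a
        dsimp only [M']
        by_cases ha : a = l
        · simp [ha, Ne.symm hwv]
        · rw [Function.update_of_ne ha]
          intro haw
          rw [hM _ _ hwv] at haw hw
          rw [hw] at haw
          exact ha (Option.some.inj haw).symm
      have hpath' : ∀ x ∈ W, rank x ≤ rank w →
          (M'.ofLeft (parent x) = none ∧ parent x = u) ∨
          ∃ w' ∈ W, rank w' < rank x ∧ M'.ofLeft (parent x) = some w' := by
        intro x hx hxw
        by_cases hxl : parent x = l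
        -- The remaining path cannot return to `l`: its old partner `w` would have rank less than
        -- `rank x ≤ rank w`.
        · rcases hpath x hx (by omega) with ⟨h, -⟩ | ⟨y, -, hy, h⟩
          · rw [hxl, hw] at h; simp at h
          · rw [hxl, hw] at h
            obtain rfl := Option.some.inj h
            omega
        · rcases hpath x hx (by omega) with h | h
          · exact Or.inl (by simpa [M', hxl] using h)
          · exact Or.inr (by simpa [M', hxl] using h)
      obtain ⟨h1, h2, h3⟩ := ih w M' hwW (by omega) hM' hv' hpath'
      refine ⟨h1, fun a b hab => ?_, fun a => ?_⟩
      · rcases h2 a b hab with h | h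
        · by_cases ha : a = l
          · subst ha
            obtain rfl : v = b := by simpa [M'] using h
            exact Or.inr (hW v hvW)
          · exact Or.inl (by simpa [M', ha] using h)
        · exact Or.inr h
      · rw [h3]
        by_cases ha : a = l
        · simp [M', ha, hw]
        · simp [M', ha]

/-- With `P` trivial this says that the output bounds the costs of some perfect matching; with `P`
the threshold given by a competitor `σ`, that no perfect matching is cheaper. -/
theorem assignAll_spec {c : Fin N → Fin N → WithTop ℝ} {P : WithTop ℝ → Prop}
    (hP : ∀ x y, x ≤ y → P y → P x) {σ : Fin N → Fin N} (hσ : Function.Injective σ)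
    (hPσ : ∀ i, P (c i (σ i))) (us : List (Fin N)) (M : BipMatching N) (θ : WithTop ℝ)
    (hnd : us.Nodup) (hM : M.Valid) (hfree : ∀ a, M.ofLeft a = none ↔ a ∈ us)
    (hcost : ∀ a b, M.ofLeft a = some b → c a b ≤ θ) (hθ : P θ) :
    θ ≤ (assignAll c us M θ).val ∧ P (assignAll c us M θ).val ∧
      ∃ τ : Fin N → Fin N, Function.Injective τ ∧ ∀ i, c i (τ i) ≤ (assignAll c us M θ).val := by
  induction us generalizing M θ with
  | nil =>
    refine ⟨le_rfl, hθ, ?_⟩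
    have h : ∀ a, ∃ b, M.ofLeft a = some b := fun a =>
      Option.ne_none_iff_exists'.mp (by simp [hfree])
    choose τ hτ using h
    refine ⟨τ, fun a b hab => ?_, fun i => hcost i _ (hτ i)⟩
    have h1 := (hM _ _).mp (hτ a)
    rw [hab, (hM _ _).mp (hτ b)] at h1
    exact (Option.some.inj h1).symm
  | cons u us ih =>
    rw [List.nodup_cons] at hnd
    rw [assignAll]
    simp only [Timed.val_bind, Timed.val_array, Timed.val_one]
    have hu : ∀ w, M.ofRight w ≠ some u := fun w hw => by
      rw [← hM] at hw
      simp [(hfree u).mpr List.mem_cons_self] at hw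
    have hinj : ∀ a b l, M.ofRight a = some l → M.ofRight b = some l → a = b := by
      intro a b l ha hb
      rw [← hM] at ha hb
      rw [ha] at hb
      exact Option.some.inj hb
    have hinv : TreeInvariant c M.ofRight u (fun _ => false) (c u) (fun _ => u) θ
        (fun _ => 0) := by
      refine ⟨by simp, by simp, by simp, by simp, fun _ _ => rfl, fun _ _ => Or.inl rfl, ?_⟩
      rintro w l - (rfl | ⟨w', h, -⟩)
      · exact le_rfl
      · simp at h
    obtain ⟨v, parent', θ', rank, W, h1, h2, h3, h4⟩ := growTree_spec hinj hu hP hσ hPσ N _ _ _ θ _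
      hinv (by simp) hθ
    simp only [h1]
    obtain ⟨h5, h6, h7⟩ := augment_spec h4.edge (u := u) N v M h4.mem h4.rank_lt
      (fun a b _ => hM a b) (fun a ha => by rw [hM, h4.free] at ha; simp at ha)
      (fun w hw _ => by
        rcases h4.path w hw with h | ⟨w', h8, h9, h10⟩
        · exact Or.inl ⟨by rw [h]; exact (hfree u).mpr List.mem_cons_self, h⟩
        · exact Or.inr ⟨w', h8, h9, (hM _ _).mpr h10⟩)
    obtain ⟨h8, h9⟩ := ih _ θ' hnd.2 h5 (fun a => by
        rw [h7, hfree]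
        by_cases ha : a = u
        · simp [ha, hnd.1]
        · simp [ha])
      (fun a b hab => (h6 a b hab).elim (fun h => (hcost a b h).trans h2) id) h3
    exact ⟨h2.trans h8, h9⟩

end Assignment

/-! ## Costs -/

namespace WithTop

@[simp] theorem toCost_coe (x : ℝ) : (x : WithTop ℝ).toCost = ENNReal.ofReal x := rfl
@[simp] theorem toCost_top : (⊤ : WithTop ℝ).toCost = ⊤ := rfl
@[simp] theorem toCost_zero : (0 : WithTop ℝ).toCost = 0 := ENNReal.ofReal_zero

theorem toCost_mono {x y : WithTop ℝ} (h : x ≤ y) : x.toCost ≤ y.toCost := by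
  induction y with
  | top => simp
  | coe y =>
    induction x with
    | top => simp at h
    | coe x => exact ENNReal.ofReal_le_ofReal (WithTop.coe_le_coe.mp h)

end WithTop

@[simp] theorem matchCost_coe_coe (b b' d d' : ℝ) :
    matchCost (b, (d : WithTop ℝ)) (b', (d' : WithTop ℝ)) =
      ((max |b - b'| |d - d'| : ℝ) : WithTop ℝ) := rfl
@[simp] theorem matchCost_top_top (b b' : ℝ) :
    matchCost (b, ⊤) (b', ⊤) = ((|b - b'| : ℝ) : WithTop ℝ) := rfl
@[simp] theorem matchCost_coe_top (b b' d : ℝ) :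
    matchCost (b, (d : WithTop ℝ)) (b', ⊤) = ⊤ := rfl
@[simp] theorem matchCost_top_coe (b b' d' : ℝ) :
    matchCost (b, ⊤) (b', (d' : WithTop ℝ)) = ⊤ := rfl
@[simp] theorem unmatchedCost_coe (b d : ℝ) :
    unmatchedCost (b, (d : WithTop ℝ)) = (((d - b) / 2 : ℝ) : WithTop ℝ) := rfl
@[simp] theorem unmatchedCost_top (b : ℝ) : unmatchedCost (b, ⊤) = ⊤ := rfl

theorem matchCost_triangle (x y z : ℝ × WithTop ℝ) :
    (matchCost x z).toCost ≤ (matchCost x y).toCost + (matchCost y z).toCost := by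
  obtain ⟨b, d⟩ := x
  obtain ⟨b', d'⟩ := y
  obtain ⟨b'', d''⟩ := z
  induction d <;> induction d' <;> induction d'' <;> simp only [matchCost_coe_coe,
    matchCost_coe_top, matchCost_top_coe, matchCost_top_top, WithTop.toCost_coe, WithTop.toCost_top,
    top_add, add_top, le_top, le_refl]
  · rw [← ENNReal.ofReal_add (abs_nonneg _) (abs_nonneg _)]
    exact ENNReal.ofReal_le_ofReal (abs_sub_le _ _ _)
  · rw [← ENNReal.ofReal_add (by positivity) (by positivity)]
    apply ENNReal.ofReal_le_ofReal
    exact max_le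
      ((abs_sub_le _ _ _).trans (add_le_add (le_max_left _ _) (le_max_left _ _)))
      ((abs_sub_le _ _ _).trans (add_le_add (le_max_right _ _) (le_max_right _ _)))

theorem matchCost_comm (x y : ℝ × WithTop ℝ) : matchCost x y = matchCost y x := by
  obtain ⟨b, d⟩ := x
  obtain ⟨b', d'⟩ := y
  induction d <;> induction d' <;> simp [abs_sub_comm]

theorem unmatchedCost_triangle (x y : ℝ × WithTop ℝ) :
    (unmatchedCost x).toCost ≤ (matchCost x y).toCost + (unmatchedCost y).toCost := by
  obtain ⟨b, d⟩ := x
  obtain ⟨b', d'⟩ := y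
  induction d <;> induction d' <;> simp only [matchCost_coe_coe,
    matchCost_coe_top, matchCost_top_coe, matchCost_top_top, unmatchedCost_coe,
    unmatchedCost_top, WithTop.toCost_coe, WithTop.toCost_top, top_add, add_top, le_top, le_refl]
  next d d' =>
  refine le_trans ?_ ENNReal.ofReal_add_le
  apply ENNReal.ofReal_le_ofReal
  have h1 := neg_abs_le (b - b')
  have h2 := le_abs_self (d - d')
  have h3 := le_max_left |b - b'| |d - d'|
  have h4 := le_max_right |b - b'| |d - d'|
  linarith

/-! ## Partial matchings of persistence diagrams -/

/-- There is a partial matching of `D₁` and `D₂` whose cost is at most `r`. -/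
def Matchable (r : ℝ≥0∞) (D₁ D₂ : Multiset (ℝ × WithTop ℝ)) : Prop :=
  ∃ S₁ U₁ S₂ U₂, D₁ = S₁ + U₁ ∧ D₂ = S₂ + U₂ ∧
    Multiset.Rel (fun x y => (matchCost x y).toCost ≤ r) S₁ S₂ ∧
    (∀ x ∈ U₁, (unmatchedCost x).toCost ≤ r) ∧ ∀ x ∈ U₂, (unmatchedCost x).toCost ≤ r

theorem Multiset.Rel.exists_pairs {α β : Type*} {R : α → β → Prop} {s : Multiset α}
    {t : Multiset β} (h : Multiset.Rel R s t) :
    ∃ M : Multiset (α × β), M.map Prod.fst = s ∧ M.map Prod.snd = t ∧ ∀ q ∈ M, R q.1 q.2 := by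
  induction h with
  | zero => exact ⟨0, rfl, rfl, by simp⟩
  | @cons a b s t hab _ ih =>
    obtain ⟨M, rfl, rfl, hM⟩ := ih
    refine ⟨(a, b) ::ₘ M, by simp, by simp, fun q hq => ?_⟩
    rcases Multiset.mem_cons.mp hq with rfl | hq
    · exact hab
    · exact hM q hq

theorem Multiset.rel_of_pairs {α β : Type*} {R : α → β → Prop} (M : Multiset (α × β))
    (hM : ∀ q ∈ M, R q.1 q.2) : Multiset.Rel R (M.map Prod.fst) (M.map Prod.snd) := by
  rw [Multiset.rel_map]
  exact Multiset.rel_refl_of_refl_on hM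

theorem Multiset.Rel.comp {α β γ : Type*} {R : α → β → Prop} {S : β → γ → Prop}
    {T : α → γ → Prop} (hT : ∀ a b c, R a b → S b c → T a c) {s : Multiset α} {t : Multiset β}
    {u : Multiset γ} (h1 : Multiset.Rel R s t) (h2 : Multiset.Rel S t u) :
    Multiset.Rel T s u := by
  induction h1 generalizing u with
  | zero => rw [Multiset.rel_zero_left] at h2; subst h2; exact Multiset.Rel.zero
  | cons hab _ ih =>
    obtain ⟨c, u', hbc, hu', rfl⟩ := Multiset.rel_cons_left.mp h2
    exact Multiset.Rel.cons (hT _ _ _ hab hbc) (ih hu')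

namespace Matchable

variable {r r' : ℝ≥0∞} {D₁ D₂ D₃ E₁ E₂ : Multiset (ℝ × WithTop ℝ)}

theorem bottleneckDist_le (h : Matchable r D₁ D₂) : bottleneckDist D₁ D₂ ≤ r := by
  obtain ⟨S₁, U₁, S₂, U₂, rfl, rfl, hS, hU₁, hU₂⟩ := h
  obtain ⟨M, rfl, rfl, hM⟩ := hS.exists_pairs
  refine iInf₂_le_of_le M ⟨by simp, by simp⟩ ?_
  simp only [matchingCost, add_tsub_cancel_left]
  refine sup_le (sup_le ?_ ?_) ?_ <;> rw [Multiset.sup_le] <;> simp only [Multiset.mem_map]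
  · rintro _ ⟨q, hq, rfl⟩; exact hM q hq
  · rintro _ ⟨q, hq, rfl⟩; exact hU₁ q hq
  · rintro _ ⟨q, hq, rfl⟩; exact hU₂ q hq

theorem of_matching {M : Multiset ((ℝ × WithTop ℝ) × (ℝ × WithTop ℝ))}
    (hM : M.map Prod.fst ≤ D₁ ∧ M.map Prod.snd ≤ D₂) (hr : matchingCost D₁ D₂ M ≤ r) :
    Matchable r D₁ D₂ := by
  unfold matchingCost at hr
  rw [sup_le_iff, sup_le_iff, Multiset.sup_le, Multiset.sup_le, Multiset.sup_le] at hr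
  exact ⟨_, D₁ - M.map Prod.fst, _, D₂ - M.map Prod.snd, (add_tsub_cancel_of_le hM.1).symm,
    (add_tsub_cancel_of_le hM.2).symm,
    Multiset.rel_of_pairs M fun q hq => hr.1.1 _ (Multiset.mem_map_of_mem _ hq),
    fun x hx => hr.1.2 _ (Multiset.mem_map_of_mem _ hx),
    fun x hx => hr.2 _ (Multiset.mem_map_of_mem _ hx)⟩

theorem mono (h : Matchable r D₁ D₂) (hr : r ≤ r') : Matchable r' D₁ D₂ := by
  obtain ⟨S₁, U₁, S₂, U₂, h1, h2, hS, hU₁, hU₂⟩ := h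
  exact ⟨S₁, U₁, S₂, U₂, h1, h2, hS.mono fun _ _ _ _ h => h.trans hr,
    fun x hx => (hU₁ x hx).trans hr, fun x hx => (hU₂ x hx).trans hr⟩

theorem symm (h : Matchable r D₁ D₂) : Matchable r D₂ D₁ := by
  obtain ⟨S₁, U₁, S₂, U₂, h1, h2, hS, hU₁, hU₂⟩ := h
  refine ⟨S₂, U₂, S₁, U₁, h2, h1, ?_, hU₂, hU₁⟩
  rw [← Multiset.rel_flip]
  exact hS.mono fun x _ y _ h => by rwa [flip, matchCost_comm]

theorem zero : Matchable r 0 0 := ⟨0, 0, 0, 0, rfl, rfl, Multiset.Rel.zero, by simp, by simp⟩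

theorem add (h : Matchable r D₁ D₂) (h' : Matchable r E₁ E₂) :
    Matchable r (D₁ + E₁) (D₂ + E₂) := by
  obtain ⟨S₁, U₁, S₂, U₂, rfl, rfl, hS, hU₁, hU₂⟩ := h
  obtain ⟨S₁', U₁', S₂', U₂', rfl, rfl, hS', hU₁', hU₂'⟩ := h'
  refine ⟨S₁ + S₁', U₁ + U₁', S₂ + S₂', U₂ + U₂', by abel, by abel, hS.add hS', ?_, ?_⟩
  · intro x hx
    rcases Multiset.mem_add.mp hx with h | h
    exacts [hU₁ x h, hU₁' x h]
  · intro x hx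
    rcases Multiset.mem_add.mp hx with h | h
    exacts [hU₂ x h, hU₂' x h]

theorem sum {ι : Type*} (s : Finset ι) {D E : ι → Multiset (ℝ × WithTop ℝ)}
    (h : ∀ i ∈ s, Matchable r (D i) (E i)) : Matchable r (∑ i ∈ s, D i) (∑ i ∈ s, E i) := by
  classical
  induction s using Finset.induction_on with
  | empty => exact zero
  | insert a s ha ih =>
    rw [Finset.sum_insert ha, Finset.sum_insert ha]
    exact (h a (Finset.mem_insert_self a s)).add
      (ih fun i hi => h i (Finset.mem_insert_of_mem hi))

theorem singleton {x y : ℝ × WithTop ℝ} (h : (matchCost x y).toCost ≤ r) :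
    Matchable r {x} {y} :=
  ⟨{x}, 0, {y}, 0, rfl, rfl, Multiset.Rel.cons h Multiset.Rel.zero, by simp, by simp⟩

theorem singleton_zero {x : ℝ × WithTop ℝ} (h : (unmatchedCost x).toCost ≤ r) :
    Matchable r {x} 0 :=
  ⟨0, {x}, 0, 0, rfl, rfl, Multiset.Rel.zero, by simpa using h, by simp⟩

/-- Pairs are composed where the middle point is matched on both sides. A point whose partner is
unmatched on the other side becomes unmatched, at a cost controlled by `unmatchedCost_triangle`. -/
theorem trans (h : Matchable r D₁ D₂) (h' : Matchable r' D₂ D₃) :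
    Matchable (r + r') D₁ D₃ := by
  classical
  obtain ⟨S₁, U₁, S₂, U₂, rfl, rfl, hS, hU₁, hU₂⟩ := h
  obtain ⟨T₂, V₂, T₃, V₃, hD, rfl, hT, hV₂, hV₃⟩ := h'
  -- `S₂` and `T₂` are the middle points matched to the left and to the right; those in only one of
  -- them are unmatched on the other side.
  have hS₂ : S₂ = S₂ ∩ T₂ + (S₂ - T₂) := by
    ext a; simp only [Multiset.count_add, Multiset.count_inter, Multiset.count_sub]; omega
  have hT₂ : T₂ = S₂ ∩ T₂ + (T₂ - S₂) := by
    ext a; simp only [Multiset.count_add, Multiset.count_inter, Multiset.count_sub]; omega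
  have hBV : S₂ - T₂ ≤ V₂ := by
    rw [tsub_le_iff_left, ← hD]; exact Multiset.le_add_right _ _
  have hCU : T₂ - S₂ ≤ U₂ := by
    rw [tsub_le_iff_left, hD]; exact Multiset.le_add_right _ _
  rw [hS₂, Multiset.rel_add_right] at hS
  rw [hT₂, Multiset.rel_add_left] at hT
  obtain ⟨A₁, B₁, hA₁, hB₁, rfl⟩ := hS
  obtain ⟨A₃, C₃, hA₃, hC₃, rfl⟩ := hT
  refine ⟨A₁, B₁ + U₁, A₃, C₃ + V₃, by abel, by abel,
    hA₁.comp (fun a b c h1 h2 => (matchCost_triangle a b c).trans (add_le_add h1 h2)) hA₃,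
    fun x hx => ?_, fun x hx => ?_⟩
  · rcases Multiset.mem_add.mp hx with h | h
    · obtain ⟨y, hy, hxy⟩ := Multiset.exists_mem_of_rel_of_mem hB₁ h
      exact (unmatchedCost_triangle x y).trans
        (add_le_add hxy (hV₂ y (Multiset.mem_of_le hBV hy)))
    · exact (hU₁ x h).trans le_self_add
  · rcases Multiset.mem_add.mp hx with h | h
    · obtain ⟨y, hy, hxy⟩ := Multiset.exists_mem_of_rel_of_mem (Multiset.rel_flip.mpr hC₃) h
      refine (unmatchedCost_triangle x y).trans ?_
      rw [matchCost_comm, add_comm]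
      exact add_le_add (hU₂ y (Multiset.mem_of_le hCU hy)) hxy
    · exact (hV₃ x h).trans le_add_self

end Matchable

/-! ## Correctness of the bottleneck algorithm -/

theorem Multiset.Rel.exists_injective {N : ℕ} {R : Fin N → Fin N → Prop}
    (h : Multiset.Rel R Finset.univ.val Finset.univ.val) :
    ∃ σ : Fin N → Fin N, Function.Injective σ ∧ ∀ i, R i (σ i) := by
  obtain ⟨M, h1, h2, hM⟩ := h.exists_pairs
  have h3 : ∀ i, ∃ j, (i, j) ∈ M := by
    intro i
    have : i ∈ M.map Prod.fst := by rw [h1]; exact Finset.mem_univ i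
    obtain ⟨⟨_, j⟩, hq, rfl⟩ := Multiset.mem_map.mp this
    exact ⟨j, hq⟩
  choose σ hσ using h3
  refine ⟨σ, fun i i' hii => ?_, fun i => hM _ (hσ i)⟩
  have hnd : (M.map Prod.snd).Nodup := by rw [h2]; exact Finset.univ.nodup
  have := (Multiset.inj_on_of_nodup_map hnd) _ (hσ i) _ (hσ i') hii
  exact congrArg Prod.fst this

theorem map_getElem?_univ {α : Type*} (l : List α) (m : ℕ) :
    (Finset.univ : Finset (Fin (l.length + m))).val.map
        (fun i : Fin (l.length + m) => l[(i : ℕ)]?) =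
      (l : Multiset α).map some + Multiset.replicate m none := by
  have h1 : (Finset.univ : Finset (Fin (l.length + m))).val =
      (List.finRange (l.length + m) : Multiset (Fin (l.length + m))) := rfl
  rw [h1, Multiset.map_coe, Multiset.map_coe, ← Multiset.coe_replicate, Multiset.coe_add]
  congr 1
  apply List.ext_getElem
  · simp
  · intro i h1 h2
    simp only [List.length_map, List.length_finRange] at h1
    by_cases hi : i < l.length
    · simp [hi]
    · simp [List.getElem_append, hi]

/-- Unmatched points are sent to diagonal slots of the other side, and superfluous slots are matched
with each other at cost 0. Conversely, deleting the slots from a perfect matching leaves a partial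
matching. -/
theorem matchable_iff_rel_edgeCost {r : ℝ≥0∞} (l₁ l₂ : List (ℝ × WithTop ℝ)) :
    Matchable r l₁ l₂ ↔ Multiset.Rel (fun x y => (edgeCost x y).toCost ≤ r)
      ((l₁ : Multiset _).map some + Multiset.replicate l₂.length none)
      ((l₂ : Multiset _).map some + Multiset.replicate l₁.length none) := by
  constructor
  · rintro ⟨S₁, U₁, S₂, U₂, h1, h2, hS, hU₁, hU₂⟩
    have hc₁ : l₁.length = S₁.card + U₁.card := by
      rw [← Multiset.coe_card, h1, Multiset.card_add]
    have hc₂ : l₂.length = S₁.card + U₂.card := by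
      rw [← Multiset.coe_card, h2, Multiset.card_add, Multiset.card_eq_card_of_rel hS]
    have key : ∀ U : Multiset (ℝ × WithTop ℝ), (∀ x ∈ U, (unmatchedCost x).toCost ≤ r) →
        Multiset.Rel (fun x y => (edgeCost x y).toCost ≤ r) (U.map some)
          (Multiset.replicate U.card none) := by
      intro U hU
      rw [← Multiset.map_const', Multiset.rel_map]
      exact Multiset.rel_refl_of_refl_on hU
    have key' : ∀ U : Multiset (ℝ × WithTop ℝ), (∀ x ∈ U, (unmatchedCost x).toCost ≤ r) →
        Multiset.Rel (fun x y => (edgeCost x y).toCost ≤ r)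
          (Multiset.replicate U.card none) (U.map some) := by
      intro U hU
      rw [← Multiset.map_const', Multiset.rel_map]
      exact Multiset.rel_refl_of_refl_on hU
    have key'' : ∀ m, Multiset.Rel (fun x y => (edgeCost x y).toCost ≤ r)
        (Multiset.replicate m none) (Multiset.replicate m none) := by
      intro m
      refine Multiset.rel_refl_of_refl_on fun x hx => ?_
      obtain rfl := Multiset.eq_of_mem_replicate hx
      simp [edgeCost]
    have hS' : Multiset.Rel (fun x y => (edgeCost x y).toCost ≤ r) (S₁.map some)
        (S₂.map some) := by
      rw [Multiset.rel_map]; exact hS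
    -- On each side, exactly one slot per matched pair remains, that is, `S₁.card` slots.
    have := ((hS'.add (key _ hU₁)).add (key' _ hU₂)).add (key'' S₁.card)
    rw [h1, h2, hc₁, hc₂, Multiset.map_add, Multiset.map_add, Multiset.replicate_add,
      Multiset.replicate_add]
    convert this using 1 <;> abel
  · intro h
    have key : ∀ s t, Multiset.Rel (fun x y => (edgeCost x y).toCost ≤ r) s t →
        Matchable r (s.filterMap id) (t.filterMap id) := by
      intro s t hst
      induction hst with
      | zero => exact Matchable.zero
      | @cons x y s t hxy _ ih =>
        rcases x with _ | x <;> rcases y with _ | y <;>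
          simp only [Multiset.filterMap_cons, id, Option.map_none, Option.map_some,
            Option.getD_none, Option.getD_some, zero_add]
        · exact ih
        · simpa using (Matchable.singleton_zero hxy).symm.add ih
        · simpa using (Matchable.singleton_zero hxy).add ih
        · exact (Matchable.singleton hxy).add ih
    have hfm : ∀ (D : Multiset (ℝ × WithTop ℝ)) m,
        (D.map some + Multiset.replicate m none).filterMap id = D := by
      intro D m
      induction m with
      | zero => simp [Multiset.filterMap_map]
      | succ m ih =>
        rw [Multiset.replicate_succ, Multiset.add_cons, Multiset.filterMap_cons_none _ _ rfl, ih]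
    have := key _ _ h
    rwa [hfm, hfm] at this

theorem bottleneckAlg_spec (l₁ l₂ : List (ℝ × WithTop ℝ)) :
    0 ≤ (bottleneckAlg l₁ l₂).val ∧ Matchable (bottleneckAlg l₁ l₂).val.toCost l₁ l₂ ∧
      ∀ r, Matchable r l₁ l₂ → (bottleneckAlg l₁ l₂).val.toCost ≤ r := by
  set N := l₁.length + l₂.length with hN
  set c : Fin N → Fin N → WithTop ℝ := fun i j => edgeCost l₁[(i : ℕ)]? l₂[(j : ℕ)]? with hc
  have hval : (bottleneckAlg l₁ l₂).val =
    (assignAll c (List.finRange N) ⟨fun _ => none, fun _ => none⟩ 0).val := rfl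
  have hrel : ∀ r, Matchable r l₁ l₂ ↔
      Multiset.Rel (fun i j => (c i j).toCost ≤ r) Finset.univ.val Finset.univ.val := by
    intro r
    have h2 := map_getElem?_univ l₂ l₁.length
    rw [show l₂.length + l₁.length = N by omega] at h2
    rw [matchable_iff_rel_edgeCost, ← map_getElem?_univ l₁ l₂.length, ← h2, Multiset.rel_map]
  have hassign := fun (P : WithTop ℝ → Prop) (hP : ∀ x y, x ≤ y → P y → P x)
      (σ : Fin N → Fin N) (hσ : Function.Injective σ) (hPσ : ∀ i, P (c i (σ i))) (h0 : P 0) =>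
    assignAll_spec hP hσ hPσ (List.finRange N) ⟨fun _ => none, fun _ => none⟩ 0
      (List.nodup_finRange N) (fun a b => by simp) (fun a => by simp) (fun a b h => by simp at h) h0
  rw [hval]
  -- The trivial predicate extracts the matching found by the algorithm; below, a threshold
  -- predicate gives optimality.
  obtain ⟨h1, -, τ, hτ, hτc⟩ := hassign (fun _ => True) (fun _ _ _ h => h) id
    Function.injective_id (fun _ => trivial) trivial
  refine ⟨h1, ?_, fun r hr => ?_⟩
  · rw [hrel]
    have huniv : (Finset.univ : Finset (Fin N)).val = Finset.univ.val.map τ := by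
      have := congrArg Finset.val
        (Finset.map_univ_equiv (Equiv.ofBijective τ (Finite.injective_iff_bijective.mp hτ)))
      exact this.symm
    conv => arg 3; rw [huniv]
    rw [Multiset.rel_map_right]
    exact Multiset.rel_refl_of_refl_on fun i _ => WithTop.toCost_mono (hτc i)
  · obtain ⟨σ, hσ, hσc⟩ := ((hrel r).mp hr).exists_injective
    exact (hassign (fun x => x.toCost ≤ r) (fun x y h hy => (WithTop.toCost_mono h).trans hy)
      σ hσ hσc (by simp)).2.1

theorem toCost_val_bottleneckAlg (l₁ l₂ : List (ℝ × WithTop ℝ)) :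
    (bottleneckAlg l₁ l₂).val.toCost = bottleneckDist l₁ l₂ := by
  obtain ⟨-, h1, h2⟩ := bottleneckAlg_spec l₁ l₂
  exact le_antisymm (le_iInf₂ fun M hM => h2 _ (Matchable.of_matching hM le_rfl))
    h1.bottleneckDist_le

/-- The infimum in the definition of the bottleneck distance is attained. -/
theorem matchable_iff {r : ℝ≥0∞} {D₁ D₂ : Multiset (ℝ × WithTop ℝ)} :
    Matchable r D₁ D₂ ↔ bottleneckDist D₁ D₂ ≤ r := by
  refine ⟨Matchable.bottleneckDist_le, fun h => ?_⟩
  -- The output of the algorithm serves as an optimal matching.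
  have := (bottleneckAlg_spec D₁.toList D₂.toList).2.1
  rw [toCost_val_bottleneckAlg, Multiset.coe_toList, Multiset.coe_toList] at this
  exact this.mono h

theorem bottleneckDist_comm (D₁ D₂ : Multiset (ℝ × WithTop ℝ)) :
    bottleneckDist D₁ D₂ = bottleneckDist D₂ D₁ :=
  le_antisymm (matchable_iff.mpr le_rfl).symm.bottleneckDist_le
    (matchable_iff.mpr le_rfl).symm.bottleneckDist_le

theorem bottleneckDist_triangle (D₁ D₂ D₃ : Multiset (ℝ × WithTop ℝ)) :
    bottleneckDist D₁ D₃ ≤ bottleneckDist D₁ D₂ + bottleneckDist D₂ D₃ :=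
  ((matchable_iff.mpr le_rfl).trans (matchable_iff.mpr le_rfl)).bottleneckDist_le

/-! ## Stability -/

namespace FinComplex

variable {V : Type*} [DecidableEq V] {K : FinComplex V}

/-- With the pairing fixed, each point moves by at most `δ`. If a point is present for only one of
the functions, the other one has the reverse inequality, so its persistence is at most `2 * δ` and
the diagonal is within reach. -/
theorem Reduction.matchable_pointsAt {V : Type*} {K : FinComplex V}
    (owner : Fin K.size → Option (Fin K.size))
    {f g : Fin K.size → ℝ} {δ : ℝ} (h : ∀ i, |f i - g i| ≤ δ) (p : ℕ) (i : Fin K.size) :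
    Matchable (ENNReal.ofReal δ) (pointsAt owner f p i) (pointsAt owner g p i) := by
  have h' := fun i => abs_le.mp (h i)
  unfold pointsAt
  by_cases hc : (K.simplex i).card = p + 1
  · rw [if_pos hc, if_pos hc]
    rcases owner i with _ | j
    · by_cases hi : ∃ a, owner a = some i
      · simp only [if_pos hi]
        exact Matchable.zero
      · simp only [if_neg hi]
        exact Matchable.singleton (ENNReal.ofReal_le_ofReal (h i))
    · dsimp only
      split_ifs with hf hg hg
      · exact Matchable.singleton (ENNReal.ofReal_le_ofReal (max_le (h i) (h j)))
      · refine Matchable.singleton_zero (ENNReal.ofReal_le_ofReal ?_)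
        have h1 := h' i; have h2 := h' j; linarith
      · refine (Matchable.singleton_zero (ENNReal.ofReal_le_ofReal ?_)).symm
        have h1 := h' i; have h2 := h' j; linarith
      · exact Matchable.zero
  · rw [if_neg hc, if_neg hc]
    exact Matchable.zero

/-- Without inverted pairs, an ordering by `f + g` is compatible with both functions, so they share
one reduction and one pairing. -/
theorem bottleneckDist_diagram_le_of_concordant {f g : Fin K.size → ℝ}
    (hfg : ∀ i j, ¬ (f i < f j ∧ g j < g i)) {δ : ℝ} (h : ∀ i, |f i - g i| ≤ δ) (p : ℕ) :
    bottleneckDist (K.diagram f p) (K.diagram g p) ≤ ENNReal.ofReal δ := by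
  obtain ⟨ord, hnd, hmem, hpw⟩ := exists_order (f + g)
  rw [diagram_eq_sum_pointsAt hnd hmem (f := f), diagram_eq_sum_pointsAt hnd hmem (f := g)]
  · exact (Matchable.sum _ fun i _ => Reduction.matchable_pointsAt _ h p i).bottleneckDist_le
  · refine hpw.imp fun {i j} hij => ?_
    simp only [Pi.add_apply] at hij
    by_contra hcon
    exact hfg i j ⟨by linarith, by linarith⟩
  · refine hpw.imp fun {i j} hij => ?_
    simp only [Pi.add_apply] at hij
    by_contra hcon
    exact hfg j i ⟨by linarith, by linarith⟩

/-- Stability of persistence diagrams. -/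
theorem bottleneckDist_diagram_le {f g : Fin K.size → ℝ} {δ : ℝ} (h : ∀ i, |f i - g i| ≤ δ)
    (p : ℕ) : bottleneckDist (K.diagram f p) (K.diagram g p) ≤ ENNReal.ofReal δ := by
  classical
  induction hn : (Finset.univ.filter fun q : Fin K.size × Fin K.size =>
    f q.1 < f q.2 ∧ g q.2 < g q.1).card using Nat.strong_induction_on generalizing f g δ with
  | _ n ih =>
    by_cases hcon : ∃ i j, f i < f j ∧ g j < g i
    · obtain ⟨i, j, hf, hg⟩ := hcon
      have hδ : 0 ≤ δ := (abs_nonneg _).trans (h i)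
      -- At time `t`, linear interpolation gives `i` and `j` the same value. Interpolation creates
      -- no new inversions, so the intermediate function `e` has strictly fewer inversions against
      -- either end, and the two bounds `t * δ` and `(1 - t) * δ` add up to `δ`.
      set t : ℝ := (f j - f i) / ((f j - f i) + (g i - g j)) with ht
      have hpos : 0 < (f j - f i) + (g i - g j) := by linarith
      have ht0 : 0 < t := div_pos (by linarith) hpos
      have ht1 : t < 1 := (div_lt_one hpos).mpr (by linarith)
      set e : Fin K.size → ℝ := fun k => (1 - t) * f k + t * g k with he
      have htie : e i = e j := by
        have : t * ((f j - f i) + (g i - g j)) = f j - f i := div_mul_cancel₀ _ hpos.ne'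
        simp only [he]; linarith
      have hfe : bottleneckDist (K.diagram f p) (K.diagram e p) ≤ ENNReal.ofReal (t * δ) := by
        refine ih _ ?_ (fun k => ?_) rfl
        · rw [← hn]
          refine Finset.card_lt_card (Finset.ssubset_iff_of_subset ?_ |>.mpr
            ⟨(i, j), by simp [hf, hg], by simp [htie]⟩)
          intro q hq
          simp only [Finset.mem_filter, Finset.mem_univ, true_and, he] at hq ⊢
          refine ⟨hq.1, ?_⟩
          by_contra hle
          nlinarith [hq.1, hq.2]
        · have : f k - e k = t * (f k - g k) := by simp only [he]; ring
          rw [this, abs_mul, abs_of_pos ht0]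
          exact mul_le_mul_of_nonneg_left (h k) ht0.le
      have heg : bottleneckDist (K.diagram e p) (K.diagram g p) ≤
          ENNReal.ofReal ((1 - t) * δ) := by
        refine ih _ ?_ (fun k => ?_) rfl
        · rw [← hn]
          refine Finset.card_lt_card (Finset.ssubset_iff_of_subset ?_ |>.mpr
            ⟨(i, j), by simp [hf, hg], by simp [htie]⟩)
          intro q hq
          simp only [Finset.mem_filter, Finset.mem_univ, true_and, he] at hq ⊢
          refine ⟨?_, hq.2⟩
          by_contra hle
          nlinarith [hq.1, hq.2]
        · have : e k - g k = (1 - t) * (f k - g k) := by simp only [he]; ring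
          rw [this, abs_mul, abs_of_pos (by linarith : 0 < 1 - t)]
          exact mul_le_mul_of_nonneg_left (h k) (by linarith)
      refine (bottleneckDist_triangle _ (K.diagram e p) _).trans
        ((add_le_add hfe heg).trans_eq ?_)
      rw [← ENNReal.ofReal_add (by positivity) (mul_nonneg (by linarith) hδ)]
      congr 1; ring
    · push Not at hcon
      exact bottleneckDist_diagram_le_of_concordant
        (fun i j hij => not_le.mpr hij.2 (hcon i j hij.1)) h p

end FinComplex

/-! ## Affine changes of the critical values -/

/-- The effect of an affine change of critical values on the points of a persistence diagram. -/
noncomputable def affinePoint (w s : ℝ) (x : ℝ × WithTop ℝ) : ℝ × WithTop ℝ :=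
  (w * x.1 + s, x.2.map fun d => w * d + s)

theorem toCost_matchCost_affinePoint {w : ℝ} (hw : 0 < w) (s : ℝ) (x y : ℝ × WithTop ℝ) :
    (matchCost (affinePoint w s x) (affinePoint w s y)).toCost =
      ENNReal.ofReal w * (matchCost x y).toCost := by
  have habs : ∀ a b : ℝ, |w * a + s - (w * b + s)| = w * |a - b| := fun a b => by
    rw [show w * a + s - (w * b + s) = w * (a - b) by ring, abs_mul, abs_of_pos hw]
  obtain ⟨b, d⟩ := x
  obtain ⟨b', d'⟩ := y
  induction d <;> induction d' <;>
    simp only [affinePoint, WithTop.map_coe, WithTop.map_top, matchCost_coe_coe, matchCost_top_top,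
      matchCost_coe_top, matchCost_top_coe, WithTop.toCost_coe, WithTop.toCost_top, habs,
      ENNReal.mul_top (ENNReal.ofReal_pos.mpr hw).ne']
  · rw [ENNReal.ofReal_mul hw.le]
  · rw [← mul_max_of_nonneg _ _ hw.le, ENNReal.ofReal_mul hw.le]

theorem toCost_unmatchedCost_affinePoint {w : ℝ} (hw : 0 < w) (s : ℝ) (x : ℝ × WithTop ℝ) :
    (unmatchedCost (affinePoint w s x)).toCost =
      ENNReal.ofReal w * (unmatchedCost x).toCost := by
  obtain ⟨b, d⟩ := x
  induction d <;>
    simp only [affinePoint, WithTop.map_coe, WithTop.map_top, unmatchedCost_coe, unmatchedCost_top,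
      WithTop.toCost_coe, WithTop.toCost_top, ENNReal.mul_top (ENNReal.ofReal_pos.mpr hw).ne']
  rw [← ENNReal.ofReal_mul hw.le]
  congr 1; ring

theorem Matchable.affine {w : ℝ} (hw : 0 < w) (s : ℝ) {r : ℝ≥0∞}
    {D₁ D₂ : Multiset (ℝ × WithTop ℝ)} (h : Matchable r D₁ D₂) :
    Matchable (ENNReal.ofReal w * r) (D₁.map (affinePoint w s)) (D₂.map (affinePoint w s)) := by
  obtain ⟨S₁, U₁, S₂, U₂, rfl, rfl, hS, hU₁, hU₂⟩ := h
  refine ⟨_, _, _, _, Multiset.map_add _ _ _, Multiset.map_add _ _ _, ?_, ?_, ?_⟩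
  · rw [Multiset.rel_map]
    exact hS.mono fun x _ y _ hxy => by
      rw [toCost_matchCost_affinePoint hw]; exact mul_le_mul_right hxy _
  all_goals
    intro x hx
    obtain ⟨y, hy, rfl⟩ := Multiset.mem_map.mp hx
    rw [toCost_unmatchedCost_affinePoint hw]
  · exact mul_le_mul_right (hU₁ y hy) _
  · exact mul_le_mul_right (hU₂ y hy) _

namespace FinComplex

variable {V₁ V₂ : Type*} [DecidableEq V₁] [DecidableEq V₂] {K : FinComplex V₁} {K' : FinComplex V₂}

theorem diagram_affine {w : ℝ} (hw : 0 < w) (s : ℝ) (f : Fin K.size → ℝ) (p : ℕ) :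
    K.diagram (fun i => w * f i + s) p = (K.diagram f p).map (affinePoint w s) := by
  obtain ⟨ord, hnd, hmem, hpw⟩ := exists_order f
  have hlt : ∀ a b : ℝ, w * a + s < w * b + s ↔ a < b := fun a b => by
    rw [add_lt_add_iff_right, mul_lt_mul_iff_right₀ hw]
  rw [diagram_eq_sum_pointsAt hnd hmem hpw, diagram_eq_sum_pointsAt hnd hmem
    (hpw.imp fun h => by have := mul_le_mul_of_nonneg_left h hw.le; linarith)]
  rw [← Multiset.coe_mapAddMonoidHom, map_sum]
  refine Finset.sum_congr rfl fun i _ => ?_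
  rw [Multiset.coe_mapAddMonoidHom]
  unfold Reduction.pointsAt
  by_cases hc : (K.simplex i).card = p + 1
  · rw [if_pos hc, if_pos hc]
    rcases (reductionResult ord).owner i with _ | j
    · dsimp only
      split_ifs <;> simp [affinePoint]
    · simp only [hlt]
      split_ifs <;> simp [affinePoint]
  · rw [if_neg hc, if_neg hc, Multiset.map_zero]

theorem bottleneckDist_affine {w : ℝ} (hw : 0 < w) (s : ℝ) (f : Fin K.size → ℝ)
    (g : Fin K'.size → ℝ) (p : ℕ) :
    bottleneckDist (K.diagram (fun i => w * f i + s) p) (K'.diagram (fun i => w * g i + s) p) =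
      ENNReal.ofReal w * bottleneckDist (K.diagram f p) (K'.diagram g p) := by
  have key : ∀ {w : ℝ} (_ : 0 < w) (s : ℝ) (f : Fin K.size → ℝ) (g : Fin K'.size → ℝ),
      bottleneckDist (K.diagram (fun i => w * f i + s) p) (K'.diagram (fun i => w * g i + s) p) ≤
      ENNReal.ofReal w * bottleneckDist (K.diagram f p) (K'.diagram g p) := by
    intro w hw s f g
    rw [diagram_affine hw, diagram_affine hw]
    exact ((matchable_iff.mpr le_rfl).affine hw s).bottleneckDist_le
  refine le_antisymm (key hw s f g) ?_
  -- The reverse inequality is the same estimate for the inverse affine map.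
  have h1 := key (inv_pos.mpr hw) (-(w⁻¹ * s)) (fun i => w * f i + s) (fun i => w * g i + s)
  have h2 : ∀ a : ℝ, w⁻¹ * (w * a + s) + -(w⁻¹ * s) = a := fun a => by field_simp; ring
  simp only [h2] at h1
  refine (mul_le_mul_right h1 _).trans_eq ?_
  rw [← mul_assoc, ← ENNReal.ofReal_mul hw.le, mul_inv_cancel₀ hw.ne', ENNReal.ofReal_one, one_mul]

/-! ## Diagrams with bounded coordinates -/

theorem mem_diagram {f : Fin K.size → ℝ} {p : ℕ} {x : ℝ × WithTop ℝ} (hx : x ∈ K.diagram f p) :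
    ∃ i, x.1 = f i ∧ (x.2 = ⊤ ∨ ∃ j, x.2 = ((f j : ℝ) : WithTop ℝ)) := by
  unfold diagram at hx
  obtain ⟨b, hb, hx⟩ := Multiset.mem_sum.mp hx
  obtain ⟨i, -, rfl⟩ := Finset.mem_image.mp hb
  refine ⟨i, ?_⟩
  rcases Multiset.mem_add.mp hx with h | h
  · rw [Multiset.eq_of_mem_replicate h]
    exact ⟨rfl, Or.inl rfl⟩
  · obtain ⟨d, hd, h⟩ := Multiset.mem_sum.mp h
    obtain ⟨j, -, rfl⟩ := Finset.mem_image.mp (Finset.mem_filter.mp hd).1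
    rw [Multiset.eq_of_mem_replicate h]
    exact ⟨rfl, Or.inr ⟨j, rfl⟩⟩

/-- Diagrams with coordinates in `[0, C]` at finite distance have distance at most `C`. -/
theorem bottleneckDist_diagram_le_of_bounded {C : ℝ} {f : Fin K.size → ℝ} {g : Fin K'.size → ℝ}
    (hf : ∀ i, f i ∈ Set.Icc 0 C) (hg : ∀ i, g i ∈ Set.Icc 0 C) (p : ℕ)
    (hne : bottleneckDist (K.diagram f p) (K'.diagram g p) ≠ ⊤) :
    bottleneckDist (K.diagram f p) (K'.diagram g p) ≤ ENNReal.ofReal C := by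
  have habs : ∀ a b : ℝ, a ∈ Set.Icc 0 C → b ∈ Set.Icc 0 C → |a - b| ≤ C := fun a b ha hb =>
    abs_le.mpr ⟨by linarith [ha.1, hb.2], by linarith [ha.2, hb.1]⟩
  have hunm : ∀ x : ℝ × WithTop ℝ, x.1 ∈ Set.Icc 0 C →
      (x.2 = ⊤ ∨ ∃ d ∈ Set.Icc 0 C, x.2 = ((d : ℝ) : WithTop ℝ)) →
      (unmatchedCost x).toCost ≠ ⊤ → (unmatchedCost x).toCost ≤ ENNReal.ofReal C := by
    rintro ⟨b, _⟩ hb (rfl | ⟨d, hd, rfl⟩) h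
    · simp at h
    · refine ENNReal.ofReal_le_ofReal ?_
      have := hb.1; have := hd.2; have := hd.1; dsimp only at *; linarith
  -- An optimal matching of finite cost pairs infinite points only with infinite points and leaves
  -- none unmatched; all its costs are then bounded by differences of numbers in `[0, C]`.
  obtain ⟨S₁, U₁, S₂, U₂, h1, h2, hS, hU₁, hU₂⟩ := matchable_iff.mpr
    (le_refl (bottleneckDist (K.diagram f p) (K'.diagram g p)))
  have hmem₁ : ∀ x ∈ K.diagram f p, x.1 ∈ Set.Icc 0 C ∧
      (x.2 = ⊤ ∨ ∃ d ∈ Set.Icc 0 C, x.2 = ((d : ℝ) : WithTop ℝ)) := by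
    intro x hx
    obtain ⟨i, hi, hj⟩ := mem_diagram hx
    exact ⟨hi ▸ hf i, hj.imp_right fun ⟨j, hj⟩ => ⟨f j, hf j, hj⟩⟩
  have hmem₂ : ∀ x ∈ K'.diagram g p, x.1 ∈ Set.Icc 0 C ∧
      (x.2 = ⊤ ∨ ∃ d ∈ Set.Icc 0 C, x.2 = ((d : ℝ) : WithTop ℝ)) := by
    intro x hx
    obtain ⟨i, hi, hj⟩ := mem_diagram hx
    exact ⟨hi ▸ hg i, hj.imp_right fun ⟨j, hj⟩ => ⟨g j, hg j, hj⟩⟩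
  refine Matchable.bottleneckDist_le ⟨S₁, U₁, S₂, U₂, h1, h2, hS.mono fun x hx y hy hxy => ?_,
    fun x hx => ?_, fun x hx => ?_⟩
  · obtain ⟨hb, hd⟩ := hmem₁ x (by rw [h1]; exact Multiset.mem_add.mpr (Or.inl hx))
    obtain ⟨hb', hd'⟩ := hmem₂ y (by rw [h2]; exact Multiset.mem_add.mpr (Or.inl hy))
    have hxy' := ne_top_of_le_ne_top hne hxy
    obtain ⟨b, d⟩ := x
    obtain ⟨b', d'⟩ := y
    dsimp only at hb hb' hd hd'
    rcases hd with rfl | ⟨d, hd, rfl⟩ <;> rcases hd' with rfl | ⟨d', hd', rfl⟩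
    · exact ENNReal.ofReal_le_ofReal (habs _ _ hb hb')
    · simp at hxy'
    · simp at hxy'
    · exact ENNReal.ofReal_le_ofReal (max_le (habs _ _ hb hb') (habs _ _ hd hd'))
  · obtain ⟨hb, hd⟩ := hmem₁ x (by rw [h1]; exact Multiset.mem_add.mpr (Or.inr hx))
    exact hunm x hb hd (ne_top_of_le_ne_top hne (hU₁ x hx))
  · obtain ⟨hb, hd⟩ := hmem₂ x (by rw [h2]; exact Multiset.mem_add.mpr (Or.inr hx))
    exact hunm x hb hd (ne_top_of_le_ne_top hne (hU₂ x hx))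

/-- Distances of diagrams under a change of the critical values. -/
theorem bottleneckDist_le_add {f f' : Fin K.size → ℝ} {g g' : Fin K'.size → ℝ} {v₁ v₂ : ℝ}
    (hf : ∀ i, |f i - f' i| ≤ v₁) (hg : ∀ i, |g i - g' i| ≤ v₂) (p : ℕ) :
    bottleneckDist (K.diagram f p) (K'.diagram g p) ≤ ENNReal.ofReal v₁ +
      bottleneckDist (K.diagram f' p) (K'.diagram g' p) + ENNReal.ofReal v₂ := by
  refine (bottleneckDist_triangle _ (K'.diagram g' p) _).trans (add_le_add
    ((bottleneckDist_triangle _ (K.diagram f' p) _).trans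
      (add_le_add (bottleneckDist_diagram_le hf p) le_rfl)) ?_)
  rw [bottleneckDist_comm]
  exact bottleneckDist_diagram_le hg p

end FinComplex

/-! ## Slices -/

section Slices

variable {V₁ V₂ : Type*} [DecidableEq V₁] [DecidableEq V₂] (p : ℕ)
  (F₁ : BiFiltration V₁) (F₂ : BiFiltration V₂)

/-- The bottleneck distance of the weighted restrictions onto the slice of type `t` with parameters
`(lam, mu)`. -/
noncomputable def sliceDist (t : SliceType) (lam mu : ℝ) : ℝ≥0∞ :=
  bottleneckDist (F₁.diagram (fun i => wpush t lam mu (F₁.crit i)) p)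
    (F₂.diagram (fun i => wpush t lam mu (F₂.crit i)) p)

theorem val_evalPrim_eq (t : SliceType) (lam mu : ℝ) :
    (evalPrim p F₁ F₂ t lam mu).val = (bottleneckAlg
      (persistenceAlg F₁.toFinComplex (fun i => wpush t lam mu (F₁.crit i)) p).val
      (persistenceAlg F₂.toFinComplex (fun i => wpush t lam mu (F₂.crit i)) p).val).val := rfl

theorem val_evalPrim (t : SliceType) (lam mu : ℝ) :
    (evalPrim p F₁ F₂ t lam mu).val.toCost = sliceDist p F₁ F₂ t lam mu := by
  rw [val_evalPrim_eq, toCost_val_bottleneckAlg, FinComplex.coe_val_persistenceAlg,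
    FinComplex.coe_val_persistenceAlg, sliceDist]

theorem evalPrim_nonneg (t : SliceType) (lam mu : ℝ) : 0 ≤ (evalPrim p F₁ F₂ t lam mu).val := by
  rw [val_evalPrim_eq]
  exact (bottleneckAlg_spec _ _).1

end Slices

/-! ### Translation between lines and parameters. -/

theorem Slice.push_eq (L : Slice) (x : ℝ × ℝ) :
    L.push x = max ((x.1 - L.origin.1) / Real.cos L.angle)
      ((x.2 - L.origin.2) / Real.sin L.angle) := by
  have hcos : 0 < Real.cos L.angle :=
    Real.cos_pos_of_mem_Ioo ⟨by linarith [L.angle_pos, Real.pi_pos], L.angle_lt⟩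
  have hsin : 0 < Real.sin L.angle :=
    Real.sin_pos_of_pos_of_lt_pi L.angle_pos (by linarith [L.angle_lt, Real.pi_pos])
  have : {t : ℝ | x ≤ L.point t} = Set.Ici (max ((x.1 - L.origin.1) / Real.cos L.angle)
      ((x.2 - L.origin.2) / Real.sin L.angle)) := by
    ext t
    simp only [Set.mem_ofPred_eq, Set.mem_Ici, max_le_iff, Slice.point, Prod.le_def, Prod.fst_add,
      Prod.snd_add, Prod.smul_fst, Prod.smul_snd, smul_eq_mul]
    rw [div_le_iff₀ hcos, div_le_iff₀ hsin, sub_le_iff_le_add', sub_le_iff_le_add']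
  rw [Slice.push, this, csInf_Ici]

section Slices

variable {V₁ V₂ : Type*} [DecidableEq V₁] [DecidableEq V₂] {p : ℕ}
  {F₁ : BiFiltration V₁} {F₂ : BiFiltration V₂}

theorem sliceDist_eq_of_push {t : SliceType} {lam mu : ℝ} {L : Slice} {w s : ℝ} (hw : 0 < w)
    (h : ∀ x, wpush t lam mu x = w * L.push x + s) :
    sliceDist p F₁ F₂ t lam mu = ENNReal.ofReal w * bottleneckDist
      (F₁.diagram (fun i => L.push (F₁.crit i)) p)
      (F₂.diagram (fun i => L.push (F₂.crit i)) p) := by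
  simp only [sliceDist, h]
  exact FinComplex.bottleneckDist_affine hw s _ _ p

end Slices

/-- The weight cancels one of the denominators sin γ, cos γ of the push and turns the other into the
slope or its inverse. Sliding the origin along the line to an axis only changes the constant `s`. -/
theorem Slice.exists_wpush (L : Slice) : ∃ t lam mu s, 0 < lam ∧ lam ≤ 1 ∧ 0 ≤ mu ∧ 0 < L.weight ∧
    ∀ x, wpush t lam mu x = L.weight * L.push x + s := by
  have hcos : 0 < Real.cos L.angle :=
    Real.cos_pos_of_mem_Ioo ⟨by linarith [L.angle_pos, Real.pi_pos], L.angle_lt⟩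
  have hsin : 0 < Real.sin L.angle :=
    Real.sin_pos_of_pos_of_lt_pi L.angle_pos (by linarith [L.angle_lt, Real.pi_pos])
  unfold Slice.weight
  set o := L.origin
  split_ifs with hflat
  · set lam := Real.sin L.angle / Real.cos L.angle with hlam
    have hlam0 : 0 < lam := div_pos hsin hcos
    have hlam1 : lam ≤ 1 := by
      rw [hlam, div_le_one hcos, ← Real.cos_pi_div_two_sub]
      exact Real.cos_le_cos_of_nonneg_of_le_pi (by linarith [L.angle_pos])
        (by linarith [L.angle_pos, Real.pi_pos]) (by linarith)
    have hpush : ∀ x, Real.sin L.angle * L.push x = max (lam * (x.1 - o.1)) (x.2 - o.2) := by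
      intro x
      rw [L.push_eq, mul_max_of_nonneg _ _ hsin.le, mul_div_cancel₀ _ hsin.ne']
      congr 1
      rw [hlam]; ring
    simp only [hpush]
    -- The sign of the `y`-intercept decides which axis is met in its nonnegative part.
    rcases le_or_gt 0 (o.2 - lam * o.1) with hc | hc
    · refine ⟨.yFlat, lam, o.2 - lam * o.1, lam * o.1, hlam0, hlam1, hc, hsin, fun x => ?_⟩
      rw [wpush, ← max_add_add_right, max_comm]
      congr 1 <;> ring
    · refine ⟨.xFlat, lam, o.1 - o.2 / lam, o.2, hlam0, hlam1, ?_, hsin, fun x => ?_⟩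
      · rw [sub_nonneg, div_le_iff₀ hlam0]; linarith
      · rw [wpush, ← max_add_add_right, max_comm]
        congr 1
        · field_simp; ring
        · ring
  · set lam := Real.cos L.angle / Real.sin L.angle with hlam
    have hlam0 : 0 < lam := div_pos hcos hsin
    have hlam1 : lam ≤ 1 := by
      rw [hlam, div_le_one hsin, ← Real.cos_pi_div_two_sub]
      rw [not_le] at hflat
      exact Real.cos_le_cos_of_nonneg_of_le_pi (by linarith [L.angle_lt])
        (by linarith [L.angle_lt, Real.pi_pos]) (by linarith)
    have hpush : ∀ x, Real.cos L.angle * L.push x = max (x.1 - o.1) (lam * (x.2 - o.2)) := by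
      intro x
      rw [L.push_eq, mul_max_of_nonneg _ _ hcos.le, mul_div_cancel₀ _ hcos.ne']
      congr 1
      rw [hlam]; ring
    simp only [hpush]
    rcases le_or_gt 0 (o.2 - o.1 / lam) with hc | hc
    · refine ⟨.ySteep, lam, o.2 - o.1 / lam, o.1, hlam0, hlam1, hc, hcos, fun x => ?_⟩
      rw [wpush, ← max_add_add_right, max_comm]
      congr 1
      · ring
      · field_simp; ring
    · refine ⟨.xSteep, lam, o.1 - lam * o.2, lam * o.2, hlam0, hlam1, ?_, hcos, fun x => ?_⟩
      · rw [sub_neg, lt_div_iff₀ hlam0] at hc; linarith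
      · rw [wpush, ← max_add_add_right, max_comm]
        congr 1 <;> ring

/-- The angle is arctan `lam` for flat slices and π/2 - arctan `lam` for steep ones. The strict
bounds, which hold at every box center, make the slope positive and decide the case in the weight.
-/
theorem exists_slice (t : SliceType) {lam : ℝ} (mu : ℝ) (h0 : 0 < lam) (h1 : lam < 1) :
    ∃ (L : Slice) (s : ℝ), 0 < L.weight ∧ ∀ x, wpush t lam mu x = L.weight * L.push x + s := by
  have ha0 : 0 < Real.arctan lam := Real.arctan_pos.mpr h0
  have ha1 : Real.arctan lam < Real.pi / 4 := by
    rw [← Real.arctan_one]; exact Real.arctan_lt_arctan_iff.mpr h1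
  have hpi := Real.pi_pos
  have hcos : 0 < Real.cos (Real.arctan lam) := Real.cos_arctan_pos lam
  have hsin : Real.sin (Real.arctan lam) = lam * Real.cos (Real.arctan lam) := by
    rw [← Real.tan_mul_cos hcos.ne', Real.tan_arctan]
  have hflat : ∀ o : ℝ × ℝ, ∃ L : Slice, 0 < L.weight ∧ ∀ x : ℝ × ℝ,
      L.weight * L.push x = max (lam * (x.1 - o.1)) (x.2 - o.2) := by
    intro o
    refine ⟨⟨o, Real.arctan lam, ha0, by linarith⟩, ?_, fun x => ?_⟩
    · rw [Slice.weight, if_pos ha1.le]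
      dsimp only
      rw [hsin]; positivity
    · rw [Slice.push_eq, Slice.weight, if_pos ha1.le]
      dsimp only
      rw [hsin, mul_max_of_nonneg _ _ (by positivity), mul_div_cancel₀ _ (by positivity)]
      congr 1
      field_simp
  have hsteep : ∀ o : ℝ × ℝ, ∃ L : Slice, 0 < L.weight ∧ ∀ x : ℝ × ℝ,
      L.weight * L.push x = max (lam * (x.2 - o.2)) (x.1 - o.1) := by
    intro o
    refine ⟨⟨o, Real.pi / 2 - Real.arctan lam, by linarith, by linarith⟩, ?_, fun x => ?_⟩
    · rw [Slice.weight, if_neg (by dsimp only; linarith)]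
      dsimp only
      rw [Real.cos_pi_div_two_sub, hsin]; positivity
    · rw [Slice.push_eq, Slice.weight, if_neg (by dsimp only; linarith)]
      dsimp only
      rw [Real.cos_pi_div_two_sub, Real.sin_pi_div_two_sub, hsin,
        mul_max_of_nonneg _ _ (by positivity), mul_div_cancel₀ _ (by positivity), max_comm]
      congr 1
      field_simp
  cases t with
  | xFlat =>
    obtain ⟨L, hL, h⟩ := hflat (mu, 0)
    exact ⟨L, 0, hL, fun x => by rw [h, wpush, max_comm]; simp⟩
  | xSteep =>
    obtain ⟨L, hL, h⟩ := hsteep (mu, 0)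
    exact ⟨L, 0, hL, fun x => by rw [h, wpush]; simp⟩
  | yFlat =>
    obtain ⟨L, hL, h⟩ := hflat (0, mu)
    exact ⟨L, 0, hL, fun x => by rw [h, wpush, max_comm]; simp⟩
  | ySteep =>
    obtain ⟨L, hL, h⟩ := hsteep (0, mu)
    exact ⟨L, 0, hL, fun x => by rw [h, wpush]; simp⟩

/-! ### Slices that are relevant for the matching distance. -/

section Slices

variable {V₁ V₂ : Type*} [DecidableEq V₁] [DecidableEq V₂] (p : ℕ)
  (F₁ : BiFiltration V₁) (F₂ : BiFiltration V₂)

theorem sliceDist_le_matchingDist (t : SliceType) {lam : ℝ} (mu : ℝ) (h0 : 0 < lam)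
    (h1 : lam < 1) : sliceDist p F₁ F₂ t lam mu ≤ matchingDist p F₁ F₂ := by
  obtain ⟨L, s, hw, h⟩ := exists_slice t mu h0 h1
  rw [sliceDist_eq_of_push hw h]
  exact le_iSup (fun L : Slice => ENNReal.ofReal L.weight *
    bottleneckDist (F₁.diagram (fun i => L.push (F₁.crit i)) p)
      (F₂.diagram (fun i => L.push (F₂.crit i)) p)) L

/-- The range of the parameter `mu` for the slices of type `t`. -/
noncomputable def muBound (X Y : ℝ) : SliceType → ℝ
  | .xFlat | .xSteep => X
  | .yFlat | .ySteep => Y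

/-- As soon as `mu` reaches the largest coordinate, the alternative that contains it is nonpositive
and loses against the nonnegative other one. -/
theorem wpush_min {X Y : ℝ} (t : SliceType) {lam : ℝ} (mu : ℝ) (h0 : 0 ≤ lam) {x : ℝ × ℝ}
    (hx0 : 0 ≤ x) (hxX : x.1 ≤ X) (hxY : x.2 ≤ Y) :
    wpush t lam (min mu (muBound X Y t)) x = wpush t lam mu x := by
  obtain ⟨hx1, hx2⟩ := hx0
  simp only [Prod.fst_zero, Prod.snd_zero] at hx1 hx2
  rcases le_total mu (muBound X Y t) with h | h
  · rw [min_eq_left h]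
  · rw [min_eq_right h]
    cases t <;> simp only [wpush, muBound] at h ⊢
    · rw [max_eq_left, max_eq_left] <;> nlinarith
    · have := mul_nonneg h0 hx2
      rw [max_eq_left, max_eq_left] <;> linarith
    · have := mul_nonneg h0 hx1
      rw [max_eq_right, max_eq_right] <;> linarith
    · rw [max_eq_right, max_eq_right] <;> nlinarith

/-- Only the slices in the initial boxes matter for the matching distance. -/
theorem matchingDist_le {X Y : ℝ} (hX : 0 ≤ X) (hY : 0 ≤ Y) (h₁ : ∀ i, 0 ≤ F₁.crit i)
    (h₂ : ∀ i, 0 ≤ F₂.crit i) (h₁' : ∀ i, F₁.crit i ≤ (X, Y)) (h₂' : ∀ i, F₂.crit i ≤ (X, Y))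
    {r : ℝ≥0∞} (hr : ∀ t lam mu, 0 ≤ lam → lam ≤ 1 → 0 ≤ mu → mu ≤ muBound X Y t →
      sliceDist p F₁ F₂ t lam mu ≤ r) : matchingDist p F₁ F₂ ≤ r := by
  refine iSup_le fun L => ?_
  obtain ⟨t, lam, mu, s, hlam0, hlam1, hmu, hw, h⟩ := L.exists_wpush
  rw [← sliceDist_eq_of_push hw h]
  have hb : 0 ≤ muBound X Y t := by cases t <;> assumption
  refine le_trans (le_of_eq ?_) (hr t lam (min mu (muBound X Y t)) hlam0.le hlam1
    (le_min hmu hb) (min_le_right _ _))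
  simp only [sliceDist]
  congr 2 <;> funext i
  · exact (wpush_min t mu hlam0.le (h₁ i) (h₁' i).1 (h₁' i).2).symm
  · exact (wpush_min t mu hlam0.le (h₂ i) (h₂' i).1 (h₂' i).2).symm

end Slices

/-! ## Variation of the pushes in a box -/

/-- A product such as `lam * (x.1 - mu)` fails to increase in `lam` only where it is nonpositive,
and there the nonnegative other alternative attains the maximum. -/
theorem wpush_mono (t : SliceType) {lam lam' mu mu' : ℝ} (h0 : 0 ≤ lam) (hlam : lam ≤ lam')
    (hmu : mu' ≤ mu) {x : ℝ × ℝ} (hx : 0 ≤ x) : wpush t lam mu x ≤ wpush t lam' mu' x := by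
  obtain ⟨hx1, hx2⟩ := hx
  simp only [Prod.fst_zero, Prod.snd_zero] at hx1 hx2
  have h0' := h0.trans hlam
  cases t <;> simp only [wpush] <;> refine max_le ?_ ?_
  · exact le_max_left _ _
  · rcases le_total (x.1 - mu) 0 with h | h
    · exact (mul_nonpos_of_nonneg_of_nonpos h0 h).trans (hx2.trans (le_max_left _ _))
    · exact (mul_le_mul hlam (by linarith) h h0').trans (le_max_right _ _)
  · exact (mul_le_mul_of_nonneg_right hlam hx2).trans (le_max_left _ _)
  · exact le_trans (by linarith) (le_max_right _ _)
  · exact le_trans (by linarith) (le_max_left _ _)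
  · exact (mul_le_mul_of_nonneg_right hlam hx1).trans (le_max_right _ _)
  · rcases le_total (x.2 - mu) 0 with h | h
    · exact (mul_nonpos_of_nonneg_of_nonpos h0 h).trans (hx1.trans (le_max_right _ _))
    · exact (mul_le_mul hlam (by linarith) h h0').trans (le_max_left _ _)
  · exact le_max_right _ _

theorem wpush_mem_Icc (t : SliceType) {lam mu C : ℝ} (h0 : 0 ≤ lam) (h1 : lam ≤ 1) (hmu : 0 ≤ mu)
    {x : ℝ × ℝ} (hx : 0 ≤ x) (hxC : x ≤ (C, C)) : wpush t lam mu x ∈ Set.Icc 0 C := by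
  obtain ⟨hx1, hx2⟩ := hx
  obtain ⟨hC1, hC2⟩ := hxC
  simp only [Prod.fst_zero, Prod.snd_zero] at hx1 hx2 hC1 hC2
  have hC : 0 ≤ C := hx1.trans hC1
  have key : ∀ a, a ≤ C → lam * a ≤ C := fun a ha =>
    (mul_le_mul_of_nonneg_left ha h0).trans (by nlinarith)
  have e1 := mul_nonneg h0 hx1
  have e2 := mul_nonneg h0 hx2
  cases t <;> simp only [wpush, Set.mem_Icc, le_max_iff, max_le_iff]
  · exact ⟨Or.inl hx2, hC2, key _ (by linarith)⟩
  · exact ⟨Or.inl e2, key _ hC2, by linarith⟩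
  · exact ⟨Or.inr e1, by linarith, key _ hC1⟩
  · exact ⟨Or.inr hx1, key _ (by linarith), hC1⟩

/-- `B` is a box that arises from the initial box of type `t` by subdivision. -/
structure ParamBox.Regular (X Y : ℝ) (B : ParamBox) (t : SliceType) : Prop where
  lam_nonneg : 0 ≤ B.lamMin
  lam_lt : B.lamMin < B.lamMax
  lam_le : B.lamMax ≤ 1
  mu_nonneg : 0 ≤ B.muMin
  mu_le : B.muMax ≤ muBound X Y t
  height : B.muMax - B.muMin = muBound X Y t * (B.lamMax - B.lamMin)

namespace ParamBox.Regular

variable {X Y : ℝ} {B : ParamBox} {t : SliceType}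

/-- By monotonicity, the extreme pushes over the box occur at the opposite corners `(lamMin, muMax)`
and `(lamMax, muMin)`. -/
theorem abs_wpush_sub_le (hB : B.Regular X Y t) {x : ℝ × ℝ} (hx : 0 ≤ x) {lam mu : ℝ}
    (hlam : lam ∈ Set.Icc B.lamMin B.lamMax) (hmu : mu ∈ Set.Icc B.muMin B.muMax) :
    |wpush t lam mu x - wpush t B.lamMid B.muMid x| ≤ cornerVariation t B x := by
  have h1 := wpush_mono t hB.lam_nonneg hlam.1 hmu.2 hx
  have h2 := wpush_mono t (hB.lam_nonneg.trans hlam.1) hlam.2 hmu.1 hx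
  have h3 : |wpush t B.lamMin B.muMax x - wpush t B.lamMid B.muMid x| ≤ cornerVariation t B x :=
    (le_max_right _ _).trans (le_max_left _ _)
  have h4 : |wpush t B.lamMax B.muMin x - wpush t B.lamMid B.muMid x| ≤ cornerVariation t B x :=
    (le_max_left _ _).trans (le_max_right _ _)
  rw [abs_le] at *
  constructor <;> linarith [h3.1, h4.2]

theorem lamMid_mem (hB : B.Regular X Y t) : 0 < B.lamMid ∧ B.lamMid < 1 := by
  have h1 := hB.lam_nonneg; have h2 := hB.lam_lt; have h3 := hB.lam_le
  unfold ParamBox.lamMid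
  constructor <;> linarith

theorem muBound_nonneg (hX : 0 ≤ X) (hY : 0 ≤ Y) (t : SliceType) : 0 ≤ muBound X Y t := by
  cases t <;> assumption

theorem muMin_le_muMax (hX : 0 ≤ X) (hY : 0 ≤ Y) (hB : B.Regular X Y t) : B.muMin ≤ B.muMax := by
  have := hB.height
  have := mul_nonneg (muBound_nonneg hX hY t) (sub_nonneg.mpr hB.lam_lt.le)
  linarith

/-- As `y` is nonnegative, `x - mu` may be replaced by its positive part, which lies in `[0, M -
m]`; then the difference of products is split as in the product rule. This covers flat `x`-slices
and steep `y`-slices, where both parameters enter one alternative. -/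
theorem _root_.abs_max_mul_sub_le {lam lam' mu mu' x y M m : ℝ} (h : 0 ≤ lam) (h' : 0 ≤ lam')
    (hy : 0 ≤ y) (hx : x ≤ M) (hmM : m ≤ M) (hm : m ≤ mu) :
    |max y (lam * (x - mu)) - max y (lam' * (x - mu'))| ≤
      lam' * |mu - mu'| + |lam - lam'| * (M - m) := by
  have key : ∀ {l a : ℝ}, 0 ≤ l → max y (l * a) = max y (l * max a 0) := by
    intro l a hl
    rw [mul_max_of_nonneg _ _ hl, mul_zero, max_comm (l * a) 0, ← max_assoc, max_eq_left hy]
  rw [key h, key h']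
  have h0 : 0 ≤ max (x - mu) 0 := le_max_right _ _
  have h1 : max (x - mu) 0 ≤ M - m := max_le (by linarith) (by linarith)
  have h2 : |max (x - mu) 0 - max (x - mu') 0| ≤ |mu - mu'| := by
    refine (abs_max_sub_max_le_abs _ _ _).trans_eq ?_
    rw [show x - mu - (x - mu') = -(mu - mu') by ring, abs_neg]
  rw [max_comm y, max_comm y]
  refine (abs_max_sub_max_le_abs _ _ _).trans ?_
  rw [show lam * max (x - mu) 0 - lam' * max (x - mu') 0 =
    lam' * (max (x - mu) 0 - max (x - mu') 0) + (lam - lam') * max (x - mu) 0 by ring]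
  refine (abs_add_le _ _).trans (add_le_add ?_ ?_)
  · rw [abs_mul, abs_of_nonneg h']
    exact mul_le_mul_of_nonneg_left h2 h'
  · rw [abs_mul, abs_of_nonneg h0]
    exact mul_le_mul_of_nonneg_left h1 (abs_nonneg _)

theorem cornerVariation_le (hX : 0 ≤ X) (hY : 0 ≤ Y) (hB : B.Regular X Y t) {x : ℝ × ℝ}
    (hx : 0 ≤ x) (hxXY : x ≤ (X, Y)) : cornerVariation t B x ≤ constantVariation t X Y B := by
  obtain ⟨hx1, hx2⟩ := hx
  obtain ⟨hxX, hxY⟩ := hxXY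
  simp only [Prod.fst_zero, Prod.snd_zero] at hx1 hx2 hxX hxY
  have hmu := hB.muMin_le_muMax hX hY
  have hlam := hB.lam_lt
  have hmid := hB.lamMid_mem.1
  have key : ∀ lam mu, 0 ≤ lam → B.muMin ≤ mu → |lam - B.lamMid| = (B.lamMax - B.lamMin) / 2 →
      |mu - B.muMid| = (B.muMax - B.muMin) / 2 →
      |wpush t lam mu x - wpush t B.lamMid B.muMid x| ≤ constantVariation t X Y B := by
    intro lam mu hlam0 hmu0 h1 h2
    have hmul : ∀ {a A : ℝ}, 0 ≤ a → a ≤ A →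
        |lam * a - B.lamMid * a| ≤ A * (B.lamMax - B.lamMin) / 2 := by
      intro a A ha haA
      rw [← sub_mul, abs_mul, h1, abs_of_nonneg ha]
      nlinarith
    have hsub : ∀ a : ℝ, |a - mu - (a - B.muMid)| = (B.muMax - B.muMin) / 2 := by
      intro a
      rw [← h2, show a - mu - (a - B.muMid) = -(mu - B.muMid) by ring, abs_neg]
    have hmM := hB.mu_le
    cases t with
    | xFlat =>
      refine (abs_max_mul_sub_le hlam0 hmid.le hx2 hxX (hmu.trans hmM) hmu0).trans_eq ?_
      rw [h1, h2, constantVariation]; ring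
    | xSteep =>
      have e1 := hmul hx2 hxY
      have e2 := mul_nonneg hY (sub_nonneg.mpr hlam.le)
      refine (abs_max_sub_max_le_max _ _ _ _).trans (max_le ?_ ?_)
      · rw [constantVariation]; linarith
      · rw [hsub, constantVariation]; linarith
    | yFlat =>
      have e1 := hmul hx1 hxX
      have e2 := mul_nonneg hX (sub_nonneg.mpr hlam.le)
      refine (abs_max_sub_max_le_max _ _ _ _).trans (max_le ?_ ?_)
      · rw [hsub, constantVariation]; linarith
      · rw [constantVariation]; linarith
    | ySteep =>
      simp only [wpush]
      rw [max_comm, max_comm (B.lamMid * _)]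
      refine (abs_max_mul_sub_le hlam0 hmid.le hx1 hxY (hmu.trans hmM) hmu0).trans_eq ?_
      rw [h1, h2, constantVariation]; ring
  have h1 : |B.lamMin - B.lamMid| = (B.lamMax - B.lamMin) / 2 := by
    rw [ParamBox.lamMid, abs_of_nonpos (by linarith)]; ring
  have h2 : |B.lamMax - B.lamMid| = (B.lamMax - B.lamMin) / 2 := by
    rw [ParamBox.lamMid, abs_of_nonneg (by linarith)]; ring
  have h3 : |B.muMin - B.muMid| = (B.muMax - B.muMin) / 2 := by
    rw [ParamBox.muMid, abs_of_nonpos (by linarith)]; ring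
  have h4 : |B.muMax - B.muMid| = (B.muMax - B.muMin) / 2 := by
    rw [ParamBox.muMid, abs_of_nonneg (by linarith)]; ring
  exact max_le
    (max_le (key _ _ hB.lam_nonneg le_rfl h1 h3) (key _ _ hB.lam_nonneg hmu h1 h4))
    (max_le (key _ _ (hB.lam_nonneg.trans hlam.le) le_rfl h2 h3)
      (key _ _ (hB.lam_nonneg.trans hlam.le) hmu h2 h4))

/-- Subdivision preserves the ratio of height to width, which is at most C, so each of the two
halved terms is at most C/2 times the width. -/
theorem constantVariation_le (hX : 0 ≤ X) (hY : 0 ≤ Y) (hB : B.Regular X Y t) :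
    constantVariation t X Y B ≤ max X Y * (B.lamMax - B.lamMin) := by
  have hw : 0 < B.lamMax - B.lamMin := sub_pos.mpr hB.lam_lt
  have h0 := hB.mu_nonneg
  obtain ⟨h1, h2⟩ := hB.lamMid_mem
  have hheight := hB.height
  have hXC := mul_le_mul_of_nonneg_right (le_max_left X Y) hw.le
  have hYC := mul_le_mul_of_nonneg_right (le_max_right X Y) hw.le
  have key : ∀ M, 0 ≤ M → B.lamMid * (M * (B.lamMax - B.lamMin)) ≤ M * (B.lamMax - B.lamMin) :=
    fun M hM => mul_le_of_le_one_left (mul_nonneg hM hw.le) h2.le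
  have hm := mul_nonneg h0 hw.le
  have e1 := key X hX
  have e2 := key Y hY
  cases t <;> simp only [constantVariation, muBound] at hheight ⊢ <;> rw [hheight] <;> linarith

theorem constantVariation_nonneg (hX : 0 ≤ X) (hY : 0 ≤ Y) (hB : B.Regular X Y t) :
    0 ≤ constantVariation t X Y B :=
  (abs_nonneg _).trans ((le_max_left _ _).trans
    ((le_max_left _ _).trans (hB.cornerVariation_le hX hY (x := 0) le_rfl ⟨hX, hY⟩)))

end ParamBox.Regular

/-! ## Numbers of steps -/

theorem steps_insertT_le {α : Type} (le : α → α → Bool) (a : α) (l : List α) :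
    (insertT le a l).steps ≤ l.length + 1 := by
  induction l with
  | nil => simp [insertT]
  | cons b l ih =>
    rw [insertT]
    split_ifs
    · simp
    · simp only [Timed.steps_bind, Timed.steps_one, List.length_cons]; omega

theorem steps_sortT_le {α : Type} (le : α → α → Bool) (l : List α) :
    (sortT le l).steps ≤ (l.length + 1) * (l.length + 1) := by
  induction l with
  | nil => simp [sortT]
  | cons a l ih =>
    have h1 := steps_insertT_le le a (sortT le l).val
    have h2 : (sortT le l).val.length = l.length := by
      rw [val_sortT]; exact List.length_insertionSort _ _
    rw [h2] at h1
    simp only [sortT, Timed.steps_bind, List.length_cons]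
    nlinarith

theorem steps_reduceCol_le {n : ℕ} (R : Fin n → Fin n → Bool) (owner : Fin n → Option (Fin n))
    (rows : List (Fin n)) (col : Fin n → Bool) :
    (reduceCol R owner col rows).steps ≤ rows.length * (2 * n + 1) + 1 := by
  induction rows generalizing col with
  | nil => simp [reduceCol]
  | cons r rows ih =>
    rw [reduceCol]
    split_ifs
    · split
      · simp
      · next i _ =>
        have := ih fun k => xor (col k) (R i k)
        simp only [Timed.steps_bind, Timed.steps_one, Timed.steps_array, Timed.val_array,
          Timed.val_one, Finset.sum_const, Finset.card_univ, Fintype.card_fin, smul_eq_mul,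
          List.length_cons] at this ⊢
        nlinarith
    · have := ih col
      simp only [Timed.steps_bind, Timed.steps_one, List.length_cons]
      nlinarith

theorem steps_reduceAll_le {n : ℕ} (rows js : List (Fin n)) (s : ReductionState n) :
    (reduceAll rows s js).steps ≤ js.length * (rows.length * (2 * n + 1) + 2) + 1 := by
  induction js generalizing s with
  | nil => simp [reduceAll]
  | cons j js ih =>
    rw [reduceAll]
    simp only [Timed.steps_bind, Timed.steps_one, List.length_cons, Timed.val_one]
    have h1 := steps_reduceCol_le s.R s.owner rows (s.R j)
    generalize reduceCol s.R s.owner (s.R j) rows = res at h1 ⊢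
    have h2 := fun s => ih s
    refine (Nat.add_le_add h1 (Nat.add_le_add_left (h2 _) 1)).trans ?_
    nlinarith

theorem collectPoints_le {n : ℕ} (p : ℕ) (card : Fin n → ℕ) (f : Fin n → ℝ)
    (s : ReductionState n) (l : List (Fin n)) :
    (collectPoints p card f s l).steps ≤ l.length + 1 ∧
      (collectPoints p card f s l).val.length ≤ l.length := by
  induction l with
  | nil => simp [collectPoints]
  | cons i l ih =>
    obtain ⟨h1, h2⟩ := ih
    simp only [collectPoints, Timed.steps_bind, Timed.steps_one, Timed.val_bind, Timed.val_one,
      List.length_cons]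
    refine ⟨by omega, ?_⟩
    by_cases hc : card i = p + 1
    · rw [if_pos hc]
      rcases s.owner i with _ | j
      · by_cases hn : s.negative i = true <;> simp only [hn] <;> simp <;> omega
      · by_cases hlt : f i < f j <;> simp only [hlt] <;> simp <;> omega
    · rw [if_neg hc]; omega

/-- A simplex with k vertices has 2ᵏ - 1 nonempty faces, all in `K`, and k² + 3 ≤ 3 · 2ᵏ. This keeps
the facet tests for all pairs of simplices within cubic time. -/
theorem FinComplex.card_sq_le {V : Type*} (K : FinComplex V) (i : Fin K.size) :
    (K.simplex i).card ^ 2 ≤ 3 * K.size := by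
  classical
  have h1 : 2 ^ (K.simplex i).card - 1 ≤ K.size := by
    have hface : ∀ τ : ↥((K.simplex i).powerset.erase ∅), ∃ j, K.simplex j = τ := by
      rintro ⟨τ, hτ⟩
      rw [Finset.mem_erase, Finset.mem_powerset] at hτ
      exact K.face_mem i τ (Finset.nonempty_iff_ne_empty.mpr hτ.1) hτ.2
    choose g hg using hface
    have hinj : Function.Injective g := fun a b hab =>
      Subtype.ext (by rw [← hg a, ← hg b, hab])
    have := Fintype.card_le_of_injective g hinj
    rwa [Fintype.card_coe, Finset.card_erase_of_mem (Finset.empty_mem_powerset _),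
      Finset.card_powerset, Fintype.card_fin] at this
  have h2 : ∀ k : ℕ, k ^ 2 + 3 ≤ 3 * 2 ^ k := by
    intro k
    induction k with
    | zero => norm_num
    | succ k ih =>
      rw [pow_succ 2 k]
      rcases k with _ | k
      · norm_num
      · nlinarith
  have := h2 (K.simplex i).card
  omega

theorem FinComplex.card_mul_card_le {V : Type*} (K : FinComplex V) (i j : Fin K.size) :
    (K.simplex i).card * (K.simplex j).card ≤ 3 * K.size := by
  have h1 := K.card_sq_le i
  have h2 := K.card_sq_le j
  rcases le_total (K.simplex i).card (K.simplex j).card with h | h <;> nlinarith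

theorem FinComplex.card_le {V : Type*} (K : FinComplex V) (i : Fin K.size) :
    (K.simplex i).card ≤ 3 * K.size :=
  (Nat.le_self_pow two_ne_zero _).trans (K.card_sq_le i)

theorem sum_fin_le {n : ℕ} {g : Fin n → ℕ} {b : ℕ} (h : ∀ i, g i ≤ b) : ∑ i, g i ≤ n * b := by
  simpa using Finset.sum_le_card_nsmul Finset.univ g b fun i _ => h i

theorem length_algOrder {V : Type*} (K : FinComplex V) (f : Fin K.size → ℝ) :
    (K.algOrder f).length = K.size := by
  rw [FinComplex.algOrder, val_sortT, List.length_insertionSort, List.length_finRange]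

theorem length_persistenceAlg_le {V : Type*} [DecidableEq V] (K : FinComplex V)
    (f : Fin K.size → ℝ) (p : ℕ) : (persistenceAlg K f p).val.length ≤ K.size :=
  (collectPoints_le p (fun i => (K.simplex i).card) f _ (K.algOrder f)).2.trans
    (length_algOrder K f).le

theorem steps_persistenceAlg_le {V : Type*} [DecidableEq V] (K : FinComplex V)
    (f : Fin K.size → ℝ) (p : ℕ) : (persistenceAlg K f p).steps ≤ 20 * (K.size + 1) ^ 3 := by
  have h1 : ∑ i, ((K.simplex i).card + 1) ≤ K.size * (3 * K.size + 1) :=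
    sum_fin_le fun i => Nat.add_le_add_right (K.card_le i) 1
  have h2 : ∑ j, (∑ i, ((K.simplex i).card * (K.simplex j).card + 1) + 1) ≤
      K.size * (K.size * (3 * K.size + 1) + 1) :=
    sum_fin_le fun j => Nat.add_le_add_right
      (sum_fin_le fun i => Nat.add_le_add_right (K.card_mul_card_le i j) 1) 1
  have h3 := steps_sortT_le (fun i j => decide (f i < f j ∨
    (f i = f j ∧ (K.simplex i).card ≤ (K.simplex j).card))) (List.finRange K.size)
  rw [List.length_finRange] at h3
  have h4 := steps_reduceAll_le (K.algOrder f).reverse (K.algOrder f)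
    ⟨fun j i => decide (K.IsFacet i j), fun _ => none, fun _ => false⟩
  have h5 := (collectPoints_le p (fun i => (K.simplex i).card) f
    (FinComplex.reductionResult (K.algOrder f)) (K.algOrder f)).1
  rw [List.length_reverse, length_algOrder] at h4
  rw [length_algOrder] at h5
  have h6 : (persistenceAlg K f p).steps = ∑ i, ((K.simplex i).card + 1) +
      (∑ j, (∑ i, ((K.simplex i).card * (K.simplex j).card + 1) + 1) +
      ((sortT (fun i j => decide (f i < f j ∨
        (f i = f j ∧ (K.simplex i).card ≤ (K.simplex j).card))) (List.finRange K.size)).steps +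
      (K.size + (∑ _i : Fin K.size, (1 + 1) + (∑ _i : Fin K.size, (1 + 1) +
      ((reduceAll (K.algOrder f).reverse
        ⟨fun j i => decide (K.IsFacet i j), fun _ => none, fun _ => false⟩ (K.algOrder f)).steps +
      (collectPoints p (fun i => (K.simplex i).card) f
        (FinComplex.reductionResult (K.algOrder f)) (K.algOrder f)).steps)))))) := rfl
  rw [h6, Finset.sum_const, Finset.card_univ, Fintype.card_fin, smul_eq_mul]
  nlinarith [Nat.zero_le (K.size ^ 3), Nat.zero_le (K.size ^ 2)]

theorem steps_argminT {N : ℕ} (visited : Fin N → Bool) (slack : Fin N → WithTop ℝ)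
    (l : List (Fin N)) : (argminT visited slack l).steps = l.length + 1 := by
  induction l with
  | nil => rfl
  | cons v l ih => simp [argminT, ih]

theorem steps_growTree_le {N : ℕ} (c : Fin N → Fin N → WithTop ℝ)
    (ofRight : Fin N → Option (Fin N)) (k : ℕ) (visited : Fin N → Bool)
    (slack : Fin N → WithTop ℝ) (parent : Fin N → Fin N) (θ : WithTop ℝ) :
    (growTree c ofRight k visited slack parent θ).steps ≤ k * (3 * N + 3) + N + 3 := by
  induction k generalizing visited slack parent θ with
  | zero => simp [growTree]
  | succ k ih =>
    rw [growTree]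
    simp only [Timed.steps_bind, steps_argminT, List.length_finRange]
    split
    · simp only [Timed.steps_one]; nlinarith
    · simp only [Timed.steps_bind, Timed.val_one, Timed.steps_one]
      split
      · simp only [Timed.steps_one]; nlinarith
      · simp only [Timed.steps_bind, Timed.val_one, Timed.steps_one, Timed.steps_array,
          Finset.sum_const, Finset.card_univ, Fintype.card_fin, smul_eq_mul]
        refine (Nat.add_le_add_left (Nat.add_le_add_left (Nat.add_le_add_left
          (Nat.add_le_add_left (ih _ _ _ _) _) _) _) _).trans ?_
        nlinarith

theorem steps_augment_le {N : ℕ} (parent : Fin N → Fin N) (k : ℕ) (v : Fin N)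
    (M : BipMatching N) : (augment parent k v M).steps ≤ k + 1 := by
  induction k generalizing v M with
  | zero => simp [augment]
  | succ k ih =>
    rw [augment]
    simp only [Timed.steps_bind, Timed.steps_one]
    split
    · simp
    · have := ih (by assumption) (Timed.one { ofLeft := Function.update M.ofLeft (parent v) (some v)
                                              ofRight := Function.update M.ofRight v
                                                (some (parent v)) : BipMatching N }).val
      omega

theorem steps_assignAll_le {N : ℕ} (c : Fin N → Fin N → WithTop ℝ) (us : List (Fin N))
    (M : BipMatching N) (θ : WithTop ℝ) :
    (assignAll c us M θ).steps ≤ us.length * (3 * N * N + 12 * N + 5) + 1 := by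
  induction us generalizing M θ with
  | nil => simp [assignAll]
  | cons u us ih =>
    rw [assignAll]
    simp only [Timed.steps_bind, Timed.steps_array, Timed.steps_one, Finset.sum_const,
      Finset.card_univ, Fintype.card_fin, smul_eq_mul, Timed.val_array, Timed.val_one]
    have h1 := steps_growTree_le c M.ofRight N (fun _ => false) (fun w => c u w) (fun _ => u) θ
    generalize growTree c M.ofRight N (fun _ => false) (fun w => c u w) (fun _ => u) θ = res at h1 ⊢
    obtain ⟨⟨_ | v, parent', θ'⟩, t⟩ := res
    · simp only [Timed.steps_one, List.length_cons] at h1 ⊢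
      nlinarith
    · simp only [Timed.steps_bind, List.length_cons] at h1 ⊢
      have h2 := steps_augment_le parent' N v M
      have h3 := ih (augment parent' N v M).val θ'
      nlinarith

theorem steps_bottleneckAlg_le (D₁ D₂ : List (ℝ × WithTop ℝ)) {m : ℕ}
    (hm : D₁.length + D₂.length ≤ m) : (bottleneckAlg D₁ D₂).steps ≤ 20 * (m + 1) ^ 3 := by
  set N := D₁.length + D₂.length
  have h1 := steps_assignAll_le (fun i j : Fin N => edgeCost D₁[(i : ℕ)]? D₂[(j : ℕ)]?)
    (List.finRange N) ⟨fun _ => none, fun _ => none⟩ 0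
  rw [List.length_finRange] at h1
  have h2 : (bottleneckAlg D₁ D₂).steps = ∑ _i : Fin N, (∑ _j : Fin N, (1 + 1) + 1) +
      (∑ _i : Fin N, (1 + 1) + (∑ _i : Fin N, (1 + 1) +
      (assignAll (fun i j : Fin N => edgeCost D₁[(i : ℕ)]? D₂[(j : ℕ)]?)
    (List.finRange N) ⟨fun _ => none, fun _ => none⟩ 0).steps)) := rfl
  rw [h2]
  simp only [Finset.sum_const, Finset.card_univ, Fintype.card_fin, smul_eq_mul]
  refine le_trans ?_ (Nat.mul_le_mul_left 20 (Nat.pow_le_pow_left (Nat.add_le_add_right hm 1) 3))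
  nlinarith [Nat.zero_le (N ^ 3), Nat.zero_le (N ^ 2)]

section Rounds

variable {V₁ V₂ : Type*} [DecidableEq V₁] [DecidableEq V₂] (p : ℕ)
  (F₁ : BiFiltration V₁) (F₂ : BiFiltration V₂)

theorem steps_evalPrim_le (t : SliceType) (lam mu : ℝ) :
    (evalPrim p F₁ F₂ t lam mu).steps ≤ 62 * (F₁.size + F₂.size + 1) ^ 3 := by
  set m := F₁.size + F₂.size with hm
  set f₁ := fun i => wpush t lam mu (F₁.crit i)
  set f₂ := fun i => wpush t lam mu (F₂.crit i)
  have h1 := steps_persistenceAlg_le F₁.toFinComplex f₁ p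
  have h2 := steps_persistenceAlg_le F₂.toFinComplex f₂ p
  have h3 := steps_bottleneckAlg_le (persistenceAlg F₁.toFinComplex f₁ p).val
    (persistenceAlg F₂.toFinComplex f₂ p).val (m := m)
    (Nat.add_le_add (length_persistenceAlg_le _ _ _) (length_persistenceAlg_le _ _ _))
  have h4 : (evalPrim p F₁ F₂ t lam mu).steps = ∑ _i : Fin F₁.size, (1 + 1) +
      (∑ _i : Fin F₂.size, (1 + 1) + ((persistenceAlg F₁.toFinComplex f₁ p).steps +
      ((persistenceAlg F₂.toFinComplex f₂ p).steps +
      (bottleneckAlg (persistenceAlg F₁.toFinComplex f₁ p).val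
        (persistenceAlg F₂.toFinComplex f₂ p).val).steps))) := rfl
  rw [h4]
  simp only [Finset.sum_const, Finset.card_univ, Fintype.card_fin, smul_eq_mul]
  have h5 : (F₁.size + 1) ^ 3 ≤ (m + 1) ^ 3 := Nat.pow_le_pow_left (by omega) 3
  have h6 : (F₂.size + 1) ^ 3 ≤ (m + 1) ^ 3 := Nat.pow_le_pow_left (by omega) 3
  have h7 : m + 1 ≤ (m + 1) ^ 3 := Nat.le_self_pow (by norm_num) _
  omega

theorem steps_maxT {α : Type} (g : α → ℝ) (l : List α) : (maxT g l).steps = l.length + 1 := by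
  induction l with
  | nil => rfl
  | cons x l ih => simp [maxT, ih]

theorem steps_boundPrim_le {V₁ V₂ : Type*} (F₁ : BiFiltration V₁) (F₂ : BiFiltration V₂)
    (kind : BoundKind) (X Y : ℝ) (B : ParamBox) (t : SliceType)
    (e : WithTop ℝ) : (boundPrim kind F₁ F₂ X Y B t e).steps ≤ 3 * (F₁.size + F₂.size + 1) := by
  cases kind
  · simp only [boundPrim, Timed.steps_bind, steps_maxT, List.length_finRange, Timed.steps_one]
    omega
  · simp only [boundPrim, Timed.steps_one]; omega

theorem steps_approxInit_le {V₁ V₂ : Type*} (F₁ : BiFiltration V₁) (F₂ : BiFiltration V₂) :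
    (approxInit F₁ F₂).steps ≤ 5 * (F₁.size + F₂.size + 1) := by
  simp only [approxInit, Timed.steps_bind, steps_maxT, List.length_finRange, Timed.steps_one]
  omega

/-- The constant is 62 for `evalPrim`, 3 for `boundPrim` and 2 for the updates of the state. -/
theorem steps_approxRound_le (kind : BoundKind) (ε : ℝ) (s : ApproxState) :
    (approxRound kind p ε F₁ F₂ s).steps ≤ 67 * (F₁.size + F₂.size + 1) ^ 3 := by
  have h7 : F₁.size + F₂.size + 1 ≤ (F₁.size + F₂.size + 1) ^ 3 :=
    Nat.le_self_pow (by norm_num) _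
  unfold approxRound
  split
  · simp
  · next B t rest _ =>
    have h1 := steps_evalPrim_le p F₁ F₂ t B.lamMid B.muMid
    have h2 := steps_boundPrim_le F₁ F₂ kind s.X s.Y B t
      (evalPrim p F₁ F₂ t B.lamMid B.muMid).val
    simp only [Timed.steps_bind, Timed.steps_one]
    split_ifs <;> simp only [Timed.steps_one] <;> omega

theorem steps_approxRun_le (kind : BoundKind) (ε : ℝ) (k : ℕ) :
    (approxRun kind p ε F₁ F₂ k).steps ≤ 67 * (k + 1) * (F₁.size + F₂.size + 1) ^ 3 := by
  induction k with
  | zero =>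
    have h7 : F₁.size + F₂.size + 1 ≤ (F₁.size + F₂.size + 1) ^ 3 :=
      Nat.le_self_pow (by norm_num) _
    have := steps_approxInit_le F₁ F₂
    rw [approxRun]
    omega
  | succ k ih =>
    have := steps_approxRound_le p F₁ F₂ kind ε (approxRun kind p ε F₁ F₂ k).val
    rw [approxRun, Timed.steps_bind]
    nlinarith

end Rounds

/-! ## Bounds for the slices -/

section SliceBounds

variable {V₁ V₂ : Type*} [DecidableEq V₁] [DecidableEq V₂] {p : ℕ}
  {F₁ : BiFiltration V₁} {F₂ : BiFiltration V₂}

/-- The critical values of `F` lie in `[0, X] × [0, Y]`. -/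
def BiFiltration.InRect {V : Type*} (F : BiFiltration V) (X Y : ℝ) : Prop :=
  ∀ i, 0 ≤ F.crit i ∧ F.crit i ≤ (X, Y)

theorem BiFiltration.InRect.wpush_mem {V : Type*} {F : BiFiltration V} {X Y : ℝ}
    (h : F.InRect X Y) (t : SliceType) {lam mu : ℝ} (h0 : 0 ≤ lam) (h1 : lam ≤ 1) (hmu : 0 ≤ mu)
    (i : Fin F.size) : wpush t lam mu (F.crit i) ∈ Set.Icc 0 (max X Y) :=
  wpush_mem_Icc t h0 h1 hmu (h i).1
    ((h i).2.trans (Prod.mk_le_mk.mpr ⟨le_max_left _ _, le_max_right _ _⟩))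

/-- All weighted pushes lie in `[0, max X Y]`, so by stability finiteness passes from one slice to
any other; a finite distance of such diagrams is at most `max X Y`. -/
theorem sliceDist_le_of_ne_top {X Y : ℝ} (h₁ : F₁.InRect X Y) (h₂ : F₂.InRect X Y)
    {t t' : SliceType} {lam mu lam' mu' : ℝ} (h0 : 0 ≤ lam) (h1 : lam ≤ 1) (hmu : 0 ≤ mu)
    (h0' : 0 ≤ lam') (h1' : lam' ≤ 1) (hmu' : 0 ≤ mu') (hne : sliceDist p F₁ F₂ t lam mu ≠ ⊤) :
    sliceDist p F₁ F₂ t' lam' mu' ≤ ENNReal.ofReal (max X Y) := by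
  refine FinComplex.bottleneckDist_diagram_le_of_bounded (h₁.wpush_mem t' h0' h1' hmu')
    (h₂.wpush_mem t' h0' h1' hmu') p ?_
  have habs : ∀ {a b C : ℝ}, a ∈ Set.Icc 0 C → b ∈ Set.Icc 0 C → |a - b| ≤ C := fun ha hb =>
    abs_le.mpr ⟨by linarith [ha.1, hb.2], by linarith [ha.2, hb.1]⟩
  refine ne_top_of_le_ne_top ?_ (FinComplex.bottleneckDist_le_add
    (f' := fun i => wpush t lam mu (F₁.crit i)) (g' := fun i => wpush t lam mu (F₂.crit i))
    (fun i => habs (h₁.wpush_mem t' h0' h1' hmu' i) (h₁.wpush_mem t h0 h1 hmu i))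
    (fun i => habs (h₂.wpush_mem t' h0' h1' hmu' i) (h₂.wpush_mem t h0 h1 hmu i)) p)
  exact ENNReal.add_ne_top.mpr
    ⟨ENNReal.add_ne_top.mpr ⟨ENNReal.ofReal_ne_top, hne⟩, ENNReal.ofReal_ne_top⟩

theorem matchingDist_le_of_inRect {X Y : ℝ} (hX : 0 ≤ X) (hY : 0 ≤ Y) (h₁ : F₁.InRect X Y)
    (h₂ : F₂.InRect X Y) {r : ℝ≥0∞} (hr : ∀ t lam mu, 0 ≤ lam → lam ≤ 1 → 0 ≤ mu →
      mu ≤ muBound X Y t → sliceDist p F₁ F₂ t lam mu ≤ r) : matchingDist p F₁ F₂ ≤ r :=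
  matchingDist_le p F₁ F₂ hX hY (fun i => (h₁ i).1) (fun i => (h₂ i).1) (fun i => (h₁ i).2)
    (fun i => (h₂ i).2) hr

theorem sliceDist_eq_top {X Y : ℝ} (hX : 0 ≤ X) (hY : 0 ≤ Y) (h₁ : F₁.InRect X Y)
    (h₂ : F₂.InRect X Y) (hD : matchingDist p F₁ F₂ = ⊤) {t : SliceType} {lam mu : ℝ}
    (h0 : 0 ≤ lam) (h1 : lam ≤ 1) (hmu : 0 ≤ mu) : sliceDist p F₁ F₂ t lam mu = ⊤ := by
  by_contra hne
  have := matchingDist_le_of_inRect hX hY h₁ h₂ (p := p) (r := ENNReal.ofReal (max X Y))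
    fun t' lam' mu' h0' h1' hmu' _ => sliceDist_le_of_ne_top h₁ h₂ h0 h1 hmu h0' h1' hmu' hne
  rw [hD] at this
  exact ENNReal.ofReal_ne_top (top_le_iff.mp this)

theorem sliceDist_le_max {X Y : ℝ} (h₁ : F₁.InRect X Y)
    (h₂ : F₂.InRect X Y) (hD : matchingDist p F₁ F₂ ≠ ⊤) {t : SliceType} {lam mu : ℝ}
    (h0 : 0 ≤ lam) (h1 : lam ≤ 1) (hmu : 0 ≤ mu) :
    sliceDist p F₁ F₂ t lam mu ≤ ENNReal.ofReal (max X Y) :=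
  -- Any genuine line serves as reference; the bound then includes the degenerate edge `lam = 0`.
  sliceDist_le_of_ne_top h₁ h₂ (t := .yFlat) (lam := 1 / 2) (mu := 0) (by norm_num) (by norm_num)
    le_rfl h0 h1 hmu (ne_top_of_le_ne_top hD
      (sliceDist_le_matchingDist p F₁ F₂ .yFlat 0 (by norm_num) (by norm_num)))

theorem val_maxT_nonneg {α : Type} (g : α → ℝ) (l : List α) : 0 ≤ (maxT g l).val := by
  induction l with
  | nil => exact le_rfl
  | cons x l ih => exact ih.trans (le_max_right _ _)

theorem le_val_maxT {α : Type} (g : α → ℝ) {l : List α} {x : α} (hx : x ∈ l) :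
    g x ≤ (maxT g l).val := by
  induction l with
  | nil => simp at hx
  | cons y l ih =>
    rcases List.mem_cons.mp hx with rfl | hx
    · exact le_max_left _ _
    · exact (ih hx).trans (le_max_right _ _)

theorem val_maxT_le {α : Type} {g : α → ℝ} {l : List α} {b : ℝ} (hb : 0 ≤ b)
    (h : ∀ x ∈ l, g x ≤ b) : (maxT g l).val ≤ b := by
  induction l with
  | nil => exact hb
  | cons y l ih =>
    exact max_le (h y List.mem_cons_self) (ih fun x hx => h x (List.mem_cons_of_mem _ hx))

/-- The bound of a box is its center value plus a bound for the variation. -/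
theorem val_boundPrim {X Y : ℝ} (hX : 0 ≤ X) (hY : 0 ≤ Y) (h₁ : F₁.InRect X Y)
    (h₂ : F₂.InRect X Y) (kind : BoundKind) {B : ParamBox} {t : SliceType}
    (hB : B.Regular X Y t) (e : ℝ) : ∃ v : ℝ,
      (boundPrim kind F₁ F₂ X Y B t (e : WithTop ℝ)).val = ((v + e : ℝ) : WithTop ℝ) ∧
      v ≤ 2 * (max X Y * (B.lamMax - B.lamMin)) ∧ 0 ≤ v ∧
      ∀ lam mu, lam ∈ Set.Icc B.lamMin B.lamMax → mu ∈ Set.Icc B.muMin B.muMax →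
        sliceDist p F₁ F₂ t lam mu ≤
          ENNReal.ofReal v + sliceDist p F₁ F₂ t B.lamMid B.muMid := by
  have hc0 := hB.constantVariation_nonneg hX hY
  have key : ∀ v₁ v₂ : ℝ, 0 ≤ v₁ → 0 ≤ v₂ → (∀ i, cornerVariation t B (F₁.crit i) ≤ v₁) →
      (∀ i, cornerVariation t B (F₂.crit i) ≤ v₂) → v₁ ≤ constantVariation t X Y B →
      v₂ ≤ constantVariation t X Y B → v₁ + v₂ ≤ 2 * (max X Y * (B.lamMax - B.lamMin)) ∧
      0 ≤ v₁ + v₂ ∧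
      ∀ lam mu, lam ∈ Set.Icc B.lamMin B.lamMax → mu ∈ Set.Icc B.muMin B.muMax →
        sliceDist p F₁ F₂ t lam mu ≤
          ENNReal.ofReal (v₁ + v₂) + sliceDist p F₁ F₂ t B.lamMid B.muMid := by
    intro v₁ v₂ hv₁ hv₂ hc₁ hc₂ hb₁ hb₂
    have hle := hB.constantVariation_le hX hY
    refine ⟨by linarith, by linarith, fun lam mu hlam hmu => ?_⟩
    rw [ENNReal.ofReal_add hv₁ hv₂, add_right_comm]
    exact FinComplex.bottleneckDist_le_add
      (fun i => (hB.abs_wpush_sub_le (h₁ i).1 hlam hmu).trans (hc₁ i))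
      (fun i => (hB.abs_wpush_sub_le (h₂ i).1 hlam hmu).trans (hc₂ i)) p
  cases kind with
  | linear =>
    refine ⟨_, ?_, key (maxT (fun i => cornerVariation t B (F₁.crit i)) (List.finRange F₁.size)).val
      (maxT (fun i => cornerVariation t B (F₂.crit i)) (List.finRange F₂.size)).val
      (val_maxT_nonneg _ _) (val_maxT_nonneg _ _)
      (fun i => le_val_maxT (fun i => cornerVariation t B (F₁.crit i)) (List.mem_finRange i))
      (fun i => le_val_maxT (fun i => cornerVariation t B (F₂.crit i)) (List.mem_finRange i))
      (val_maxT_le hc0 fun i _ => hB.cornerVariation_le hX hY (h₁ i).1 (h₁ i).2)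
      (val_maxT_le hc0 fun i _ => hB.cornerVariation_le hX hY (h₂ i).1 (h₂ i).2)⟩
    simp only [boundPrim, Timed.val_bind, Timed.val_one]
    rw [← WithTop.coe_add, ← WithTop.coe_add, add_right_comm]
  | constant =>
    refine ⟨_, ?_, key (constantVariation t X Y B) (constantVariation t X Y B) hc0 hc0
      (fun i => hB.cornerVariation_le hX hY (h₁ i).1 (h₁ i).2)
      (fun i => hB.cornerVariation_le hX hY (h₂ i).1 (h₂ i).2) le_rfl le_rfl⟩
    simp only [boundPrim, Timed.val_one]
    rw [← WithTop.coe_add, ← WithTop.coe_add, add_right_comm]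

end SliceBounds

/-! ## The main loop -/

namespace ParamBox

/-- The width of a box. -/
noncomputable def width (B : ParamBox) : ℝ := B.lamMax - B.lamMin

/-- The slice with parameters `(lam, mu)` belongs to the box. -/
def Contains (B : ParamBox) (lam mu : ℝ) : Prop :=
  lam ∈ Set.Icc B.lamMin B.lamMax ∧ mu ∈ Set.Icc B.muMin B.muMax

theorem width_of_mem_children {B B' : ParamBox} (h : B' ∈ B.children) :
    B'.width = B.width / 2 := by
  simp only [children, List.mem_cons, List.not_mem_nil, or_false] at h
  rcases h with rfl | rfl | rfl | rfl <;> simp only [width, lamMid] <;> ring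

theorem exists_children_contains {B : ParamBox} {lam mu : ℝ} (h : B.Contains lam mu) :
    ∃ B' ∈ B.children, B'.Contains lam mu := by
  obtain ⟨⟨h1, h2⟩, h3, h4⟩ := h
  simp only [children, List.mem_cons, List.not_mem_nil, or_false, exists_eq_or_imp,
    exists_eq_left, Contains, Set.mem_Icc]
  rcases le_total lam B.lamMid with h5 | h5 <;> rcases le_total mu B.muMid with h6 | h6 <;>
    simp [*]

variable {X Y : ℝ} {B B' : ParamBox} {t : SliceType}

theorem Regular.children (hX : 0 ≤ X) (hY : 0 ≤ Y) (hB : B.Regular X Y t)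
    (h : B' ∈ B.children) :
    B'.Regular X Y t ∧ ∀ lam mu, B'.Contains lam mu → B.Contains lam mu := by
  have h1 := hB.lam_nonneg
  have h2 := hB.lam_lt
  have h3 := hB.lam_le
  have h4 := hB.mu_nonneg
  have h5 := hB.mu_le
  have h6 := hB.height
  have h7 := hB.muMin_le_muMax hX hY
  simp only [ParamBox.children, List.mem_cons, List.not_mem_nil, or_false] at h
  rcases h with rfl | rfl | rfl | rfl <;>
    refine ⟨⟨?_, ?_, ?_, ?_, ?_, ?_⟩, fun lam mu => ?_⟩ <;>
    simp only [Contains, Set.mem_Icc, lamMid, muMid] <;>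
    first
    | linarith
    | exact fun ⟨⟨_, _⟩, _, _⟩ => ⟨⟨by linarith, by linarith⟩, by linarith, by linarith⟩

theorem Regular.contains_valid (hB : B.Regular X Y t) {lam mu : ℝ} (h : B.Contains lam mu) :
    0 ≤ lam ∧ lam ≤ 1 ∧ 0 ≤ mu :=
  ⟨hB.lam_nonneg.trans h.1.1, h.1.2.trans hB.lam_le, hB.mu_nonneg.trans h.2.1⟩

end ParamBox

section Loop

variable {V₁ V₂ : Type*} [DecidableEq V₁] [DecidableEq V₂]

/-- The invariant of the main loop; `ρ` is the largest distance encountered so far, and boxes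
have width at least `ω`. -/
structure LoopInvariant (p : ℕ) (F₁ : BiFiltration V₁) (F₂ : BiFiltration V₂) (ε X Y ω : ℝ)
    (s : ApproxState) (ρ : ℝ) : Prop where
  eq_X : s.X = X
  eq_Y : s.Y = Y
  eq_rho : s.rho = ρ
  rho_nonneg : 0 ≤ ρ
  rho_le : ENNReal.ofReal ρ ≤ matchingDist p F₁ F₂
  regular : ∀ b ∈ s.queue, b.1.Regular X Y b.2
  width_ge : ∀ b ∈ s.queue, ω ≤ b.1.width
  -- A queued box is a quarter of an evaluated box of twice its width, whose variation is at most 2C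
  -- times its own width; this gives the factor 4.
  upper : ∀ b ∈ s.queue, ∀ lam mu, b.1.Contains lam mu →
    sliceDist p F₁ F₂ b.2 lam mu ≤ ENNReal.ofReal (ρ + 4 * (max X Y * b.1.width))
  -- The effect of the FIFO order: the head is widest, and at most two consecutive levels of
  -- subdivision are present.
  sorted : s.queue.Pairwise fun a b => b.1.width ≤ a.1.width ∧ a.1.width ≤ 2 * b.1.width
  cover : ∀ t lam mu, 0 ≤ lam → lam ≤ 1 → 0 ≤ mu → mu ≤ muBound X Y t →
    sliceDist p F₁ F₂ t lam mu ≤ ENNReal.ofReal ((1 + ε) * ρ) ∨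
      ∃ b ∈ s.queue, b.2 = t ∧ b.1.Contains lam mu

/-- A bound for the number of rounds that are still needed. -/
noncomputable def potential (ω : ℝ) (q : List (ParamBox × SliceType)) : ℝ :=
  -- For width 2ʰω this is (4ʰ⁺¹ - 1)/3, the number of nodes of a full quadtree of height h.
  (q.map fun b => 4 / 3 * (b.1.width / ω) ^ 2 - 1 / 3).sum

variable {p : ℕ} {F₁ : BiFiltration V₁} {F₂ : BiFiltration V₂} {ε X Y ω : ℝ}

/-- The core of the analysis: subdivision happens only at width at least `2 * ω`, so children
respect the lower bound `ω`. This combines a small variation threshold relative to ρ with an upper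
bound for `d` from the queue. -/
theorem LoopInvariant.round (hX : 0 ≤ X) (hY : 0 ≤ Y) (h₁ : F₁.InRect X Y) (h₂ : F₂.InRect X Y)
    (kind : BoundKind) (hε : 0 < ε) (hω0 : 0 < ω) {d : ℝ} (hd : 0 < d)
    (hD : matchingDist p F₁ F₂ = ENNReal.ofReal d)
    (hω : 8 * (max X Y * (1 + ε)) * ω = ε * d) {s : ApproxState} {ρ : ℝ}
    (hs : LoopInvariant p F₁ F₂ ε X Y ω s ρ) (hq : s.queue ≠ []) :
    (∃ ρ', LoopInvariant p F₁ F₂ ε X Y ω (approxRound kind p ε F₁ F₂ s).val ρ') ∧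
      potential ω (approxRound kind p ε F₁ F₂ s).val.queue + 1 ≤ potential ω s.queue := by
  obtain ⟨⟨B, t⟩, rest, hqueue⟩ := List.exists_cons_of_ne_nil hq
  have hBmem : (B, t) ∈ s.queue := by rw [hqueue]; exact List.mem_cons_self
  have hrest : ∀ b ∈ rest, b ∈ s.queue := fun b hb => by
    rw [hqueue]; exact List.mem_cons_of_mem _ hb
  have hB : B.Regular X Y t := hs.regular _ hBmem
  obtain ⟨hmid0, hmid1⟩ := hB.lamMid_mem
  set C := max X Y with hC
  have hC0 : 0 ≤ C := hX.trans (le_max_left _ _)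
  have hw0 : 0 < B.width := sub_pos.mpr hB.lam_lt
  have hsorted := hs.sorted
  rw [hqueue, List.pairwise_cons] at hsorted
  -- the center value
  have heD := sliceDist_le_matchingDist p F₁ F₂ t B.muMid hmid0 hmid1
  obtain ⟨e, he⟩ : ∃ e : ℝ, (evalPrim p F₁ F₂ t B.lamMid B.muMid).val = e := by
    rcases h : (evalPrim p F₁ F₂ t B.lamMid B.muMid).val with _ | e
    · rw [← val_evalPrim, h, hD] at heD
      exact absurd (top_le_iff.mp heD) ENNReal.ofReal_ne_top
    · exact ⟨e, rfl⟩
  have he0 : 0 ≤ e := by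
    have := evalPrim_nonneg p F₁ F₂ t B.lamMid B.muMid
    rw [he] at this
    exact_mod_cast this
  have hslice : sliceDist p F₁ F₂ t B.lamMid B.muMid = ENNReal.ofReal e := by
    rw [← val_evalPrim, he, WithTop.toCost_coe]
  obtain ⟨v, hv, hvle, hv0, hvar⟩ := val_boundPrim (p := p) hX hY h₁ h₂ kind hB e
  rw [hslice] at hvar
  simp only [← ENNReal.ofReal_add hv0 he0] at hvar
  set ρ' := max ρ e with hρ'
  have hρρ' : ρ ≤ ρ' := le_max_left _ _
  have heρ' : e ≤ ρ' := le_max_right _ _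
  have hρ'0 : 0 ≤ ρ' := he0.trans heρ'
  have hρ'D : ENNReal.ofReal ρ' ≤ matchingDist p F₁ F₂ := by
    rcases max_choice ρ e with h | h
    · rw [hρ', h]; exact hs.rho_le
    · rw [hρ', h, ← hslice]; exact heD
  have hmaxrho : max s.rho (e : WithTop ℝ) = (ρ' : WithTop ℝ) := by
    rw [hs.eq_rho, hρ', WithTop.coe_max]
  have hround : (approxRound kind p ε F₁ F₂ s).val =
      if (1 + ε) * ρ' < v + e then
        { s with queue := rest ++ B.children.map (fun B' => (B', t)), rho := (ρ' : WithTop ℝ) }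
      else { s with queue := rest, rho := (ρ' : WithTop ℝ) } := by
    unfold approxRound
    split
    · next h => rw [hqueue] at h; simp at h
    · next B₀ t₀ rest₀ h =>
      rw [hqueue] at h
      obtain ⟨⟨rfl, rfl⟩, rfl⟩ : (B = B₀ ∧ t = t₀) ∧ rest = rest₀ := by simpa using h
      simp only [Timed.val_bind, Timed.val_one, he, hmaxrho, hs.eq_X, hs.eq_Y, hv]
      have : scaleUp ε (ρ' : WithTop ℝ) < ((v + e : ℝ) : WithTop ℝ) ↔ (1 + ε) * ρ' < v + e :=
        WithTop.coe_lt_coe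
      simp only [this]
      split_ifs <;> rfl
  have hupper : ∀ b ∈ rest, ∀ lam mu, b.1.Contains lam mu →
      sliceDist p F₁ F₂ b.2 lam mu ≤ ENNReal.ofReal (ρ' + 4 * (C * b.1.width)) :=
    fun b hb lam mu h => (hs.upper b (hrest b hb) lam mu h).trans
      (ENNReal.ofReal_le_ofReal (by linarith))
  have hcover : ∀ t lam mu, 0 ≤ lam → lam ≤ 1 → 0 ≤ mu → mu ≤ muBound X Y t →
      sliceDist p F₁ F₂ t lam mu ≤ ENNReal.ofReal ((1 + ε) * ρ') ∨
      ∃ b ∈ s.queue, b.2 = t ∧ b.1.Contains lam mu :=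
    fun t lam mu h0 h1 h2 h3 => (hs.cover t lam mu h0 h1 h2 h3).imp_left fun h =>
      h.trans (ENNReal.ofReal_le_ofReal (mul_le_mul_of_nonneg_left hρρ' (by linarith)))
  have hpot : potential ω s.queue =
      (4 / 3 * (B.width / ω) ^ 2 - 1 / 3) + potential ω rest := by
    rw [hqueue]; rfl
  rw [hround]
  split_ifs with hsub
  · -- the box is subdivided
    -- Settled slices are bounded by the first term, queued ones by the second, as no queued box is
    -- wider than the head `B`.
    have hdle : d ≤ max ((1 + ε) * ρ') (ρ' + 4 * (C * B.width)) := by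
      have h := matchingDist_le_of_inRect (p := p) hX hY h₁ h₂
        (r := ENNReal.ofReal (max ((1 + ε) * ρ') (ρ' + 4 * (C * B.width))))
        fun t lam mu h0 h1 h2 h3 => by
          rcases hcover t lam mu h0 h1 h2 h3 with h | ⟨b, hb, rfl, hbc⟩
          · exact h.trans (ENNReal.ofReal_le_ofReal (le_max_left _ _))
          · refine (hs.upper b hb lam mu hbc).trans (ENNReal.ofReal_le_ofReal
              (le_trans ?_ (le_max_right _ _)))
            have hwb : b.1.width ≤ B.width := by
              rw [hqueue] at hb
              rcases List.mem_cons.mp hb with rfl | hb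
              · exact le_rfl
              · exact (hsorted.1 b hb).1
            have := mul_le_mul_of_nonneg_left hwb hC0
            linarith
      rw [hD] at h
      exact (ENNReal.ofReal_le_ofReal_iff (le_max_of_le_left (by positivity))).mp h
    -- From `(1 + ε) * ρ' < v + e`, `e ≤ ρ'` and the bound for `v`.
    have hερ : ε * ρ' < 2 * (C * B.width) := by
      change v ≤ 2 * (C * B.width) at hvle
      linarith
    have hCw : 0 ≤ C * B.width := by positivity
    -- In the first case of `hdle`, εd ≤ (1 + ε)ερ' ≤ 2C(1 + ε)w; in the second, εd ≤ ερ' + 4εCw.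
    -- Both are at most 4C(1 + ε)w, while εd = 8C(1 + ε)ω.
    have hωw : 2 * ω ≤ B.width := by
      have hεd : ε * d ≤ 4 * (C * (1 + ε)) * B.width := by
        rcases le_max_iff.mp hdle with h | h
        · have h3 := mul_le_mul_of_nonneg_left h hε.le
          have h4 := mul_le_mul_of_nonneg_left hερ.le (by linarith : 0 ≤ 1 + ε)
          nlinarith [mul_nonneg hε.le hCw]
        · have h3 := mul_le_mul_of_nonneg_left h hε.le
          nlinarith
      have hCpos : 0 < C * (1 + ε) := by
        have : 0 < 8 * (C * (1 + ε)) * ω := by rw [hω]; positivity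
        have h8 := (pos_iff_pos_of_mul_pos this).mpr hω0
        linarith
      rw [← hω] at hεd
      nlinarith
    have hchild : ∀ b ∈ B.children.map (fun B' => (B', t)), b.2 = t ∧ b.1 ∈ B.children := by
      intro b hb
      obtain ⟨B', hB', rfl⟩ := List.mem_map.mp hb
      exact ⟨rfl, hB'⟩
    have hchildw : ∀ b ∈ B.children.map (fun B' => (B', t)), b.1.width = B.width / 2 :=
      fun b hb => ParamBox.width_of_mem_children (hchild b hb).2
    refine ⟨⟨ρ', hs.eq_X, hs.eq_Y, rfl, hρ'0, hρ'D, ?_, ?_, ?_, ?_, ?_⟩, ?_⟩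
    · intro b hb
      rcases List.mem_append.mp hb with h | h
      · exact hs.regular b (hrest b h)
      · obtain ⟨h3, h4⟩ := hchild b h
        rw [h3]
        exact (hB.children hX hY h4).1
    · intro b hb
      rcases List.mem_append.mp hb with h | h
      · exact hs.width_ge b (hrest b h)
      · rw [hchildw b h]; linarith
    · intro b hb lam mu hbc
      rcases List.mem_append.mp hb with h | h
      · exact hupper b h lam mu hbc
      · obtain ⟨h3, h4⟩ := hchild b h
        have hBc := (hB.children hX hY h4).2 lam mu hbc
        rw [h3, hchildw b h]
        refine (hvar lam mu hBc.1 hBc.2).trans (ENNReal.ofReal_le_ofReal ?_)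
        change v ≤ 2 * (C * B.width) at hvle
        linarith
    -- The other queued boxes have widths between half the width of `B` and the width of `B`, so
    -- quarters fit at the end.
    · refine List.pairwise_append.mpr ⟨hsorted.2, ?_, fun a ha b hb => ?_⟩
      · refine List.pairwise_of_forall_mem_list fun a ha b hb => ?_
        rw [hchildw a ha, hchildw b hb]
        constructor <;> linarith
      · have := hsorted.1 a ha
        rw [hchildw b hb]
        constructor <;> linarith [this.1, this.2]
    · intro t' lam mu h0 h1 h2 h3
      refine (hcover t' lam mu h0 h1 h2 h3).imp_right ?_
      rintro ⟨b, hb, rfl, hbc⟩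
      rw [hqueue] at hb
      rcases List.mem_cons.mp hb with rfl | hb
      · obtain ⟨B', hB', hc⟩ := ParamBox.exists_children_contains hbc
        exact ⟨(B', t), List.mem_append.mpr (Or.inr (List.mem_map.mpr ⟨B', hB', rfl⟩)), rfl, hc⟩
      · exact ⟨b, List.mem_append.mpr (Or.inl hb), rfl, hbc⟩
    · rw [hpot]
      have : potential ω (rest ++ B.children.map (fun B' => (B', t))) = potential ω rest +
          4 * (4 / 3 * (B.width / 2 / ω) ^ 2 - 1 / 3) := by
        have hw : ∀ B' ∈ B.children, B'.width = B.width / 2 :=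
          fun B' h => ParamBox.width_of_mem_children h
        unfold potential
        rw [List.map_append, List.sum_append, List.map_map]
        congr 1
        rw [List.map_congr_left (g := fun _ => 4 / 3 * (B.width / 2 / ω) ^ 2 - 1 / 3)
          fun B' h => by simp only [Function.comp, hw B' h]]
        simp only [ParamBox.children, List.map_cons, List.map_nil, List.sum_cons, List.sum_nil]
        ring
      rw [this]
      -- A node count is one plus four times that of a child: 4(x/3 - 1/3) + 1 = 4x/3 - 1/3.
      apply le_of_eq
      ring
  · -- the box is settled
    rw [not_lt] at hsub
    refine ⟨⟨ρ', hs.eq_X, hs.eq_Y, rfl, hρ'0, hρ'D, fun b hb => hs.regular b (hrest b hb),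
      fun b hb => hs.width_ge b (hrest b hb), hupper, hsorted.2, ?_⟩, ?_⟩
    · intro t' lam mu h0 h1 h2 h3
      rcases hcover t' lam mu h0 h1 h2 h3 with h | ⟨b, hb, rfl, hbc⟩
      · exact Or.inl h
      · rw [hqueue] at hb
        rcases List.mem_cons.mp hb with rfl | hb
        · exact Or.inl ((hvar lam mu hbc.1 hbc.2).trans (ENNReal.ofReal_le_ofReal hsub))
        · exact Or.inr ⟨b, hb, rfl, hbc⟩
    · rw [hpot]
      have h1 : 1 ≤ B.width / ω := (one_le_div hω0).mpr (hs.width_ge _ hBmem)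
      have h2 : 1 ≤ (B.width / ω) ^ 2 := one_le_pow₀ h1
      dsimp only
      linarith

theorem potential_nonneg (hω0 : 0 < ω) {q : List (ParamBox × SliceType)}
    (h : ∀ b ∈ q, ω ≤ b.1.width) : 0 ≤ potential ω q := by
  refine List.sum_nonneg fun x hx => ?_
  obtain ⟨b, hb, rfl⟩ := List.mem_map.mp hx
  have h1 : 1 ≤ b.1.width / ω := (one_le_div hω0).mpr (h b hb)
  have h2 : 1 ≤ (b.1.width / ω) ^ 2 := one_le_pow₀ h1
  linarith

theorem approxRound_of_queue_eq_nil (kind : BoundKind) {s : ApproxState} (h : s.queue = []) :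
    (approxRound kind p ε F₁ F₂ s).val = s := by
  unfold approxRound
  split
  · rfl
  · next h' => rw [h] at h'; simp at h'

end Loop

/-! ### Initialization, termination and the total number of rounds. -/

section Run

variable {V₁ V₂ : Type*} {F₁ : BiFiltration V₁} {F₂ : BiFiltration V₂}

theorem approxInit_spec (h₁ : ∀ i, 0 ≤ F₁.crit i) (h₂ : ∀ i, 0 ≤ F₂.crit i) : ∃ X Y : ℝ,
    (approxInit F₁ F₂).val = ⟨X, Y, [(⟨0, 1, 0, Y⟩, .ySteep), (⟨0, 1, 0, Y⟩, .yFlat),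
      (⟨0, 1, 0, X⟩, .xSteep), (⟨0, 1, 0, X⟩, .xFlat)], 0⟩ ∧
    0 ≤ X ∧ 0 ≤ Y ∧ X ≤ maxX F₁ F₂ ∧ Y ≤ maxY F₁ F₂ ∧ F₁.InRect X Y ∧ F₂.InRect X Y := by
  have hX₁ : ∀ i, (F₁.crit i).1 ≤ maxX F₁ F₂ := fun i =>
    le_ciSup (f := fun i : Fin F₁.size ⊕ Fin F₂.size =>
      Sum.elim (fun j => (F₁.crit j).1) (fun j => (F₂.crit j).1) i)
      (Set.finite_range _).bddAbove (Sum.inl i)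
  have hX₂ : ∀ i, (F₂.crit i).1 ≤ maxX F₁ F₂ := fun i =>
    le_ciSup (f := fun i : Fin F₁.size ⊕ Fin F₂.size =>
      Sum.elim (fun j => (F₁.crit j).1) (fun j => (F₂.crit j).1) i)
      (Set.finite_range _).bddAbove (Sum.inr i)
  have hY₁ : ∀ i, (F₁.crit i).2 ≤ maxY F₁ F₂ := fun i =>
    le_ciSup (f := fun i : Fin F₁.size ⊕ Fin F₂.size =>
      Sum.elim (fun j => (F₁.crit j).2) (fun j => (F₂.crit j).2) i)
      (Set.finite_range _).bddAbove (Sum.inl i)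
  have hY₂ : ∀ i, (F₂.crit i).2 ≤ maxY F₁ F₂ := fun i =>
    le_ciSup (f := fun i : Fin F₁.size ⊕ Fin F₂.size =>
      Sum.elim (fun j => (F₁.crit j).2) (fun j => (F₂.crit j).2) i)
      (Set.finite_range _).bddAbove (Sum.inr i)
  have hX : 0 ≤ maxX F₁ F₂ := Real.iSup_nonneg fun i => by
    rcases i with i | i
    exacts [(h₁ i).1, (h₂ i).1]
  have hY : 0 ≤ maxY F₁ F₂ := Real.iSup_nonneg fun i => by
    rcases i with i | i
    exacts [(h₁ i).2, (h₂ i).2]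
  refine ⟨_, _, rfl, (val_maxT_nonneg _ _).trans (le_max_left _ _),
    (val_maxT_nonneg _ _).trans (le_max_left _ _),
    max_le (val_maxT_le hX fun i _ => hX₁ i) (val_maxT_le hX fun i _ => hX₂ i),
    max_le (val_maxT_le hY fun i _ => hY₁ i) (val_maxT_le hY fun i _ => hY₂ i),
    fun i => ⟨h₁ i, Prod.mk_le_mk.mpr ⟨?_, ?_⟩⟩, fun i => ⟨h₂ i, Prod.mk_le_mk.mpr ⟨?_, ?_⟩⟩⟩
  · exact (le_val_maxT (fun i => (F₁.crit i).1) (List.mem_finRange i)).trans (le_max_left _ _)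
  · exact (le_val_maxT (fun i => (F₁.crit i).2) (List.mem_finRange i)).trans (le_max_left _ _)
  · exact (le_val_maxT (fun i => (F₂.crit i).1) (List.mem_finRange i)).trans (le_max_right _ _)
  · exact (le_val_maxT (fun i => (F₂.crit i).2) (List.mem_finRange i)).trans (le_max_right _ _)

variable [DecidableEq V₁] [DecidableEq V₂] {p : ℕ}

theorem diagram_of_size_eq_zero {V : Type*} [DecidableEq V] {K : FinComplex V} (h : K.size = 0)
    (f : Fin K.size → ℝ) : K.diagram f p = 0 := by
  have : IsEmpty (Fin K.size) := by rw [h]; infer_instance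
  simp [FinComplex.diagram]

/-- Needed to replace the factor (n + 1)³ of the step counts by 8n³. -/
theorem size_pos_of_matchingDist_pos (h : 0 < matchingDist p F₁ F₂) :
    1 ≤ F₁.size + F₂.size := by
  by_contra hcon
  have h1 : F₁.size = 0 := by omega
  have h2 : F₂.size = 0 := by omega
  refine h.ne' (le_antisymm (iSup_le fun L => ?_) zero_le)
  rw [diagram_of_size_eq_zero h1, diagram_of_size_eq_zero h2,
    le_antisymm Matchable.zero.bottleneckDist_le zero_le, mul_zero]

/-- If the matching distance is infinite, no box is subdivided. -/
theorem approxRound_of_eq_top {X Y : ℝ} (hX : 0 ≤ X) (hY : 0 ≤ Y) (h₁ : F₁.InRect X Y)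
    (h₂ : F₂.InRect X Y) (kind : BoundKind) (ε : ℝ) (hD : matchingDist p F₁ F₂ = ⊤)
    {X' Y' M : ℝ} (hM : 0 ≤ M) (t : SliceType) (rest : List (ParamBox × SliceType))
    (rho : WithTop ℝ) :
    (approxRound kind p ε F₁ F₂ ⟨X', Y', (⟨0, 1, 0, M⟩, t) :: rest, rho⟩).val =
      ⟨X', Y', rest, ⊤⟩ := by
  have he : (evalPrim p F₁ F₂ t (ParamBox.lamMid ⟨0, 1, 0, M⟩)
      (ParamBox.muMid ⟨0, 1, 0, M⟩)).val = ⊤ := by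
    have := val_evalPrim p F₁ F₂ t (ParamBox.lamMid ⟨0, 1, 0, M⟩) (ParamBox.muMid ⟨0, 1, 0, M⟩)
    rw [sliceDist_eq_top hX hY h₁ h₂ hD (by norm_num [ParamBox.lamMid])
      (by norm_num [ParamBox.lamMid]) (by simp only [ParamBox.muMid]; linarith)] at this
    rcases h : (evalPrim p F₁ F₂ t (ParamBox.lamMid ⟨0, 1, 0, M⟩)
      (ParamBox.muMid ⟨0, 1, 0, M⟩)).val with _ | e
    · rfl
    · rw [h] at this
      exact absurd this ENNReal.ofReal_ne_top
  unfold approxRound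
  simp only [Timed.val_bind, Timed.val_one, he, max_top_right]
  split_ifs with h
  · exact absurd (show scaleUp ε ⊤ < _ from h) not_top_lt
  · rfl

/-- Each of the four initial boxes has infinite center value and is dropped after one round. -/
theorem approxRun_of_eq_top (h₁ : ∀ i, 0 ≤ F₁.crit i) (h₂ : ∀ i, 0 ≤ F₂.crit i)
    (kind : BoundKind) (ε : ℝ) (hD : matchingDist p F₁ F₂ = ⊤) :
    (approxRun kind p ε F₁ F₂ 4).val.queue = [] ∧ (approxRun kind p ε F₁ F₂ 4).val.rho = ⊤ := by
  obtain ⟨X, Y, hinit, hX, hY, -, -, hR₁, hR₂⟩ := approxInit_spec h₁ h₂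
  simp only [approxRun, Timed.val_bind, hinit, approxRound_of_eq_top hX hY hR₁ hR₂ kind ε hD hX,
    approxRound_of_eq_top hX hY hR₁ hR₂ kind ε hD hY]
  exact ⟨trivial, trivial⟩

/-- Correctness of the main loop and a bound for the number of rounds. -/
theorem approxRun_of_ne_top (h₁ : ∀ i, 0 ≤ F₁.crit i) (h₂ : ∀ i, 0 ≤ F₂.crit i)
    (kind : BoundKind) {ε d : ℝ} (hε : 0 < ε) (hd : 0 < d)
    (hD : matchingDist p F₁ F₂ = ENNReal.ofReal d) :
    ∃ (k : ℕ) (ρ : ℝ), (approxRun kind p ε F₁ F₂ k).val.queue = [] ∧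
      (approxRun kind p ε F₁ F₂ k).val.rho = ρ ∧ 0 ≤ ρ ∧
      matchingDist p F₁ F₂ ≤ ENNReal.ofReal ((1 + ε) * ρ) ∧
      ENNReal.ofReal ρ ≤ matchingDist p F₁ F₂ ∧
      (k : ℝ) + 1 ≤ 344 * (max (maxX F₁ F₂) (maxY F₁ F₂) * (1 + ε) / (ε * d)) ^ 2 := by
  obtain ⟨X, Y, hinit, hX, hY, hXle, hYle, hR₁, hR₂⟩ := approxInit_spec h₁ h₂
  have hDne : matchingDist p F₁ F₂ ≠ ⊤ := by rw [hD]; exact ENNReal.ofReal_ne_top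
  set C := max X Y with hC
  have hC0 : 0 ≤ C := hX.trans (le_max_left _ _)
  have hslice : ∀ t lam mu, 0 ≤ lam → lam ≤ 1 → 0 ≤ mu →
      sliceDist p F₁ F₂ t lam mu ≤ ENNReal.ofReal C :=
    fun t lam mu h0 h1 h2 => sliceDist_le_max hR₁ hR₂ hDne h0 h1 h2
  have hdC : d ≤ C := by
    have h := matchingDist_le_of_inRect (p := p) hX hY hR₁ hR₂ (r := ENNReal.ofReal C)
      fun t lam mu h0 h1 h2 _ => hslice t lam mu h0 h1 h2
    rw [hD] at h
    exact (ENNReal.ofReal_le_ofReal_iff hC0).mp h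
  have hCpos : 0 < C := hd.trans_le hdC
  set Q := C * (1 + ε) / (ε * d) with hQ
  have hQ1 : 1 ≤ Q := by
    rw [hQ, one_le_div (by positivity)]
    nlinarith
  -- Equal to εd / (8C(1 + ε)), the least width a box can have.
  set ω := 1 / (8 * Q) with hωdef
  have hω0 : 0 < ω := by positivity
  have hω : 8 * (C * (1 + ε)) * ω = ε * d := by
    rw [hωdef, hQ]; field_simp
  have hω1 : ω ≤ 1 := by
    rw [hωdef, div_le_one (by positivity)]; linarith
  have hinv0 : LoopInvariant p F₁ F₂ ε X Y ω (approxRun kind p ε F₁ F₂ 0).val 0 := by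
    rw [approxRun, hinit]
    have hmem : ∀ b ∈ [((⟨0, 1, 0, Y⟩ : ParamBox), SliceType.ySteep), (⟨0, 1, 0, Y⟩, .yFlat),
        (⟨0, 1, 0, X⟩, .xSteep), (⟨0, 1, 0, X⟩, .xFlat)],
        b.1 = ⟨0, 1, 0, muBound X Y b.2⟩ := by
      simp [muBound]
    have hreg : ∀ b ∈ [((⟨0, 1, 0, Y⟩ : ParamBox), SliceType.ySteep), (⟨0, 1, 0, Y⟩, .yFlat),
        (⟨0, 1, 0, X⟩, .xSteep), (⟨0, 1, 0, X⟩, .xFlat)], b.1.Regular X Y b.2 := by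
      intro b hb
      rw [hmem b hb]
      exact ⟨le_rfl, one_pos, le_rfl, le_rfl, le_rfl, by ring⟩
    refine ⟨rfl, rfl, rfl, le_rfl, by simp, hreg, ?_, ?_, ?_, ?_⟩
    · intro b hb
      rw [hmem b hb]
      simpa [ParamBox.width] using hω1
    · intro b hb lam mu hc
      obtain ⟨h0, h1, h2⟩ := (hreg b hb).contains_valid hc
      refine (hslice b.2 lam mu h0 h1 h2).trans (ENNReal.ofReal_le_ofReal ?_)
      rw [hmem b hb]
      simp only [ParamBox.width]
      linarith
    · refine List.pairwise_of_forall_mem_list fun a ha b hb => ?_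
      rw [hmem a ha, hmem b hb]
      norm_num [ParamBox.width]
    · intro t lam mu h0 h1 h2 h3
      refine Or.inr ⟨(⟨0, 1, 0, muBound X Y t⟩, t), ?_, rfl, ⟨h0, h1⟩, h2, h3⟩
      cases t <;> simp [muBound]
  set Φ := potential ω (approxRun kind p ε F₁ F₂ 0).val.queue with hΦ
  -- Four boxes of width 1 with 1/ω = 8Q contribute less than 4 · (4/3) · 64 Q² = (1024/3) Q².
  have hΦQ : Φ ≤ 342 * Q ^ 2 := by
    rw [hΦ, approxRun, hinit]
    simp only [potential, ParamBox.width, List.map_cons, List.map_nil, List.sum_cons, List.sum_nil]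
    have : (1 - 0) / ω = 8 * Q := by rw [hωdef]; field_simp; ring
    rw [this]
    nlinarith
  have hrun : ∀ k : ℕ, (∃ ρ, LoopInvariant p F₁ F₂ ε X Y ω (approxRun kind p ε F₁ F₂ k).val ρ) ∧
      ((approxRun kind p ε F₁ F₂ k).val.queue = [] ∨
        potential ω (approxRun kind p ε F₁ F₂ k).val.queue + k ≤ Φ) := by
    intro k
    induction k with
    | zero => exact ⟨⟨0, hinv0⟩, Or.inr (by simp [hΦ])⟩
    | succ k ih =>
      obtain ⟨⟨ρ, hρ⟩, hk⟩ := ih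
      rw [approxRun, Timed.val_bind]
      by_cases hq : (approxRun kind p ε F₁ F₂ k).val.queue = []
      · rw [approxRound_of_queue_eq_nil kind hq]
        exact ⟨⟨ρ, hρ⟩, Or.inl hq⟩
      · obtain ⟨h3, h4⟩ := hρ.round hX hY hR₁ hR₂ kind hε hω0 hd hD hω hq
        refine ⟨h3, Or.inr ?_⟩
        have := hk.resolve_left hq
        push_cast
        linarith
  -- More rounds than the initial potential allows; a nonempty queue would have negative potential.
  obtain ⟨⟨ρ, hρ⟩, hk⟩ := hrun (⌊Φ⌋₊ + 1)
  have hΦ0 : 0 ≤ Φ := potential_nonneg hω0 hinv0.width_ge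
  have hempty : (approxRun kind p ε F₁ F₂ (⌊Φ⌋₊ + 1)).val.queue = [] := by
    refine hk.resolve_right fun h => ?_
    have h3 := potential_nonneg hω0 hρ.width_ge
    have h4 := Nat.lt_floor_add_one Φ
    push_cast at h
    linarith
  refine ⟨⌊Φ⌋₊ + 1, ρ, hempty, hρ.eq_rho, hρ.rho_nonneg, ?_, hρ.rho_le, ?_⟩
  · refine matchingDist_le_of_inRect hX hY hR₁ hR₂ fun t lam mu h0 h1 h2 h3 => ?_
    refine (hρ.cover t lam mu h0 h1 h2 h3).resolve_right ?_
    rintro ⟨b, hb, -⟩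
    rw [hempty] at hb
    exact List.not_mem_nil hb
  -- Here `k + 1 ≤ Φ + 2`, and `1 ≤ Q` absorbs the 2 into 344 = 342 + 2.
  · have h3 := Nat.floor_le hΦ0
    have h4 : Q ≤ max (maxX F₁ F₂) (maxY F₁ F₂) * (1 + ε) / (ε * d) := by
      rw [hQ]
      have : C ≤ max (maxX F₁ F₂) (maxY F₁ F₂) := max_le_max hXle hYle
      gcongr
    have h5 : Q ^ 2 ≤ (max (maxX F₁ F₂) (maxY F₁ F₂) * (1 + ε) / (ε * d)) ^ 2 := by gcongr
    push_cast
    nlinarith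

end Run

theorem mainTheorem6 :
    ∃ A : ℝ, ∀ (V₁ : Type u) (V₂ : Type v) [DecidableEq V₁] [DecidableEq V₂]
      (F₁ : BiFiltration V₁) (F₂ : BiFiltration V₂),
      (∀ i, 0 ≤ F₁.crit i) → (∀ i, 0 ≤ F₂.crit i) →
      ∀ (kind : BoundKind) (p : ℕ) (ε : ℝ), 0 < ε → 0 < matchingDist p F₁ F₂ →
      ∃ k : ℕ,
        (approxRun kind p ε F₁ F₂ k).val.queue = [] ∧
        (matchingDist p F₁ F₂ ≠ ⊤ →
          ((approxRun kind p ε F₁ F₂ k).steps : ℝ) ≤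
            A * ((F₁.size + F₂.size : ℕ) : ℝ) ^ 3 *
              (max (maxX F₁ F₂) (maxY F₁ F₂) * (1 + ε) /
                (ε * (matchingDist p F₁ F₂).toReal)) ^ 2) ∧
        (matchingDist p F₁ F₂ = ⊤ →
          ((approxRun kind p ε F₁ F₂ k).steps : ℝ) ≤
            A * ((F₁.size + F₂.size : ℕ) : ℝ) ^ 3) ∧
        matchingDist p F₁ F₂ ≤ (scaleUp ε (approxRun kind p ε F₁ F₂ k).val.rho).toCost ∧
        (scaleUp ε (approxRun kind p ε F₁ F₂ k).val.rho).toCost ≤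
          ENNReal.ofReal (1 + ε) * matchingDist p F₁ F₂ := by
  -- 67 is the cost per round, 344 comes from the number of rounds, and 8 from (n + 1)³ ≤ 8n³. In
  -- the infinite case `k + 1 = 5`, which is below 344.
  refine ⟨67 * 344 * 8, fun V₁ V₂ _ _ F₁ F₂ h₁ h₂ kind p ε hε hpos => ?_⟩
  have hn : (1 : ℝ) ≤ ((F₁.size + F₂.size : ℕ) : ℝ) := by
    exact_mod_cast size_pos_of_matchingDist_pos hpos
  have hsteps : ∀ k, ((approxRun kind p ε F₁ F₂ k).steps : ℝ) ≤
      67 * 8 * ((F₁.size + F₂.size : ℕ) : ℝ) ^ 3 * ((k : ℝ) + 1) := by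
    intro k
    have h3 : ((approxRun kind p ε F₁ F₂ k).steps : ℝ) ≤
        67 * ((k : ℝ) + 1) * (((F₁.size + F₂.size : ℕ) : ℝ) + 1) ^ 3 := by
      exact_mod_cast steps_approxRun_le p F₁ F₂ kind ε k
    have h4 : (((F₁.size + F₂.size : ℕ) : ℝ) + 1) ^ 3 ≤
        8 * ((F₁.size + F₂.size : ℕ) : ℝ) ^ 3 := by
      refine (pow_le_pow_left₀ (by positivity)
        (by linarith : _ ≤ 2 * ((F₁.size + F₂.size : ℕ) : ℝ)) 3).trans_eq ?_
      ring
    refine (h3.trans (mul_le_mul_of_nonneg_left h4 (by positivity))).trans_eq ?_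
    ring
  by_cases hD : matchingDist p F₁ F₂ = ⊤
  · obtain ⟨hq, hrho⟩ := approxRun_of_eq_top h₁ h₂ kind ε hD
    have hout : (scaleUp ε (approxRun kind p ε F₁ F₂ 4).val.rho).toCost = ⊤ := by
      rw [hrho]; rfl
    refine ⟨4, hq, fun h => absurd hD h, fun _ => (hsteps 4).trans ?_, ?_, ?_⟩
    · have : 0 ≤ ((F₁.size + F₂.size : ℕ) : ℝ) ^ 3 := by positivity
      push_cast at this ⊢
      linarith
    · rw [hout]; exact le_top
    · rw [hD, ENNReal.mul_top (by simpa using by linarith)]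
      exact le_top
  · have hd : 0 < (matchingDist p F₁ F₂).toReal := ENNReal.toReal_pos hpos.ne' hD
    obtain ⟨k, ρ, hq, hrho, hρ0, hle, hge, hk⟩ := approxRun_of_ne_top h₁ h₂ kind hε hd
      (ENNReal.ofReal_toReal hD).symm
    have hout : (scaleUp ε (approxRun kind p ε F₁ F₂ k).val.rho).toCost =
        ENNReal.ofReal ((1 + ε) * ρ) := by
      rw [hrho]; rfl
    refine ⟨k, hq, fun _ => (hsteps k).trans ?_, fun h => absurd h hD, hout ▸ hle, ?_⟩
    · refine (mul_le_mul_of_nonneg_left hk (by positivity)).trans_eq ?_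
      ring
    · rw [hout, ENNReal.ofReal_mul (by linarith)]
      exact mul_le_mul_right hge _
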